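/- **Setup.** Units with $\hbar=1$. Let $N$ be odd, $L,m_{\rm h},m_{\rm i}>0$. Consider $N$ spinless fermions with coordinates $x_1,\dots,x_N$ and one impurity with coordinate $x_{\rm i}$ on a ring of circumference $L$; the Hilbert space consists of the $L^2$ wave functions on the $(N+1)$-fold product of the ring that are antisymmetric in $x_1,\dots,x_N$. Put $k_{\rm F}=\frac{2\pi}{L}\frac{N-1}{2}$ and $q_0=\min\{k_{\rm F},\frac{m_{\rm i}}{m_{\rm h}}k_{\rm F}\}$. The interaction potential $U$ is a real potential on the ring with finite total weight, i.e. a finite signed Borel measure: an integrable function $U(x)$ stands for $U(x)\,dx$, and a contact potential $g\,\delta(x)$ is allowed; $\overline U=\int U(x)\,dx$ is its total mass. The Hamiltonian is $$H=H^0+V,\qquad H^0=\sum_{n=1}^N\frac{\hat p_n^2}{2m_{\rm h}}-C+\frac{\hat p_{\rm i}^2}{2m_{\rm i}},\qquad V=\sum_{n=1}^N U(x_n-x_{\rm i}),\qquad C=\frac{k_{\rm F}^2}{6m_{\rm h}}\frac{N(N+1)}{N-1},$$ with periodic boundary conditions, understood as the operator associated with the quadratic form of $H^0+V$ on the states of finite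 kinetic energy (with the continuous density of $x_n-x_{\rm i}$ used to evaluate $V$). Let $|{\rm FS}\rangle$ be the normalized Slater determinant of the plane waves with momenta $-k_{\rm F},-k_{\rm F}+\frac{2\pi}{L},\dots,k_{\rm F}$, let $p_0\in\frac{2\pi}{L}\mathbb Z$, let $|p_0\rangle$ be the normalized impurity plane wave of momentum $p_0$, and $|{\rm FS},p_0\rangle=|{\rm FS}\rangle\otimes|p_0\rangle$. **Theorem.** Let $0<p_0<q_0$ and assume that every eigenvalue of $H$ in the subspace of total momentum $p_0$ is nondegenerate there. Then the unitary group $e^{-iHt}$ generated by $H$ exists and is unique, the infinite-time momentum of the impurity $$p_\infty=\lim_{t\to\infty}\frac1t\int_0^t\langle{\rm FS},p_0|e^{iHt'}\hat p_{\rm i}e^{-iHt'}|{\rm FS},p_0\rangle\,dt'$$ is well defined (the expectation values, the integrals and the limit exist), and $$p_\infty\ \ge\ p_0-\frac{m_{\rm i}}{q_0-p_0}\Bigl(\langle{\rm FS},p_0|V|{\rm FS},p_0\rangle-\sum_E|\langle{\rm FS},p_0|\Psi_E\rangle|^2\langle\Psi_E|V|\Psi_E\rangle\Bigr),$$ where $E$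 runs over the eigenvalues of $H$ in the subspace of total momentum $p_0$, $\Psi_E$ is a normalized eigenvector for $E$ in this subspace, and the sum converges absolutely. If moreover $U\ge0$ everywhere, then $$p_\infty\ \ge\ p_0-\frac{m_{\rm i}k_{\rm F}\overline U}{\pi(q_0-p_0)}\,\frac{N}{N-1}.$$ -/

import Mathlib

open MeasureTheory Filter Topology
open scoped ComplexConjugate

noncomputable section

namespace ImpurityGas

/-- Configurations of `N` host particles (first component) and one impurity (second component) on a
ring of circumference `L`. -/
abbrev Config (N : ℕ) (L : ℝ) : Type := (Fin N → AddCircle L) × AddCircle L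

/-- Plane-wave labels: integers `(k, l)` stand for host momenta `(2π/L) k n` and impurity momentum
`(2π/L) l` (units with `ħ = 1`). -/
abbrev Mode (N : ℕ) : Type := (Fin N → ℤ) × ℤ

/-- The momentum `2πj/L` on the ring. -/
def ringMomentum (L : ℝ) (j : ℤ) : ℝ := 2 * Real.pi / L * j

/-- Fermi momentum `k_F = (2π/L)(N-1)/2`. -/
def fermiMomentum (N : ℕ) (L : ℝ) : ℝ := 2 * Real.pi / L * (((N : ℝ) - 1) / 2)

/-- `q₀ = min {k_F, (m_i/m_h) k_F}`. -/
def criticalMomentum (N : ℕ) (L mh mi : ℝ) : ℝ :=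
  min (fermiMomentum N L) (mi / mh * fermiMomentum N L)

/-- The constant `C = k_F² N (N+1) / (6 m_h (N-1))` subtracted from the host kinetic energy. -/
def hostShift (N : ℕ) (L mh : ℝ) : ℝ :=
  fermiMomentum N L ^ 2 / (6 * mh) * ((N : ℝ) * ((N : ℝ) + 1) / ((N : ℝ) - 1))

/-- Eigenvalue of `H⁰ = ∑ p̂ₙ²/(2m_h) - C + p̂ᵢ²/(2m_i)` on a plane wave. -/
def kineticEnergy {N : ℕ} (L mh mi : ℝ) (q : Mode N) : ℝ :=
  (∑ n, ringMomentum L (q.1 n) ^ 2 / (2 * mh) - hostShift N L mh)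
    + ringMomentum L q.2 ^ 2 / (2 * mi)

variable {N : ℕ} {L : ℝ} [Fact (0 < L)]

/-- Square-integrable wave functions `ψ(x₁, …, x_N; xᵢ)` (no symmetry imposed yet). -/
abbrev WaveFn (N : ℕ) (L : ℝ) [Fact (0 < L)] : Type :=
  Lp ℂ 2 (volume : Measure (Config N L))

/-- Normalized plane wave
`L^{-(N+1)/2} exp((2πi/L)(∑ₙ k n xₙ + l xᵢ))`, as a continuous function. -/
def planeWaveFun (q : Mode N) : C(Config N L, ℂ) where
  toFun x := ((Real.sqrt (L ^ (N + 1)))⁻¹ : ℝ) *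
    ((∏ n, fourier (q.1 n) (x.1 n)) * fourier q.2 x.2)
  continuous_toFun := by fun_prop

/-- Normalized plane wave as an element of `L²`. -/
def planeWave (q : Mode N) : WaveFn N L :=
  ContinuousMap.toLp 2 volume ℂ (planeWaveFun q)

/-- Momentum-space amplitude `⟨k, l | ψ⟩`. -/
def amplitude (ψ : WaveFn N L) (q : Mode N) : ℂ := inner ℂ (planeWave q) ψ

/-! ### Fermionic statistics -/

/-- Relabelling of the host particles. -/
def permuteConfig (σ : Equiv.Perm (Fin N)) (x : Config N L) : Config N L :=
  (fun n => x.1 (σ n), x.2)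

theorem measurePreserving_permuteConfig (σ : Equiv.Perm (Fin N)) :
    MeasurePreserving (permuteConfig (L := L) σ) volume volume := by
  have h := volume_measurePreserving_piCongrLeft (fun _ : Fin N => AddCircle L) σ.symm
  have h2 := h.prod (MeasurePreserving.id (volume : Measure (AddCircle L)))
  have e : permuteConfig (L := L) σ = Prod.map
      (MeasurableEquiv.piCongrLeft (fun _ : Fin N => AddCircle L) σ.symm) id := by
    funext x
    refine Prod.ext (funext fun n => ?_) rfl
    have := MeasurableEquiv.piCongrLeft_apply_apply (β := fun _ : Fin N => AddCircle L)
      σ.symm x.1 (σ n)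
    simpa [permuteConfig] using this.symm
  rw [e]
  exact h2

/-- The operator `(σψ)(x₁, …, x_N; xᵢ) = ψ(x_{σ 1}, …, x_{σ N}; xᵢ)`. -/
def permuteWave (σ : Equiv.Perm (Fin N)) : WaveFn N L →ₗ[ℂ] WaveFn N L :=
  Lp.compMeasurePreservingₗ ℂ (permuteConfig σ) (measurePreserving_permuteConfig σ)

/-- The Hilbert space of `N` spinless fermions plus one impurity: wave functions that are
antisymmetric in the host coordinates. -/
def FermiSpace (N : ℕ) (L : ℝ) [Fact (0 < L)] : Submodule ℂ (WaveFn N L) where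
  carrier := {ψ | ∀ σ : Equiv.Perm (Fin N),
    permuteWave σ ψ = ((Equiv.Perm.sign σ : ℤ) : ℂ) • ψ}
  add_mem' := fun ha hb σ => by rw [map_add, ha σ, hb σ, smul_add]
  zero_mem' := fun σ => by simp
  smul_mem' := fun c ψ h σ => by rw [map_smul, h σ, smul_comm]

/-- Host momenta of the Fermi sea (for odd `N`): `-(N-1)/2, …, (N-1)/2` in units of `2π/L`. -/
def fermiSeaModes (N : ℕ) (n : Fin N) : ℤ := (n : ℤ) - ((N : ℤ) - 1) / 2

/-- The state `|FS⟩ ⊗ |p₀⟩`, `p₀ = 2πj/L`: normalized Slater determinant of the Fermi-sea plane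
waves times the impurity plane wave. -/
def fermiSeaWave (N : ℕ) (L : ℝ) [Fact (0 < L)] (j : ℤ) : WaveFn N L :=
  ((Real.sqrt (N.factorial : ℝ))⁻¹ : ℂ) •
    ∑ σ : Equiv.Perm (Fin N), ((Equiv.Perm.sign σ : ℤ) : ℂ) •
      planeWave (fun n => fermiSeaModes N (σ n), j)

theorem permuteWave_planeWave (σ : Equiv.Perm (Fin N)) (q : Mode N) :
    permuteWave σ (planeWave (L := L) q) = planeWave (fun n => q.1 (σ.symm n), q.2) := by
  apply Lp.ext
  have h1 : permuteWave σ (planeWave (L := L) q) =ᵐ[volume]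
      (planeWave (L := L) q) ∘ permuteConfig σ :=
    Lp.coeFn_compMeasurePreserving _ (measurePreserving_permuteConfig σ)
  have h2 : (planeWave (L := L) q) =ᵐ[volume] planeWaveFun q :=
    ContinuousMap.coeFn_toLp _ _
  have h3 : (planeWave (L := L) (fun n => q.1 (σ.symm n), q.2)) =ᵐ[volume]
      planeWaveFun (fun n => q.1 (σ.symm n), q.2) :=
    ContinuousMap.coeFn_toLp _ _
  have h4 := (measurePreserving_permuteConfig (L := L) σ).quasiMeasurePreserving.ae_eq_comp h2
  filter_upwards [h1, h3, h4] with x hx1 hx3 hx4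
  rw [hx1, hx3, hx4]
  simp only [Function.comp_apply, planeWaveFun, ContinuousMap.coe_mk, permuteConfig]
  congr 2
  refine Fintype.prod_equiv σ _ _ fun n => ?_
  simp

theorem fermiSeaWave_mem (N : ℕ) (L : ℝ) [Fact (0 < L)] (j : ℤ) :
    fermiSeaWave N L j ∈ FermiSpace N L := by
  intro τ
  unfold fermiSeaWave
  rw [map_smul, map_sum, smul_comm]
  congr 1
  rw [Finset.smul_sum]
  refine Fintype.sum_equiv (Equiv.mulRight τ⁻¹) _ _ fun σ => ?_
  rw [map_smul, permuteWave_planeWave, smul_smul]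
  congr 1
  · have h : ((Equiv.Perm.sign τ : ℤ) : ℂ) * ((Equiv.Perm.sign τ : ℤ) : ℂ) = 1 := by
      rw [← Int.cast_mul, ← Units.val_mul, Int.units_mul_self]; simp
    simp only [Equiv.coe_mulRight, Equiv.Perm.sign_mul, Equiv.Perm.sign_inv, Units.val_mul,
      Int.cast_mul]
    linear_combination (-((Equiv.Perm.sign σ : ℤ) : ℂ)) * h

/-- The initial state `|FS, p₀⟩` with `p₀ = 2πj/L`. -/
def initialState (N : ℕ) (L : ℝ) [Fact (0 < L)] (j : ℤ) : FermiSpace N L :=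
  ⟨fermiSeaWave N L j, fermiSeaWave_mem N L j⟩

/-! ### The interaction

The potential `U` is a finite signed Borel measure on the ring: an integrable function `u` is the
measure `u(x) dx`, the contact potential `g δ(x)` is `g` times the Dirac mass at `0`. -/

/-- `∫ f dU` for a signed measure `U`. -/
def signedIntegral (U : SignedMeasure (AddCircle L)) (f : AddCircle L → ℂ) : ℂ :=
  ∫ y, f y ∂U.toJordanDecomposition.posPart - ∫ y, f y ∂U.toJordanDecomposition.negPart

/-- `ρ` is the continuous density of the relative coordinate `xₙ - xᵢ` under the complex measure
`conj φ(x) ψ(x) dx`. A continuous density is unique. -/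
def IsPairDensity (n : Fin N) (φ ψ : WaveFn N L) (ρ : C(AddCircle L, ℂ)) : Prop :=
  ∀ h : C(AddCircle L, ℂ),
    ∫ x : Config N L, h (x.1 n - x.2) * (conj (φ x) * ψ x) = ∫ y : AddCircle L, h y * ρ y

open Classical in
/-- The continuous density of `xₙ - xᵢ` under `conj φ ψ dx`. It exists whenever `φ` and `ψ` have
finite kinetic energy, the only case in which it is used (default value `0` otherwise). -/
def pairDensity (n : Fin N) (φ ψ : WaveFn N L) : C(AddCircle L, ℂ) :=
  if h : ∃ ρ, IsPairDensity n φ ψ ρ then h.choose else 0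

/-- Sesquilinear form `⟨φ|V̂|ψ⟩` of `V̂ = ∑ₙ U(xₙ - xᵢ)`. For `U = u(y) dy` it is
`∫ ∑ₙ u(xₙ - xᵢ) conj φ(x) ψ(x) dx`. -/
def potentialForm (U : SignedMeasure (AddCircle L)) (φ ψ : WaveFn N L) : ℂ :=
  ∑ n, signedIntegral U (pairDensity n φ ψ)

/-- Expectation value `⟨ψ|V̂|ψ⟩` (the form is Hermitian, so this is real). -/
def potentialEnergy (U : SignedMeasure (AddCircle L)) (ψ : WaveFn N L) : ℝ :=
  (potentialForm U ψ ψ).re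

/-! ### Hamiltonian -/

/-- Finite kinetic energy: `ψ` lies in the form domain of `H⁰`. -/
def FiniteKineticEnergy (mh mi : ℝ) (ψ : WaveFn N L) : Prop :=
  Summable fun q : Mode N => kineticEnergy L mh mi q * ‖amplitude ψ q‖ ^ 2

/-- Sesquilinear form `⟨φ|H⁰|ψ⟩`. -/
def kineticForm (mh mi : ℝ) (φ ψ : WaveFn N L) : ℂ :=
  ∑' q : Mode N, (kineticEnergy L mh mi q : ℂ) * (conj (amplitude φ q) * amplitude ψ q)

/-- `HamiltonianMaps mh mi U ψ χ` says that `ψ` is in the domain of `H = H⁰ + V̂` and `H ψ = χ`.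
Here `H` is the operator on the fermionic space associated with the quadratic form of `H⁰ + V̂` on
the states of finite kinetic energy. -/
def HamiltonianMaps (mh mi : ℝ) (U : SignedMeasure (AddCircle L)) (ψ χ : FermiSpace N L) : Prop :=
  FiniteKineticEnergy mh mi (ψ : WaveFn N L) ∧
  ∀ φ : FermiSpace N L, FiniteKineticEnergy mh mi (φ : WaveFn N L) →
    kineticForm mh mi (φ : WaveFn N L) ψ + potentialForm U (φ : WaveFn N L) ψ = inner ℂ φ χ

/-- `W t = exp(-i H t)`: the strongly continuous one-parameter unitary group whose generator is
`-i H`. -/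
structure IsEvolution (mh mi : ℝ) (U : SignedMeasure (AddCircle L))
    (W : ℝ → (FermiSpace N L ≃ₗᵢ[ℂ] FermiSpace N L)) : Prop where
  add : ∀ s t, W (s + t) = W s * W t
  continuous : ∀ ψ, Continuous fun t => W t ψ
  generator : ∀ ψ χ, HamiltonianMaps mh mi U ψ χ ↔
    HasDerivAt (fun t => W t ψ) (-Complex.I • χ) 0

/-! ### Eigenstates of given total momentum -/

/-- Total momentum `2πj/L`: only plane waves with `∑ₙ k n + l = j` occur in `ψ`. -/
def HasTotalMomentum (j : ℤ) (ψ : WaveFn N L) : Prop :=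
  ∀ q : Mode N, amplitude ψ q ≠ 0 → ∑ n, q.1 n + q.2 = j

/-- `ψ` has total momentum `2πj/L` and `H ψ = E ψ`. -/
def IsSectorEigenvector (mh mi : ℝ) (U : SignedMeasure (AddCircle L)) (j : ℤ) (E : ℝ)
    (ψ : FermiSpace N L) : Prop :=
  HasTotalMomentum j (ψ : WaveFn N L) ∧ HamiltonianMaps mh mi U ψ ((E : ℂ) • ψ)

/-- Eigenvalues of `H` in the sector of total momentum `2πj/L`. -/
def sectorEigenvalues (N : ℕ) (mh mi : ℝ) (U : SignedMeasure (AddCircle L)) (j : ℤ) : Set ℝ :=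
  {E | ∃ ψ : FermiSpace N L, ψ ≠ 0 ∧ IsSectorEigenvector mh mi U j E ψ}

/-- Every eigenvalue of `H` in the sector of total momentum `2πj/L` is nondegenerate. -/
def NondegenerateSector (N : ℕ) (mh mi : ℝ) (U : SignedMeasure (AddCircle L)) (j : ℤ) : Prop :=
  ∀ (E : ℝ) (ψ φ : FermiSpace N L), ψ ≠ 0 → IsSectorEigenvector mh mi U j E ψ →
    IsSectorEigenvector mh mi U j E φ → ∃ c : ℂ, φ = c • ψ

/-! ### Infinite-time momentum of the impurity -/

/-- `ψ` lies in the domain of the impurity momentum operator `p̂ᵢ`. -/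
def InMomentumDomain (ψ : WaveFn N L) : Prop :=
  Summable fun q : Mode N => ringMomentum L q.2 ^ 2 * ‖amplitude ψ q‖ ^ 2

/-- `⟨ψ|p̂ᵢ|ψ⟩`. -/
def meanMomentum (ψ : WaveFn N L) : ℝ :=
  ∑' q : Mode N, ringMomentum L q.2 * ‖amplitude ψ q‖ ^ 2

/-- `p` is the infinite-time momentum
`lim_{t → ∞} (1/t) ∫₀ᵗ ⟨ψ₀| exp(iHt') p̂ᵢ exp(-iHt') |ψ₀⟩ dt'`, all terms being well defined. -/
structure IsInfiniteTimeMomentum (W : ℝ → (FermiSpace N L ≃ₗᵢ[ℂ] FermiSpace N L))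
    (ψ₀ : FermiSpace N L) (p : ℝ) : Prop where
  domain : ∀ t, InMomentumDomain (W t ψ₀ : WaveFn N L)
  integrable : ∀ t, IntervalIntegrable (fun s => meanMomentum (W s ψ₀ : WaveFn N L)) volume 0 t
  tendsto : Tendsto (fun t : ℝ => t⁻¹ * ∫ s in (0 : ℝ)..t, meanMomentum (W s ψ₀ : WaveFn N L))
    atTop (𝓝 p)

end ImpurityGas

end

open ImpurityGas

/-!
The form of `H + Λ` is a small perturbation of the form of `H⁰ + 1`, so `(H + Λ)⁻¹ = J J†` for a
compact injection `J` of the form domain. Hence `H` has an orthonormal eigenbasis, which yields the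
unitary group and its uniqueness. Nondegeneracy in the sector of total momentum `p₀` removes the
oscillating terms from the time average of `⟨p̂ᵢ⟩`, so `p_∞` is the average of the eigenstate
momenta with the weights `|⟨FS, p₀|Ψ_E⟩|²`.

If the hosts carry momentum `P = p₀ - p` while the impurity carries `p`, Pauli exclusion bounds
their energy above the Fermi sea from below, and the total kinetic energy is at least
`p₀² / 2mᵢ + (q₀ - p₀) (p₀ - p) / mᵢ`. Averaging this over each eigenstate and then over the
eigenstates, and comparing with the conserved energy of the initial state, gives the first bound.
For `U ≥ 0` all eigenstates have nonnegative potential energy, while that of the initial state is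
`N Ū / L`.
-/

noncomputable section

namespace ImpurityGas

section SpectralTheory

open ContinuousLinearMap (adjoint adjoint_inner_left adjoint_inner_right)

variable {H : Type*} [NormedAddCommGroup H] [InnerProductSpace ℂ H]

theorem eq_of_forall_inner_hilbertBasis {ι : Type*} (b : HilbertBasis ι ℂ H) {x y : H}
    (h : ∀ i, inner ℂ (b i) x = inner ℂ (b i) y) : x = y := by
  apply b.repr.injective
  ext i
  rw [b.repr_apply_apply, b.repr_apply_apply, h i]

theorem exists_hilbertBasis_mem_of_orthogonalFamily [CompleteSpace H] {α : Type*}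
    {V : α → Submodule ℂ H} [∀ a, CompleteSpace (V a)]
    (hV : OrthogonalFamily ℂ (fun a => V a) fun a => (V a).subtypeₗᵢ) (htop : (⨆ a, V a)ᗮ = ⊥) :
    ∃ (w : ∀ a, Set (V a)) (b : HilbertBasis (Σ a, w a) ℂ H), ∀ i, b i ∈ V i.1 := by
  choose w bw _ using fun a => exists_hilbertBasis ℂ (V a)
  have horth : Orthonormal ℂ fun i : Σ a, w a => (bw i.1 i.2 : H) :=
    hV.orthonormal_sigma_orthonormal (v_family := fun a => bw a) fun a => (bw a).orthonormal
  have hspan : (Submodule.span ℂ (Set.range fun i : Σ a, w a => (bw i.1 i.2 : H)))ᗮ = ⊥ := by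
    rw [eq_bot_iff, ← htop]
    intro x hx
    have hxV : ∀ a, x ∈ (V a)ᗮ := fun a => by
      rw [← Submodule.orthogonalProjectionOnto_eq_zero_iff]
      refine eq_of_forall_inner_hilbertBasis (bw a) fun i => ?_
      rw [Submodule.inner_orthogonalProjectionOnto_eq_of_mem_left, inner_zero_right]
      exact (Submodule.mem_orthogonal _ _).1 hx _ (Submodule.subset_span ⟨⟨a, i⟩, rfl⟩)
    rw [← Submodule.iInf_orthogonal]
    exact (Submodule.mem_iInf _).2 hxV
  refine ⟨w, HilbertBasis.mkOfOrthogonalEqBot horth hspan, fun i => ?_⟩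
  rw [HilbertBasis.coe_mkOfOrthogonalEqBot]
  exact (bw i.1 i.2).2

theorem exists_hilbertBasis_eigenvectors.{u} {H : Type u} [NormedAddCommGroup H]
    [InnerProductSpace ℂ H] [CompleteSpace H] {T : H →L[ℂ] H} (hc : IsCompactOperator T)
    (hs : T.IsSymmetric) :
    ∃ (ι : Type u) (b : HilbertBasis ι ℂ H) (r : ι → ℝ), ∀ i, T (b i) = (r i : ℂ) • b i := by
  have hclosed : ∀ μ : ℂ, IsClosed (Module.End.eigenspace (T : Module.End ℂ H) μ : Set H) :=
    fun μ => by
      have heq : (Module.End.eigenspace (T : Module.End ℂ H) μ : Set H) = {x | T x = μ • x} := by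
        ext x; simp
      rw [heq]
      exact isClosed_eq T.continuous (continuous_const_smul μ)
  have : ∀ μ : ℂ, CompleteSpace (Module.End.eigenspace (T : Module.End ℂ H) μ) :=
    fun μ => (hclosed μ).completeSpace_coe
  obtain ⟨w, b, hb⟩ := exists_hilbertBasis_mem_of_orthogonalFamily
    (LinearMap.IsSymmetric.orthogonalFamily_eigenspaces hs)
    (ContinuousLinearMap.orthogonalComplement_iSup_eigenspaces_eq_bot hc hs)
  refine ⟨_, b, fun i => i.1.re, fun i => ?_⟩
  have hreal : conj i.1 = i.1 := LinearMap.IsSymmetric.conj_eigenvalue_eq_self hs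
    (Module.End.hasEigenvalue_of_hasEigenvector ⟨hb i, b.orthonormal.ne_zero i⟩)
  rw [Complex.conj_eq_iff_re.1 hreal]
  exact Module.End.mem_eigenspace_iff.1 (hb i)

theorem eq_zero_of_forall_inner_eigenvector_eq_zero [CompleteSpace H] {G : H →L[ℂ] H}
    (hc : IsCompactOperator G) (hs : G.IsSymmetric) {M : Submodule ℂ H}
    (hM : IsClosed (M : Set H)) (hinv : ∀ x ∈ M, G x ∈ M) {x : H} (hx : x ∈ M)
    (horth : ∀ (μ : ℝ), ∀ y ∈ M, G y = (μ : ℂ) • y → inner ℂ y x = 0) : x = 0 := by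
  have : CompleteSpace M := hM.completeSpace_coe
  let GM : M →L[ℂ] M := G.restrict hinv
  have hGMc : IsCompactOperator GM := hc.restrict' hinv
  have hGMs : GM.IsSymmetric := LinearMap.IsSymmetric.restrict_invariant hs hinv
  obtain ⟨ι, b, r, hb⟩ := exists_hilbertBasis_eigenvectors hGMc hGMs
  have hzero : (⟨x, hx⟩ : M) = 0 := eq_of_forall_inner_hilbertBasis b fun i => by
    rw [inner_zero_right]
    exact horth (r i) (b i) (b i).2 (congrArg Subtype.val (hb i))
  exact congrArg Subtype.val hzero

theorem hasSum_inner_smul_of_forall_inner_eq_zero [CompleteSpace H] {ι : Type*} {f : ι → H}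
    (hf : Orthonormal ℂ f) {M : Submodule ℂ H} (hM : IsClosed (M : Set H)) (hfM : ∀ i, f i ∈ M)
    (htot : ∀ x ∈ M, (∀ i, inner ℂ (f i) x = 0) → x = 0) {x : H} (hx : x ∈ M) :
    HasSum (fun i => inner ℂ (f i) x • f i) x := by
  have : CompleteSpace M := hM.completeSpace_coe
  let fM : ι → M := fun i => ⟨f i, hfM i⟩
  have hfMo : Orthonormal ℂ fM := hf
  have hspan : (Submodule.span ℂ (Set.range fM))ᗮ = ⊥ := by
    rw [eq_bot_iff]
    intro y hy
    exact Subtype.ext (htot y y.2 fun i =>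
      (Submodule.mem_orthogonal _ _).1 hy _ (Submodule.subset_span ⟨i, rfl⟩))
  have h := M.subtypeL.hasSum
    ((HilbertBasis.mkOfOrthogonalEqBot hfMo hspan).hasSum_repr ⟨x, hx⟩)
  simpa [Function.comp_def, HilbertBasis.repr_apply_apply, fM] using h

/-- The relation `A ψ = χ` for the self-adjoint operator `A` with eigenvalues `E i` in the
Hilbert basis `b`. Membership of `ψ` in the domain is part of the relation, because the
coefficients of `χ` are square summable. -/
def DiagonalMaps {ι : Type*} (b : HilbertBasis ι ℂ H) (E : ι → ℝ) (ψ χ : H) : Prop :=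
  ∀ i, inner ℂ (b i) χ = E i * inner ℂ (b i) ψ

variable [CompleteSpace H] {K : Type*} [NormedAddCommGroup K] [InnerProductSpace ℂ K]
  [CompleteSpace K]

/-- The relation `A ψ = χ` for the operator `A` of a semibounded closed form. Here `J` is the
inclusion of the form domain `K`, whose inner product is the form shifted by `Λ`, so that
`A + Λ` is the inverse of `J J†`. -/
def FormOperatorMaps (J : K →L[ℂ] H) (Λ : ℝ) (ψ χ : H) : Prop :=
  ψ = J (adjoint J (χ + (Λ : ℂ) • ψ))

theorem isSymmetric_comp_adjoint (J : K →L[ℂ] H) : (J ∘L adjoint J).IsSymmetric := fun x y => by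
  change inner ℂ (J (adjoint J x)) y = inner ℂ x (J (adjoint J y))
  rw [← adjoint_inner_right, adjoint_inner_left]

theorem comp_adjoint_injective {J : K →L[ℂ] H} (hd : DenseRange J) :
    Function.Injective (J ∘L adjoint J) := by
  rw [injective_iff_map_eq_zero]
  intro x hx
  have hadj : adjoint J x = 0 := by
    rw [← inner_self_eq_zero (𝕜 := ℂ), adjoint_inner_right]
    exact (congrArg (fun y => inner ℂ y x) hx).trans (inner_zero_left x)
  exact hd.eq_zero_of_inner_left ℂ fun y => by
    rw [← adjoint_inner_left, hadj, inner_zero_left]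

theorem exists_diagonalization.{u} {H : Type u} [NormedAddCommGroup H] [InnerProductSpace ℂ H]
    [CompleteSpace H] {J : K →L[ℂ] H} (hc : IsCompactOperator J) (hd : DenseRange J) (Λ : ℝ) :
    ∃ (ι : Type u) (b : HilbertBasis ι ℂ H) (E : ι → ℝ), ∀ ψ χ,
      FormOperatorMaps J Λ ψ χ ↔ DiagonalMaps b E ψ χ := by
  have hsymm := isSymmetric_comp_adjoint J
  obtain ⟨ι, b, r, hr⟩ := exists_hilbertBasis_eigenvectors (hc.comp_clm (adjoint J)) hsymm
  have hr0 : ∀ i, (r i : ℂ) ≠ 0 := fun i h0 => by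
    refine b.orthonormal.ne_zero i (comp_adjoint_injective hd ?_)
    rw [hr, h0, zero_smul, map_zero]
  have hinner : ∀ i x, inner ℂ (b i) (J (adjoint J x)) = r i * inner ℂ (b i) x := fun i x => by
    calc inner ℂ (b i) (J (adjoint J x)) = inner ℂ ((J ∘L adjoint J) (b i)) x :=
          (hsymm (b i) x).symm
      _ = r i * inner ℂ (b i) x := by rw [hr, inner_smul_left, Complex.conj_ofReal]
  refine ⟨ι, b, fun i => (r i)⁻¹ - Λ, fun ψ χ => ?_⟩
  have hcoord : FormOperatorMaps J Λ ψ χ ↔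
      ∀ i, inner ℂ (b i) ψ = r i * (inner ℂ (b i) χ + Λ * inner ℂ (b i) ψ) := by
    simp only [← inner_smul_right, ← inner_add_right, ← hinner]
    exact ⟨fun h i => congrArg _ h, fun h => eq_of_forall_inner_hilbertBasis b h⟩
  rw [hcoord]
  refine forall_congr' fun i => ?_
  have := hr0 i
  push_cast
  field_simp
  constructor <;> intro h <;> linear_combination -h

end SpectralTheory

section UnitaryGroup

variable {H : Type*} [NormedAddCommGroup H] [InnerProductSpace ℂ H]

/-- The phase `exp(-iEt)` acquired in time `t` by an eigenstate of energy `E`. -/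
def phase (E t : ℝ) : Circle := Circle.exp (-(E * t))

theorem phase_zero_right (E : ℝ) : phase E 0 = 1 := by simp [phase]

theorem phase_add_right (E s t : ℝ) : phase E (s + t) = phase E s * phase E t := by
  simp only [phase, mul_add, neg_add, Circle.exp_add]

theorem conj_phase_mul_phase (E F t : ℝ) :
    conj (phase E t : ℂ) * phase F t = phase (F - E) t := by
  rw [← Circle.coe_inv_eq_conj, ← Circle.coe_mul]
  simp only [phase, ← Circle.exp_neg, ← Circle.exp_add]
  congr 2
  ring

theorem hasDerivAt_phase (E t : ℝ) :
    HasDerivAt (fun t => (phase E t : ℂ)) (-Complex.I * E * phase E t) t := by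
  have h : HasDerivAt (fun t : ℝ => ((-(E * t) : ℝ) : ℂ) * Complex.I) (-E * Complex.I) t := by
    simpa using (((hasDerivAt_id t).const_mul E).neg.ofReal_comp).mul_const Complex.I
  refine h.cexp.congr_deriv ?_
  rw [phase, Circle.coe_exp]
  ring

@[fun_prop]
theorem continuous_phase (E : ℝ) : Continuous fun t => (phase E t : ℂ) :=
  continuous_iff_continuousAt.2 fun t => (hasDerivAt_phase E t).continuousAt

theorem norm_sum_smul_sq_le {ι : Type*} {f : ι → H} (hf : Orthonormal ℂ f) {c : ι → ℂ} {a : ι → ℝ}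
    (hc : ∀ i, ‖c i‖ ^ 2 ≤ a i) (s : Finset ι) : ‖∑ i ∈ s, c i • f i‖ ^ 2 ≤ ∑ i ∈ s, a i := by
  have heq : ‖∑ i ∈ s, c i • f i‖ ^ 2 = ∑ i ∈ s, ‖c i‖ ^ 2 := by
    have := hf.inner_sum c c s
    rw [inner_self_eq_norm_sq_to_K] at this
    simp only [Complex.conj_mul'] at this
    apply Complex.ofReal_injective
    push_cast
    exact this
  exact heq.trans_le (Finset.sum_le_sum fun i _ => hc i)

theorem tendstoUniformly_sum_smul_orthonormal [CompleteSpace H] {ι X : Type*} {f : ι → H}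
    (hf : Orthonormal ℂ f) {c : ι → X → ℂ} {a : ι → ℝ} (ha : Summable a)
    (hc : ∀ i x, ‖c i x‖ ^ 2 ≤ a i) :
    TendstoUniformly (fun s x => ∑ i ∈ s, c i x • f i) (fun x => ∑' i, c i x • f i) atTop := by
  classical
  have htail : ∀ ε > 0, ∃ s₀ : Finset ι, ∀ s, Disjoint s s₀ → ∀ x,
      ‖∑ i ∈ s, c i x • f i‖ < ε := fun ε hε => by
    obtain ⟨s₀, hs₀⟩ := summable_iff_vanishing_norm.1 ha (ε ^ 2) (by positivity)
    refine ⟨s₀, fun s hs x => lt_of_pow_lt_pow_left₀ 2 hε.le ?_⟩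
    exact (norm_sum_smul_sq_le hf (fun i => hc i x) s).trans_lt
      ((le_abs_self _).trans_lt (hs₀ s hs))
  have hsum : ∀ x, Summable fun i => c i x • f i := fun x =>
    summable_iff_vanishing_norm.2 fun ε hε =>
      (htail ε hε).imp fun s₀ hs₀ s hs => hs₀ s hs x
  rw [Metric.tendstoUniformly_iff]
  intro ε hε
  obtain ⟨s₀, hs₀⟩ := htail (ε / 2) (by positivity)
  filter_upwards [eventually_ge_atTop s₀] with s hs x
  have hlim : Tendsto (fun t : Finset ι => ‖∑ i ∈ t, c i x • f i - ∑ i ∈ s, c i x • f i‖) atTop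
      (𝓝 ‖∑' i, c i x • f i - ∑ i ∈ s, c i x • f i‖) := ((hsum x).hasSum.sub_const _).norm
  have hle : ∀ᶠ t : Finset ι in atTop,
      ‖∑ i ∈ t, c i x • f i - ∑ i ∈ s, c i x • f i‖ ≤ ε / 2 := by
    filter_upwards [eventually_ge_atTop s] with t ht
    rw [← Finset.sum_sdiff ht, add_sub_cancel_right]
    exact (hs₀ _ (Finset.disjoint_of_subset_right hs Finset.sdiff_disjoint) x).le
  rw [dist_eq_norm]
  linarith [le_of_tendsto hlim hle]

/-- `W` is the strongly continuous one-parameter unitary group whose generator is `-i A`, the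
operator `A` being given by its graph. -/
structure IsUnitaryGroup (A : H → H → Prop) (W : ℝ → (H ≃ₗᵢ[ℂ] H)) : Prop where
  add : ∀ s t, W (s + t) = W s * W t
  continuous : ∀ ψ, Continuous fun t => W t ψ
  generator : ∀ ψ χ, A ψ χ ↔ HasDerivAt (fun t => W t ψ) (-Complex.I • χ) 0

namespace IsUnitaryGroup

variable {A : H → H → Prop} {W : ℝ → (H ≃ₗᵢ[ℂ] H)}

theorem apply_zero (hW : IsUnitaryGroup A W) : W 0 = 1 :=
  (left_eq_mul (a := W 0)).1 (by rw [← hW.add, add_zero])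

theorem hasDerivAt (hW : IsUnitaryGroup A W) {ψ χ : H} (hA : A ψ χ) (t : ℝ) :
    HasDerivAt (fun t => W t ψ) (W t (-Complex.I • χ)) t := by
  have hshift : (fun s => W s ψ) = fun s => W t (W (s - t) ψ) := by
    funext s
    calc W s ψ = (W (t + (s - t))) ψ := by rw [add_sub_cancel]
      _ = W t (W (s - t) ψ) := by rw [hW.add]; rfl
  rw [hshift]
  refine ((W t).toContinuousLinearEquiv.toContinuousLinearMap.restrictScalars
    ℝ).hasFDerivAt.comp_hasDerivAt t (HasDerivAt.comp_sub_const (f := fun s => W s ψ) t t ?_)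
  rw [sub_self]
  exact (hW.generator ψ χ).1 hA

theorem apply_eigenvector (hW : IsUnitaryGroup A W) {ψ : H} {E : ℝ} (hA : A ψ ((E : ℂ) • ψ))
    (t : ℝ) : W t ψ = (phase E t : ℂ) • ψ := by
  have hconst : ∀ s, HasDerivAt (fun s => (phase (-E) s : ℂ) • W s ψ) 0 s := fun s => by
    convert (hasDerivAt_phase (-E) s).fun_smul (hW.hasDerivAt hA s) using 1
    simp only [map_smul, smul_smul, ← add_smul]
    push_cast
    rw [show (phase (-E) s : ℂ) * (-Complex.I * E) + -Complex.I * -E * phase (-E) s = 0 by ring,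
      zero_smul]
  have hval := is_const_of_deriv_eq_zero (fun s => (hconst s).differentiableAt)
    (fun s => (hconst s).deriv) t 0
  have hcancel : (phase E t : ℂ) * phase (-E) t = 1 := by
    rw [← Circle.coe_mul, phase, phase, ← Circle.exp_add]
    simp
  simp only [hW.apply_zero, phase_zero_right, Circle.coe_one, one_smul,
    LinearIsometryEquiv.coe_one, id_eq] at hval
  rw [← hval, smul_smul, hcancel, one_smul, hval]

end IsUnitaryGroup

variable [CompleteSpace H] {ι : Type*}

theorem exists_unitary_inner_eq_mul (b : HilbertBasis ι ℂ H) (z : ι → Circle) :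
    ∃ W : H ≃ₗᵢ[ℂ] H, ∀ i ψ, inner ℂ (b i) (W ψ) = z i * inner ℂ (b i) ψ := by
  classical
  have horth : Orthonormal ℂ fun i => (z i : ℂ) • b i := by
    rw [orthonormal_iff_ite]
    intro i j
    rw [inner_smul_left, inner_smul_right, orthonormal_iff_ite.1 b.orthonormal i j]
    split_ifs with h
    · simp [h, Complex.conj_mul', Circle.norm_coe]
    · simp
  have hspan : (Submodule.span ℂ (Set.range fun i => (z i : ℂ) • b i))ᗮ = ⊥ := by
    rw [eq_bot_iff]
    intro x hx
    refine eq_of_forall_inner_hilbertBasis b fun i => ?_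
    have h := (Submodule.mem_orthogonal _ _).1 hx _ (Submodule.subset_span ⟨i, rfl⟩)
    rw [inner_smul_left] at h
    rw [inner_zero_right]
    exact (mul_eq_zero.1 h).resolve_left (by simp)
  let b' := HilbertBasis.mkOfOrthogonalEqBot horth hspan
  refine ⟨b.repr.trans b'.repr.symm, fun i ψ => ?_⟩
  have hcoef : inner ℂ ((z i : ℂ) • b i) (b'.repr.symm (b.repr ψ)) = inner ℂ (b i) ψ := by
    have hb' : b' i = (z i : ℂ) • b i :=
      congrFun (HilbertBasis.coe_mkOfOrthogonalEqBot horth hspan) i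
    rw [← hb', ← b'.repr_apply_apply, LinearIsometryEquiv.apply_symm_apply, b.repr_apply_apply]
  have hz : (z i : ℂ) * conj (z i : ℂ) = 1 := by simp [Complex.mul_conj', Circle.norm_coe]
  rw [← hcoef, inner_smul_left, ← mul_assoc, hz, one_mul]
  rfl

/-- The unitary group `exp(-iAt)` of the operator `A` with eigenvalues `E i` in the Hilbert
basis `b`. -/
def diagonalGroup (b : HilbertBasis ι ℂ H) (E : ι → ℝ) (t : ℝ) : H ≃ₗᵢ[ℂ] H :=
  (exists_unitary_inner_eq_mul b fun i => phase (E i) t).choose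

theorem inner_diagonalGroup (b : HilbertBasis ι ℂ H) (E : ι → ℝ) (t : ℝ) (i : ι) (ψ : H) :
    inner ℂ (b i) (diagonalGroup b E t ψ) = phase (E i) t * inner ℂ (b i) ψ :=
  (exists_unitary_inner_eq_mul b fun i => phase (E i) t).choose_spec i ψ

theorem diagonalGroup_add (b : HilbertBasis ι ℂ H) (E : ι → ℝ) (s t : ℝ) :
    diagonalGroup b E (s + t) = diagonalGroup b E s * diagonalGroup b E t := by
  ext ψ
  refine eq_of_forall_inner_hilbertBasis b fun i => ?_
  change _ = inner ℂ (b i) (diagonalGroup b E s (diagonalGroup b E t ψ))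
  rw [inner_diagonalGroup, inner_diagonalGroup, inner_diagonalGroup, phase_add_right,
    Circle.coe_mul, mul_assoc]

theorem diagonalGroup_zero (b : HilbertBasis ι ℂ H) (E : ι → ℝ) (ψ : H) :
    diagonalGroup b E 0 ψ = ψ :=
  eq_of_forall_inner_hilbertBasis b fun i => by
    rw [inner_diagonalGroup, phase_zero_right, Circle.coe_one, one_mul]

theorem continuous_diagonalGroup (b : HilbertBasis ι ℂ H) (E : ι → ℝ) (ψ : H) :
    Continuous fun t => diagonalGroup b E t ψ := by
  have hseries : (fun t => diagonalGroup b E t ψ) =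
      fun t => ∑' i, ((phase (E i) t : ℂ) * inner ℂ (b i) ψ) • b i := by
    funext t
    rw [← (b.hasSum_repr (diagonalGroup b E t ψ)).tsum_eq]
    simp only [b.repr_apply_apply, inner_diagonalGroup]
  rw [hseries]
  refine (tendstoUniformly_sum_smul_orthonormal b.orthonormal
    (b.orthonormal.inner_products_summable (x := ψ)) fun i t => ?_).continuous
    (Frequently.of_forall fun s => by fun_prop)
  rw [norm_mul, Circle.norm_coe, one_mul]

theorem hasDerivAt_diagonalGroup (b : HilbertBasis ι ℂ H) {E : ι → ℝ} {ψ χ : H}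
    (h : DiagonalMaps b E ψ χ) :
    HasDerivAt (fun t => diagonalGroup b E t ψ) (-Complex.I • χ) 0 := by
  set w := fun s => diagonalGroup b E s (-Complex.I • χ)
  have hw : Continuous w := continuous_diagonalGroup b E _
  have hduhamel : ∀ t, diagonalGroup b E t ψ = ψ + ∫ s in (0 : ℝ)..t, w s := fun t => by
    refine eq_of_forall_inner_hilbertBasis b fun i => ?_
    have hinner : ∀ s, inner ℂ (b i) (w s) = (-Complex.I * E i * phase (E i) s) *
        inner ℂ (b i) ψ := fun s => by
      rw [inner_diagonalGroup, inner_smul_right, h i]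
      ring
    have hcomm : inner ℂ (b i) (∫ s in (0 : ℝ)..t, w s) =
        ∫ s in (0 : ℝ)..t, inner ℂ (b i) (w s) :=
      ((innerSL ℂ (b i)).intervalIntegral_comp_comm (hw.intervalIntegrable 0 t)).symm
    rw [inner_add_right, hcomm, inner_diagonalGroup]
    simp only [hinner]
    rw [intervalIntegral.integral_eq_sub_of_hasDerivAt
      (fun s _ => (hasDerivAt_phase (E i) s).mul_const _)
      (by apply Continuous.intervalIntegrable; fun_prop), phase_zero_right, Circle.coe_one]
    ring
  have hderiv : HasDerivAt (fun t => ψ + ∫ s in (0 : ℝ)..t, w s) (w 0) 0 :=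
    (intervalIntegral.integral_hasDerivAt_right (hw.intervalIntegrable _ _)
      (hw.stronglyMeasurableAtFilter _ _) hw.continuousAt).const_add ψ
  rw [show w 0 = -Complex.I • χ from diagonalGroup_zero b E _] at hderiv
  exact hderiv.congr_of_eventuallyEq (Eventually.of_forall hduhamel)

theorem diagonalMaps_of_hasDerivAt (b : HilbertBasis ι ℂ H) {E : ι → ℝ} {ψ χ : H}
    (h : HasDerivAt (fun t => diagonalGroup b E t ψ) (-Complex.I • χ) 0) :
    DiagonalMaps b E ψ χ := fun i => by
  have hcoord : HasDerivAt (fun t => inner ℂ (b i) (diagonalGroup b E t ψ))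
      (inner ℂ (b i) (-Complex.I • χ)) 0 :=
    ((innerSL ℂ (b i)).restrictScalars ℝ).hasFDerivAt.comp_hasDerivAt 0 h
  simp only [inner_diagonalGroup, inner_smul_right] at hcoord
  have heq := hcoord.unique ((hasDerivAt_phase (E i) 0).mul_const (inner ℂ (b i) ψ))
  rw [phase_zero_right, Circle.coe_one] at heq
  apply mul_left_cancel₀ (neg_ne_zero.2 Complex.I_ne_zero)
  linear_combination heq

theorem isUnitaryGroup_diagonalGroup (b : HilbertBasis ι ℂ H) (E : ι → ℝ) :
    IsUnitaryGroup (DiagonalMaps b E) (diagonalGroup b E) where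
  add := diagonalGroup_add b E
  continuous := continuous_diagonalGroup b E
  generator _ _ := ⟨hasDerivAt_diagonalGroup b, diagonalMaps_of_hasDerivAt b⟩

theorem IsUnitaryGroup.eq_diagonalGroup {b : HilbertBasis ι ℂ H} {E : ι → ℝ}
    {W : ℝ → (H ≃ₗᵢ[ℂ] H)} (hW : IsUnitaryGroup (DiagonalMaps b E) W) : W = diagonalGroup b E := by
  have hbasis : ∀ {V}, IsUnitaryGroup (DiagonalMaps b E) V →
      ∀ t i, V t (b i) = (phase (E i) t : ℂ) • b i := fun hV t i =>
    hV.apply_eigenvector (fun j => by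
      by_cases hij : j = i
      · rw [hij, inner_smul_right]
      · rw [inner_smul_right, b.orthonormal.2 hij, mul_zero, mul_zero]) t
  funext t
  ext ψ
  have hsum := fun V : H ≃ₗᵢ[ℂ] H =>
    V.toContinuousLinearEquiv.toContinuousLinearMap.hasSum (b.hasSum_repr ψ)
  refine (hsum (W t)).unique ?_
  convert hsum (diagonalGroup b E t) using 1
  · funext i
    simp [hbasis hW, hbasis (isUnitaryGroup_diagonalGroup b E)]
  · rfl

theorem existsUnique_isUnitaryGroup_diagonalMaps (b : HilbertBasis ι ℂ H) (E : ι → ℝ) :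
    ∃! W, IsUnitaryGroup (DiagonalMaps b E) W :=
  ⟨_, isUnitaryGroup_diagonalGroup b E, fun _ => IsUnitaryGroup.eq_diagonalGroup⟩

end UnitaryGroup

section TimeAverage

/-- The time average `(1/t) ∫₀ᵗ f`, with the value `0` at `t = 0`. -/
def timeAverage (f : ℝ → ℂ) (t : ℝ) : ℂ := t⁻¹ • ∫ s in (0 : ℝ)..t, f s

theorem norm_timeAverage_le {f : ℝ → ℂ} {C : ℝ} (hf : ∀ t, ‖f t‖ ≤ C) (t : ℝ) :
    ‖timeAverage f t‖ ≤ C := by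
  have hint := intervalIntegral.norm_integral_le_of_norm_le_const (a := 0) (b := t) fun s _ => hf s
  rw [sub_zero] at hint
  rw [timeAverage, norm_smul, norm_inv, Real.norm_eq_abs]
  rcases eq_or_ne t 0 with rfl | ht
  · simpa using (norm_nonneg _).trans (hf 0)
  · rw [inv_mul_le_iff₀ (abs_pos.2 ht), mul_comm]
    exact hint

theorem timeAverage_finset_sum {ι : Type*} {f : ι → ℝ → ℂ} (s : Finset ι)
    (hf : ∀ i, Continuous (f i)) (t : ℝ) :
    timeAverage (fun τ => ∑ i ∈ s, f i τ) t = ∑ i ∈ s, timeAverage (f i) t := by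
  rw [timeAverage, intervalIntegral.integral_finsetSum fun i _ => (hf i).intervalIntegrable 0 t,
    Finset.smul_sum]
  rfl

theorem timeAverage_mul_const (f : ℝ → ℂ) (c : ℂ) (t : ℝ) :
    timeAverage (fun τ => f τ * c) t = timeAverage f t * c := by
  rw [timeAverage, intervalIntegral.integral_mul_const, timeAverage, smul_mul_assoc]

theorem tendsto_timeAverage_phase {ω : ℝ} (hω : ω ≠ 0) :
    Tendsto (timeAverage fun t => phase ω t) atTop (𝓝 0) := by
  set c : ℂ := (-Complex.I * ω)⁻¹
  have hint : ∀ t : ℝ, ∫ s in (0 : ℝ)..t, (phase ω s : ℂ) = c * (phase ω t - 1) := fun t => by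
    have hprim : ∀ s, HasDerivAt (fun s => c * (phase ω s : ℂ)) (phase ω s) s := fun s => by
      refine ((hasDerivAt_phase ω s).const_mul c).congr_deriv ?_
      rw [← mul_assoc, inv_mul_cancel₀, one_mul]
      simpa using hω
    rw [intervalIntegral.integral_eq_sub_of_hasDerivAt (fun s _ => hprim s)
      ((continuous_phase ω).intervalIntegrable 0 t), phase_zero_right, Circle.coe_one]
    ring
  have hbound : ∀ t, ‖timeAverage (fun t => phase ω t) t‖ ≤ |t⁻¹| * (‖c‖ * 2) := fun t => by
    rw [timeAverage, hint, norm_smul, norm_mul, Real.norm_eq_abs]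
    gcongr
    refine (norm_sub_le _ _).trans_eq ?_
    rw [Circle.norm_coe, norm_one]
    norm_num
  refine squeeze_zero_norm hbound ?_
  simpa using (tendsto_inv_atTop_zero (𝕜 := ℝ)).abs.mul_const (‖c‖ * 2)

theorem tendsto_timeAverage_phase_zero : Tendsto (timeAverage fun t => phase 0 t) atTop (𝓝 1) := by
  refine tendsto_const_nhds.congr' ?_
  filter_upwards [eventually_gt_atTop 0] with t ht
  simp [timeAverage, phase, ht.ne']

theorem tendstoUniformly_timeAverage {κ : Type*} {l : Filter κ} {f : κ → ℝ → ℂ} {g : ℝ → ℂ}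
    (hf : ∀ k, Continuous (f k)) (hg : Continuous g) (h : TendstoUniformly f g l) :
    TendstoUniformly (fun k => timeAverage (f k)) (timeAverage g) l := by
  rw [Metric.tendstoUniformly_iff] at h ⊢
  intro ε hε
  filter_upwards [h (ε / 2) (by positivity)] with k hk t
  have hsub : timeAverage g t - timeAverage (f k) t = timeAverage (fun s => g s - f k s) t := by
    rw [timeAverage, timeAverage, timeAverage, ← smul_sub, intervalIntegral.integral_sub
      (hg.intervalIntegrable _ _) ((hf k).intervalIntegrable _ _)]
  rw [dist_eq_norm, hsub]
  have := norm_timeAverage_le (fun s => (dist_eq_norm (g s) (f k s)).symm.trans_le (hk s).le) t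
  linarith

variable {K : Type*} [NormedAddCommGroup K] [InnerProductSpace ℂ K]

theorem norm_inner_clm_sub_le (Q : K →L[ℂ] K) (x y : K) :
    ‖inner ℂ x (Q x) - inner ℂ y (Q y)‖ ≤ ‖Q‖ * (‖x‖ + ‖y‖) * ‖x - y‖ := by
  have hsplit : inner ℂ x (Q x) - inner ℂ y (Q y) =
      inner ℂ (x - y) (Q x) + inner ℂ y (Q (x - y)) := by
    rw [map_sub, inner_sub_left, inner_sub_right]; ring
  calc ‖inner ℂ x (Q x) - inner ℂ y (Q y)‖
      ≤ ‖x - y‖ * ‖Q x‖ + ‖y‖ * ‖Q (x - y)‖ := by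
        rw [hsplit]
        exact norm_add_le_of_le (norm_inner_le_norm _ _) (norm_inner_le_norm _ _)
    _ ≤ ‖x - y‖ * (‖Q‖ * ‖x‖) + ‖y‖ * (‖Q‖ * ‖x - y‖) := by gcongr <;> exact Q.le_opNorm _
    _ = ‖Q‖ * (‖x‖ + ‖y‖) * ‖x - y‖ := by ring

theorem tendstoUniformly_inner_clm {κ X : Type*} {l : Filter κ} [l.NeBot] (Q : K →L[ℂ] K)
    {y : κ → X → K} {u : X → K} {C : ℝ} (hC : 0 ≤ C) (hy : ∀ k x, ‖y k x‖ ≤ C)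
    (h : TendstoUniformly y u l) :
    TendstoUniformly (fun k x => inner ℂ (y k x) (Q (y k x))) (fun x => inner ℂ (u x) (Q (u x)))
      l := by
  have hu : ∀ x, ‖u x‖ ≤ C := fun x =>
    le_of_tendsto (h.tendsto_at x).norm (Eventually.of_forall fun k => hy k x)
  rw [Metric.tendstoUniformly_iff] at h ⊢
  intro ε hε
  set D := ‖Q‖ * (C + C)
  filter_upwards [h (ε / (D + 1)) (by positivity)] with k hk x
  rw [dist_eq_norm]
  calc ‖inner ℂ (u x) (Q (u x)) - inner ℂ (y k x) (Q (y k x))‖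
      ≤ ‖Q‖ * (‖u x‖ + ‖y k x‖) * ‖u x - y k x‖ := norm_inner_clm_sub_le Q _ _
    _ ≤ D * (ε / (D + 1)) := by
        have := (hk x).le
        rw [dist_eq_norm] at this
        exact mul_le_mul (mul_le_mul_of_nonneg_left (add_le_add (hu x) (hy k x)) (norm_nonneg _))
          this (norm_nonneg _) (by positivity)
    _ < ε := by
        rw [← mul_div_assoc, div_lt_iff₀ (by positivity)]
        linarith

theorem tendsto_timeAverage_inner_sum_phase {ι : Type*} {E : ι → ℝ} (hE : Function.Injective E)
    (w : ι → K) (Q : K →L[ℂ] K) (s : Finset ι) :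
    Tendsto (timeAverage fun t => inner ℂ (∑ i ∈ s, (phase (E i) t : ℂ) • w i)
      (Q (∑ i ∈ s, (phase (E i) t : ℂ) • w i))) atTop (𝓝 (∑ i ∈ s, inner ℂ (w i) (Q (w i)))) := by
  classical
  have hexpand : ∀ t, inner ℂ (∑ i ∈ s, (phase (E i) t : ℂ) • w i)
      (Q (∑ i ∈ s, (phase (E i) t : ℂ) • w i)) =
      ∑ i ∈ s, ∑ j ∈ s, (phase (E j - E i) t : ℂ) * inner ℂ (w i) (Q (w j)) := fun t => by
    rw [map_sum, sum_inner]
    refine Finset.sum_congr rfl fun i _ => ?_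
    rw [inner_sum]
    refine Finset.sum_congr rfl fun j _ => ?_
    rw [map_smul, inner_smul_left, inner_smul_right, ← mul_assoc, conj_phase_mul_phase]
  have haverage : (timeAverage fun t => ∑ i ∈ s, ∑ j ∈ s,
      (phase (E j - E i) t : ℂ) * inner ℂ (w i) (Q (w j))) = fun t => ∑ i ∈ s, ∑ j ∈ s,
      timeAverage (fun t => phase (E j - E i) t) t * inner ℂ (w i) (Q (w j)) := by
    funext t
    rw [timeAverage_finset_sum s fun i => by fun_prop]
    refine Finset.sum_congr rfl fun i _ => ?_
    rw [timeAverage_finset_sum s fun j => by fun_prop]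
    exact Finset.sum_congr rfl fun j _ => timeAverage_mul_const _ _ _
  have hdiag : ∀ i ∈ s, inner ℂ (w i) (Q (w i)) =
      ∑ j ∈ s, (if j = i then (1 : ℂ) else 0) * inner ℂ (w i) (Q (w j)) := fun i hi => by
    simp [hi]
  simp only [hexpand]
  rw [haverage, Finset.sum_congr rfl hdiag]
  refine tendsto_finsetSum _ fun i _ => tendsto_finsetSum _ fun j _ => Tendsto.mul_const _ ?_
  split_ifs with hij
  · simpa only [hij, sub_self] using tendsto_timeAverage_phase_zero
  · exact tendsto_timeAverage_phase (sub_ne_zero.2 (hE.ne hij))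

theorem tendsto_timeAverage_inner_of_tendstoUniformly {ι : Type*} {E : ι → ℝ}
    (hE : Function.Injective E) {w : ι → K} (Q : K →L[ℂ] K) {u : ℝ → K} {C : ℝ} {M : ℂ}
    (hC : 0 ≤ C) (hw : ∀ (s : Finset ι) t, ‖∑ i ∈ s, (phase (E i) t : ℂ) • w i‖ ≤ C)
    (hu : TendstoUniformly (fun (s : Finset ι) t => ∑ i ∈ s, (phase (E i) t : ℂ) • w i) u atTop)
    (hM : HasSum (fun i => inner ℂ (w i) (Q (w i))) M) :
    Continuous u ∧ Tendsto (timeAverage fun t => inner ℂ (u t) (Q (u t))) atTop (𝓝 M) := by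
  have hcu : Continuous u := hu.continuous (Frequently.of_forall fun s => by fun_prop)
  refine ⟨hcu, TendstoUniformly.tendsto_of_eventually_tendsto
    (tendstoUniformly_timeAverage (fun s => by fun_prop) (by fun_prop)
      (tendstoUniformly_inner_clm Q hC hw hu))
    (Eventually.of_forall fun s => tendsto_timeAverage_inner_sum_phase hE w Q s) hM⟩

end TimeAverage

section EigenvectorExpansion

open ContinuousLinearMap (adjoint adjoint_inner_left adjoint_inner_right)

variable {H K : Type*} [NormedAddCommGroup H] [InnerProductSpace ℂ H] [NormedAddCommGroup K]
  [InnerProductSpace ℂ K] {J : K →L[ℂ] H} {Λ : ℝ} {ι : Type*} {E : ι → ℝ} {v : ι → K}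

theorem hasSum_sq_norm_inner_map {x : K}
    (hx : HasSum (fun i => inner ℂ (J (v i)) (J x) • v i) x) :
    HasSum (fun i => ‖inner ℂ (J (v i)) (J x)‖ ^ 2) (‖J x‖ ^ 2) := by
  have hterm : ∀ i, innerSL ℂ (J x) (J (inner ℂ (J (v i)) (J x) • v i)) =
      (‖inner ℂ (J (v i)) (J x)‖ ^ 2 : ℝ) := fun i => by
    rw [map_smul, map_smul, innerSL_apply_apply, ← inner_conj_symm (J x), smul_eq_mul,
      Complex.mul_conj, Complex.normSq_eq_norm_sq]
  have hJx := (hx.mapL J).mapL (innerSL ℂ (J x))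
  rw [innerSL_apply_apply, inner_self_eq_norm_sq_to_K] at hJx
  simp only [hterm] at hJx
  exact Complex.hasSum_ofReal.1 (by simpa using hJx)

variable [CompleteSpace H] [CompleteSpace K]

/-- The vectors `J (v i)` are unit eigenvectors, for distinct eigenvalues `E i`, of the operator of
the form with form domain `J : K → H` (see `FormOperatorMaps`). -/
structure IsEigenfamily (J : K →L[ℂ] H) (Λ : ℝ) (E : ι → ℝ) (v : ι → K) : Prop where
  injective : Function.Injective E
  eigen : ∀ i, v i = ((E i + Λ : ℝ) : ℂ) • adjoint J (J (v i))
  norm_eq_one : ∀ i, ‖J (v i)‖ = 1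

namespace IsEigenfamily

theorem inner_left (hv : IsEigenfamily J Λ E v) (i : ι) (x : K) :
    inner ℂ (v i) x = (E i + Λ : ℝ) * inner ℂ (J (v i)) (J x) := by
  conv_lhs => rw [hv.eigen i, inner_smul_left, adjoint_inner_left, Complex.conj_ofReal]

theorem orthonormal (hv : IsEigenfamily J Λ E v) : Orthonormal ℂ fun i => J (v i) := by
  refine ⟨hv.norm_eq_one, fun i j hij => ?_⟩
  have hsymm : ((E i + Λ : ℝ) : ℂ) * inner ℂ (J (v i)) (J (v j)) =
      (E j + Λ : ℝ) * inner ℂ (J (v i)) (J (v j)) := by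
    rw [← hv.inner_left, ← inner_conj_symm (v i), hv.inner_left, map_mul, Complex.conj_ofReal,
      inner_conj_symm]
  have hE : (E i : ℂ) - E j ≠ 0 := sub_ne_zero.2 (Complex.ofReal_injective.ne (hv.injective.ne hij))
  refine (mul_eq_zero.1 (?_ : ((E i : ℂ) - E j) * _ = 0)).resolve_left hE
  push_cast at hsymm
  linear_combination hsymm

theorem norm_sq (hv : IsEigenfamily J Λ E v) (i : ι) : ‖v i‖ ^ 2 = E i + Λ := by
  have h := hv.inner_left i (v i)
  rw [inner_self_eq_norm_sq_to_K, inner_self_eq_norm_sq_to_K, hv.norm_eq_one] at h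
  apply Complex.ofReal_injective
  push_cast at h ⊢
  simpa using h

theorem ne_zero (hv : IsEigenfamily J Λ E v) (i : ι) : v i ≠ 0 := fun h => by
  simpa [h] using hv.norm_eq_one i

theorem orthonormal_normalized (hv : IsEigenfamily J Λ E v) :
    Orthonormal ℂ fun i => ((‖v i‖⁻¹ : ℝ) : ℂ) • v i := by
  refine ⟨fun i => ?_, fun i j hij => ?_⟩
  · rw [norm_smul, Complex.norm_real, norm_inv, norm_norm,
      inv_mul_cancel₀ (norm_ne_zero_iff.2 (hv.ne_zero i))]
  · change inner ℂ (((‖v i‖⁻¹ : ℝ) : ℂ) • v i) (((‖v j‖⁻¹ : ℝ) : ℂ) • v j) = 0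
    rw [inner_smul_left, inner_smul_right, hv.inner_left, hv.orthonormal.2 hij]
    simp only [mul_zero]

theorem inner_normalized_smul (hv : IsEigenfamily J Λ E v) (i : ι) (x : K) :
    inner ℂ (((‖v i‖⁻¹ : ℝ) : ℂ) • v i) x • (((‖v i‖⁻¹ : ℝ) : ℂ) • v i) =
      inner ℂ (J (v i)) (J x) • v i := by
  rw [inner_smul_left, hv.inner_left, ← hv.norm_sq, smul_smul, Complex.conj_ofReal]
  congr 1
  have : (‖v i‖ : ℂ) ≠ 0 := Complex.ofReal_ne_zero.2 (norm_ne_zero_iff.2 (hv.ne_zero i))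
  push_cast
  field_simp

theorem hasSum_inner_smul (hv : IsEigenfamily J Λ E v) (hJ : IsCompactOperator J)
    {M : Submodule ℂ K} (hM : IsClosed (M : Set K)) (hvM : ∀ i, v i ∈ M)
    (hinv : ∀ x ∈ M, adjoint J (J x) ∈ M)
    (hmult : ∀ (μ : ℝ), ∀ y ∈ M, y ≠ 0 → adjoint J (J y) = (μ : ℂ) • y →
      ∃ i, ∃ c : ℂ, y = c • v i)
    {x : K} (hx : x ∈ M) : HasSum (fun i => inner ℂ (J (v i)) (J x) • v i) x := by
  have hsymm : (adjoint J ∘L J).IsSymmetric := fun y z => by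
    change inner ℂ (adjoint J (J y)) z = inner ℂ y (adjoint J (J z))
    rw [adjoint_inner_left, adjoint_inner_right]
  have htotal : ∀ y ∈ M, (∀ i, inner ℂ (((‖v i‖⁻¹ : ℝ) : ℂ) • v i) y = 0) → y = 0 :=
    fun y hy h => eq_zero_of_forall_inner_eigenvector_eq_zero (G := adjoint J ∘L J)
      (hJ.clm_comp (adjoint J)) hsymm hM hinv hy fun μ z hz hμ => by
        rcases eq_or_ne z 0 with rfl | hz₀
        · exact inner_zero_left y
        obtain ⟨i, c, rfl⟩ := hmult μ z hz hz₀ hμ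
        have hi := h i
        rw [inner_smul_left, mul_eq_zero] at hi
        rw [inner_smul_left, hi.resolve_left (by simpa using hv.ne_zero i), mul_zero]
  have hsum := hasSum_inner_smul_of_forall_inner_eq_zero hv.orthonormal_normalized hM
    (fun i => M.smul_mem _ (hvM i)) htotal hx
  simpa only [hv.inner_normalized_smul] using hsum

variable {x : K}

theorem hasSum_sq_norm_inner_mul (hv : IsEigenfamily J Λ E v)
    (hx : HasSum (fun i => inner ℂ (J (v i)) (J x) • v i) x) :
    HasSum (fun i => ‖inner ℂ (J (v i)) (J x)‖ ^ 2 * (E i + Λ)) (‖x‖ ^ 2) := by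
  have hterm : ∀ i, innerSL ℂ x (inner ℂ (J (v i)) (J x) • v i) =
      (‖inner ℂ (J (v i)) (J x)‖ ^ 2 * (E i + Λ) : ℝ) := fun i => by
    rw [map_smul, innerSL_apply_apply, ← inner_conj_symm x, hv.inner_left, map_mul,
      Complex.conj_ofReal, smul_eq_mul, mul_left_comm, Complex.mul_conj, Complex.normSq_eq_norm_sq,
      mul_comm, ← Complex.ofReal_mul]
  have hxx := hx.mapL (innerSL ℂ x)
  rw [innerSL_apply_apply, inner_self_eq_norm_sq_to_K] at hxx
  simp only [hterm] at hxx
  exact Complex.hasSum_ofReal.1 (by simpa using hxx)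

theorem summable_sq_norm_inner_mul_inner (hv : IsEigenfamily J Λ E v)
    (hx : HasSum (fun i => inner ℂ (J (v i)) (J x) • v i) x) (Q : K →L[ℂ] K) :
    Summable fun i => (‖inner ℂ (J (v i)) (J x)‖ ^ 2 : ℂ) * inner ℂ (v i) (Q (v i)) := by
  refine ((hv.hasSum_sq_norm_inner_mul hx).summable.mul_left ‖Q‖).of_norm_bounded fun i => ?_
  have hQ : ‖inner ℂ (v i) (Q (v i))‖ ≤ ‖Q‖ * (E i + Λ) := by
    calc ‖inner ℂ (v i) (Q (v i))‖ ≤ ‖v i‖ * (‖Q‖ * ‖v i‖) :=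
          (norm_inner_le_norm _ _).trans (by gcongr; exact Q.le_opNorm _)
      _ = ‖Q‖ * (E i + Λ) := by rw [← hv.norm_sq]; ring
  rw [norm_mul, norm_pow, Complex.norm_real, norm_norm, mul_left_comm]
  gcongr

theorem exists_tendsto_timeAverage (hv : IsEigenfamily J Λ E v)
    (hx : HasSum (fun i => inner ℂ (J (v i)) (J x) • v i) x) (Q : K →L[ℂ] K)
    {W : ℝ → (H ≃ₗᵢ[ℂ] H)} (hW : ∀ t i, W t (J (v i)) = (phase (E i) t : ℂ) • J (v i)) :
    ∃ u : ℝ → K, Continuous u ∧ (∀ t, J (u t) = W t (J x)) ∧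
      Tendsto (timeAverage fun t => inner ℂ (u t) (Q (u t))) atTop
        (𝓝 (∑' i, (‖inner ℂ (J (v i)) (J x)‖ ^ 2 : ℂ) * inner ℂ (v i) (Q (v i)))) := by
  set c : ι → ℂ := fun i => inner ℂ (J (v i)) (J x)
  have hc : ∀ i t, ‖(phase (E i) t : ℂ) * (c i * ‖v i‖)‖ ^ 2 ≤ ‖c i‖ ^ 2 * (E i + Λ) :=
    fun i t => by
      rw [norm_mul, norm_mul, Circle.norm_coe, Complex.norm_real, norm_norm, one_mul, mul_pow,
        hv.norm_sq]
  have hf : ∀ i t, ((phase (E i) t : ℂ) * (c i * ‖v i‖)) • ((‖v i‖⁻¹ : ℝ) : ℂ) • v i =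
      (phase (E i) t : ℂ) • c i • v i := fun i t => by
    rw [smul_smul, smul_smul, mul_assoc, mul_assoc, ← Complex.ofReal_mul,
      mul_inv_cancel₀ (norm_ne_zero_iff.2 (hv.ne_zero i)), Complex.ofReal_one, mul_one]
  have hsum := hv.hasSum_sq_norm_inner_mul hx
  have hunif := tendstoUniformly_sum_smul_orthonormal hv.orthonormal_normalized hsum.summable hc
  have hbound := fun (s : Finset ι) t => (norm_sum_smul_sq_le hv.orthonormal_normalized
    (hc · t) s).trans (sum_le_hasSum s (fun i _ => (sq_nonneg _).trans (hc i t)) hsum)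
  simp only [hf] at hunif hbound
  have hdiag : ∀ i, inner ℂ (c i • v i) (Q (c i • v i)) =
      (‖c i‖ ^ 2 : ℂ) * inner ℂ (v i) (Q (v i)) := fun i => by
    rw [map_smul, inner_smul_left, inner_smul_right, ← mul_assoc, Complex.conj_mul']
  obtain ⟨hcont, hlim⟩ := tendsto_timeAverage_inner_of_tendstoUniformly hv.injective Q
    (norm_nonneg x) (fun s t => le_of_sq_le_sq (hbound s t) (norm_nonneg x)) hunif
    (by simpa only [hdiag] using (hv.summable_sq_norm_inner_mul_inner hx Q).hasSum)
  refine ⟨_, hcont, fun t => ?_, hlim⟩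
  have hJu : HasSum (fun i => J ((phase (E i) t : ℂ) • c i • v i)) (J _) :=
    HasSum.mapL J (hunif.tendsto_at t)
  have hWJ : ∀ i, J ((phase (E i) t : ℂ) • c i • v i) = W t (J (c i • v i)) := fun i => by
    rw [map_smul, map_smul, map_smul, hW]
    exact smul_comm _ _ _
  simp only [hWJ] at hJu
  exact hJu.unique ((hx.mapL J).mapL (W t).toContinuousLinearEquiv.toContinuousLinearMap)

end IsEigenfamily

end EigenvectorExpansion

section DiagonalOperators

variable {H : Type*} [NormedAddCommGroup H] [InnerProductSpace ℂ H] {ι : Type*}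
  (b : HilbertBasis ι ℂ H)

theorem hasSum_sq_norm_inner_hilbertBasis (x : H) :
    HasSum (fun i => ‖inner ℂ (b i) x‖ ^ 2) (‖x‖ ^ 2) := by
  have hterm : ∀ i, inner ℂ x (b i) * inner ℂ (b i) x = (‖inner ℂ (b i) x‖ ^ 2 : ℝ) := fun i => by
    rw [← inner_conj_symm x, Complex.conj_mul', Complex.ofReal_pow]
  have h := b.hasSum_inner_mul_inner x x
  rw [inner_self_eq_norm_sq_to_K] at h
  simp only [hterm] at h
  exact Complex.hasSum_ofReal.1 (by simpa using h)

theorem exists_inner_hilbertBasis_eq {c : ι → ℂ}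
    (hc : Summable fun i => ‖c i‖ ^ 2) : ∃ x : H, ∀ i, inner ℂ (b i) x = c i := by
  have hmem : Memℓp c 2 := memℓp_gen (by simpa using hc)
  refine ⟨b.repr.symm ⟨c, hmem⟩, fun i => ?_⟩
  rw [← b.repr_apply_apply, LinearIsometryEquiv.apply_symm_apply]

variable {b} {g : ι → ℂ} {C : ℝ}

theorem norm_le_of_inner_eq_mul (hg : ∀ i, ‖g i‖ ≤ C) (hC : 0 ≤ C) {x y : H}
    (hy : ∀ i, inner ℂ (b i) y = g i * inner ℂ (b i) x) : ‖y‖ ≤ C * ‖x‖ := by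
  refine le_of_sq_le_sq ?_ (by positivity)
  rw [mul_pow]
  refine hasSum_le (fun i => ?_) (hasSum_sq_norm_inner_hilbertBasis b y)
    ((hasSum_sq_norm_inner_hilbertBasis b x).mul_left (C ^ 2))
  rw [hy, norm_mul, mul_pow]
  gcongr
  exact hg i

theorem exists_diagonalOperator (b : HilbertBasis ι ℂ H) (hg : ∀ i, ‖g i‖ ≤ C)
    (hC : 0 ≤ C) : ∃ T : H →L[ℂ] H, ∀ x i, inner ℂ (b i) (T x) = g i * inner ℂ (b i) x := by
  have hex : ∀ x, ∃ y, ∀ i, inner ℂ (b i) y = g i * inner ℂ (b i) x := fun x => by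
    refine exists_inner_hilbertBasis_eq b (.of_nonneg_of_le (fun _ => sq_nonneg _) (fun i => ?_)
      ((hasSum_sq_norm_inner_hilbertBasis b x).summable.mul_left (C ^ 2)))
    rw [norm_mul, mul_pow]
    gcongr
    exact hg i
  choose T hT using hex
  let T' : H →ₗ[ℂ] H :=
    { toFun := T
      map_add' := fun x y => eq_of_forall_inner_hilbertBasis b fun i => by
        rw [hT, inner_add_right, inner_add_right, hT, hT, mul_add]
      map_smul' := fun c x => eq_of_forall_inner_hilbertBasis b fun i => by
        rw [hT, RingHom.id_apply, inner_smul_right, inner_smul_right, hT, mul_left_comm] }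
  exact ⟨T'.mkContinuous C fun x => norm_le_of_inner_eq_mul hg hC (hT x), hT⟩

theorem isCompactOperator_of_inner_eq_mul [CompleteSpace H] {T : H →L[ℂ] H}
    (hT : ∀ x i, inner ℂ (b i) (T x) = g i * inner ℂ (b i) x) (hg : Tendsto g cofinite (𝓝 0)) :
    IsCompactOperator T := by
  classical
  let A : Finset ι → H →L[ℂ] H := fun s =>
    ∑ i ∈ s, (ContinuousLinearMap.toSpanSingleton ℂ (g i • b i)) ∘L innerSL ℂ (b i)
  have hA : ∀ s, IsCompactOperator (A s) := fun s =>
    (compactOperator (RingHom.id ℂ) H H).sum_mem fun i _ =>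
      (isCompactOperator_of_locallyCompactSpace_dom (innerSL ℂ (b i))).clm_comp
        (ContinuousLinearMap.toSpanSingleton ℂ (g i • b i))
  have hAinner : ∀ s x i, inner ℂ (b i) ((T - A s) x) =
      (if i ∈ s then 0 else g i) * inner ℂ (b i) x := fun s x i => by
    have hAx : inner ℂ (b i) (A s x) = if i ∈ s then g i * inner ℂ (b i) x else 0 := by
      simp [A, orthonormal_iff_ite.1 b.orthonormal, mul_comm]
    rw [sub_apply, inner_sub_right, hT, hAx]
    split_ifs <;> ring
  refine isCompactOperator_of_tendsto (l := atTop) (F := A) ?_ (Eventually.of_forall hA)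
  rw [Metric.tendsto_nhds]
  intro ε hε
  have hfin : {i | ¬ ‖g i‖ < ε / 2}.Finite := by
    simpa using (Metric.tendsto_nhds.1 hg) (ε / 2) (by positivity)
  filter_upwards [eventually_ge_atTop hfin.toFinset] with s hs
  rw [dist_comm, dist_eq_norm]
  refine (ContinuousLinearMap.opNorm_le_bound _ (half_pos hε).le fun x =>
    norm_le_of_inner_eq_mul (fun i => ?_) (half_pos hε).le (hAinner s x)).trans_lt (half_lt_self hε)
  split_ifs with hi
  · simpa using (half_pos hε).le
  · by_contra! h
    exact hi (hs (hfin.mem_toFinset.2 h.le.not_gt))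

end DiagonalOperators

section PlaneWaves

variable {N : ℕ} {L : ℝ}

/-- The unnormalized plane wave with labels `q`, a character of the torus `Config N L`. -/
def character (q : Mode N) : C(Config N L, ℂ) where
  toFun x := (∏ n, fourier (q.1 n) (x.1 n)) * fourier q.2 x.2
  continuous_toFun := by fun_prop

theorem character_apply (q : Mode N) (x : Config N L) :
    character q x = (∏ n, fourier (q.1 n) (x.1 n)) * fourier q.2 x.2 := rfl

theorem character_zero : (character 0 : C(Config N L, ℂ)) = 1 := by
  ext x
  simp [character_apply]

theorem character_add (q q' : Mode N) :
    (character (q + q') : C(Config N L, ℂ)) = character q * character q' := by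
  ext x
  simp only [character_apply, ContinuousMap.mul_apply, Prod.fst_add, Prod.snd_add, Pi.add_apply,
    fourier_add, Finset.prod_mul_distrib]
  ring

theorem star_character (q : Mode N) : star (character q : C(Config N L, ℂ)) = character (-q) := by
  ext x
  simp only [character_apply, ContinuousMap.star_apply, Prod.fst_neg, Prod.snd_neg, Pi.neg_apply,
    fourier_neg, star_mul', RCLike.star_def, map_prod]

theorem character_single_apply (n : Fin N) (x : Config N L) :
    character (Pi.single n 1, 0) x = fourier 1 (x.1 n) := by
  simp only [character_apply, fourier_zero, mul_one]
  rw [Finset.prod_eq_single n (fun m _ hm => by rw [Pi.single_eq_of_ne hm, fourier_zero]) (by simp),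
    Pi.single_eq_same]

/-- The star algebra of trigonometric polynomials. -/
def characterAlgebra (N : ℕ) (L : ℝ) : StarSubalgebra ℂ C(Config N L, ℂ) where
  toSubalgebra := Algebra.adjoin ℂ (Set.range character)
  star_mem' := by
    change Algebra.adjoin ℂ (Set.range character) ≤ star (Algebra.adjoin ℂ (Set.range character))
    refine Algebra.adjoin_le ?_
    rintro _ ⟨q, rfl⟩
    exact Algebra.subset_adjoin ⟨-q, (star_character q).symm⟩

theorem character_mem_characterAlgebra (q : Mode N) :
    (character q : C(Config N L, ℂ)) ∈ characterAlgebra N L :=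
  Algebra.subset_adjoin ⟨q, rfl⟩

theorem characterAlgebra_toSubmodule :
    (characterAlgebra N L).toSubalgebra.toSubmodule = Submodule.span ℂ (Set.range character) := by
  apply Algebra.adjoin_eq_span_of_subset
  refine .trans (fun _ => Submonoid.closure_induction (fun _ => id) ⟨0, character_zero⟩ ?_)
    Submodule.subset_span
  rintro _ _ _ _ ⟨q, rfl⟩ ⟨q', rfl⟩
  exact ⟨q + q', character_add q q'⟩

theorem planeWaveFun_eq_smul (q : Mode N) :
    (planeWaveFun q : C(Config N L, ℂ)) = (((√(L ^ (N + 1)))⁻¹ : ℝ) : ℂ) • character q := rfl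

variable [Fact (0 < L)]

theorem characterAlgebra_separatesPoints : (characterAlgebra N L).SeparatesPoints := by
  intro x y hxy
  have hne : ∀ {a b : AddCircle L}, a ≠ b → (fourier 1 a : ℂ) ≠ fourier 1 b := fun hab h => by
    rw [fourier_one, fourier_one] at h
    exact hab (AddCircle.injective_toCircle (Fact.out : 0 < L).ne' (Circle.ext h))
  by_cases h2 : x.2 = y.2
  · obtain ⟨n, hn⟩ : ∃ n, x.1 n ≠ y.1 n := by
      by_contra! h1
      exact hxy (Prod.ext (funext h1) h2)
    refine ⟨_, ⟨character (Pi.single n 1, 0), character_mem_characterAlgebra _, rfl⟩, ?_⟩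
    simpa only [character_single_apply] using hne hn
  · refine ⟨_, ⟨character (0, 1), character_mem_characterAlgebra _, rfl⟩, ?_⟩
    simpa [character_apply] using hne h2

theorem topologicalClosure_span_character :
    (Submodule.span ℂ (Set.range (character (N := N) (L := L)))).topologicalClosure = ⊤ := by
  rw [← characterAlgebra_toSubmodule]
  exact congr_arg (Subalgebra.toSubmodule <| StarSubalgebra.toSubalgebra ·)
    (ContinuousMap.starSubalgebra_topologicalClosure_eq_top_of_separatesPoints _
      characterAlgebra_separatesPoints)

theorem integral_fourier (m : ℤ) :
    ∫ y : AddCircle L, fourier m y = if m = 0 then (L : ℂ) else 0 := by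
  have hL : 0 < L := Fact.out
  have h := congrFun (fourierCoeff_fourier (T := L) m) 0
  simp only [fourierCoeff, neg_zero, fourier_zero, one_smul, AddCircle.integral_haarAddCircle,
    Pi.single_apply, inv_smul_eq_iff₀ hL.ne'] at h
  rw [h]
  by_cases hm : m = 0
  · simp [hm]
  · simp [hm, Ne.symm hm]

theorem integral_character (q : Mode N) :
    ∫ x : Config N L, character q x = if q = 0 then (L : ℂ) ^ (N + 1) else 0 := by
  have hprod := integral_prod_mul (μ := (volume : Measure (Fin N → AddCircle L)))
    (ν := (volume : Measure (AddCircle L)))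
    (fun x => ∏ n, fourier (q.1 n) (x n)) (fun y => (fourier q.2 y : ℂ))
  rw [integral_fintype_prod_volume_eq_prod (𝕜 := ℂ) (E := fun _ : Fin N => AddCircle L)
    fun n y => fourier (q.1 n) y] at hprod
  refine hprod.trans ?_
  simp only [integral_fourier]
  split_ifs with h2 hq hq
  · simp [hq, pow_succ]
  · obtain ⟨n, hn⟩ : ∃ n, q.1 n ≠ 0 := by
      by_contra! h1
      exact hq (Prod.ext (funext h1) h2)
    rw [Finset.prod_eq_zero (Finset.mem_univ n) (if_neg hn), zero_mul]
  · exact absurd (by rw [hq]; rfl) h2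
  · rw [mul_zero]

theorem conj_planeWaveFun_mul (q q' : Mode N) (x : Config N L) :
    conj (planeWaveFun q x) * planeWaveFun q' x =
      ((L ^ (N + 1))⁻¹ : ℝ) * character (q' - q) x := by
  have hL : 0 < L := Fact.out
  have hsqrt : (((√(L ^ (N + 1)))⁻¹ : ℝ) : ℂ) * ((√(L ^ (N + 1)))⁻¹ : ℝ) =
      ((L ^ (N + 1))⁻¹ : ℝ) := by
    rw [← Complex.ofReal_mul, ← mul_inv, Real.mul_self_sqrt (by positivity)]
  have hstar : conj (character q x) = character (-q) x := by rw [← star_character]; rfl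
  rw [sub_eq_add_neg, character_add, ← hsqrt]
  simp only [planeWaveFun_eq_smul, ContinuousMap.smul_apply, ContinuousMap.mul_apply, smul_eq_mul,
    map_mul, Complex.conj_ofReal, hstar]
  ring

theorem orthonormal_planeWave : Orthonormal ℂ (planeWave (N := N) (L := L)) := by
  have hL : (L : ℂ) ≠ 0 := Complex.ofReal_ne_zero.2 (Fact.out : 0 < L).ne'
  rw [orthonormal_iff_ite]
  intro q q'
  rw [planeWave, planeWave, ContinuousMap.inner_toLp]
  simp only [mul_comm _ (conj _), conj_planeWaveFun_mul]
  rw [integral_const_mul, integral_character]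
  simp only [sub_eq_zero, eq_comm (a := q')]
  split_ifs
  · push_cast
    exact inv_mul_cancel₀ (pow_ne_zero _ hL)
  · rw [mul_zero]

theorem topologicalClosure_span_planeWave :
    (Submodule.span ℂ (Set.range (planeWave (N := N) (L := L)))).topologicalClosure = ⊤ := by
  have hL : 0 < L := Fact.out
  have hdense := (ContinuousMap.toLp_denseRange (p := 2) ℂ (volume : Measure (Config N L)) ℂ
    (by norm_num)).topologicalClosure_map_submodule
    (topologicalClosure_span_character (N := N) (L := L))
  rw [eq_top_iff, ← hdense]
  apply Submodule.topologicalClosure_mono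
  rw [Submodule.map_span, Submodule.span_le]
  rintro _ ⟨_, ⟨q, rfl⟩, rfl⟩
  have hchar : (character q : C(Config N L, ℂ)) = (√(L ^ (N + 1)) : ℂ) • planeWaveFun q := by
    rw [planeWaveFun_eq_smul, smul_smul, ← Complex.ofReal_mul, mul_inv_cancel₀ (by positivity),
      Complex.ofReal_one, one_smul]
  rw [hchar]
  change ContinuousMap.toLp 2 volume ℂ ((√(L ^ (N + 1)) : ℂ) • planeWaveFun q) ∈ _
  rw [map_smul]
  exact Submodule.smul_mem _ _ (Submodule.subset_span ⟨q, rfl⟩)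

/-- The Hilbert basis of plane waves. -/
def planeWaveBasis (N : ℕ) (L : ℝ) [Fact (0 < L)] : HilbertBasis (Mode N) ℂ (WaveFn N L) :=
  HilbertBasis.mk orthonormal_planeWave topologicalClosure_span_planeWave.ge

theorem inner_planeWaveBasis (q : Mode N) (ψ : WaveFn N L) :
    inner ℂ (planeWaveBasis N L q) ψ = amplitude ψ q := by
  rw [planeWaveBasis, HilbertBasis.coe_mk, amplitude]

theorem amplitude_add (ψ χ : WaveFn N L) (q : Mode N) :
    amplitude (ψ + χ) q = amplitude ψ q + amplitude χ q := inner_add_right _ _ _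

theorem amplitude_smul (c : ℂ) (ψ : WaveFn N L) (q : Mode N) :
    amplitude (c • ψ) q = c * amplitude ψ q := inner_smul_right _ _ _

open Classical in
theorem amplitude_planeWave (q q' : Mode N) :
    amplitude (planeWave (L := L) q') q = if q = q' then 1 else 0 :=
  orthonormal_iff_ite.1 orthonormal_planeWave q q'

theorem amplitude_ext {ψ χ : WaveFn N L} (h : ∀ q, amplitude ψ q = amplitude χ q) : ψ = χ :=
  eq_of_forall_inner_hilbertBasis (planeWaveBasis N L) fun q => by
    simpa only [inner_planeWaveBasis] using h q

theorem hasSum_conj_amplitude_mul (φ ψ : WaveFn N L) :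
    HasSum (fun q => conj (amplitude φ q) * amplitude ψ q) (inner ℂ φ ψ) := by
  have h := (planeWaveBasis N L).hasSum_inner_mul_inner φ ψ
  simpa only [← inner_conj_symm φ (planeWaveBasis N L _), inner_planeWaveBasis] using h

theorem hasSum_sq_norm_amplitude (ψ : WaveFn N L) :
    HasSum (fun q => ‖amplitude ψ q‖ ^ 2) (‖ψ‖ ^ 2) := by
  simpa only [inner_planeWaveBasis] using hasSum_sq_norm_inner_hilbertBasis (planeWaveBasis N L) ψ

end PlaneWaves

section FermiSpace

variable {N : ℕ} {L : ℝ} [Fact (0 < L)]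

/-- Relabelling of the host momenta. -/
def permuteMode (σ : Equiv.Perm (Fin N)) (q : Mode N) : Mode N := (fun n => q.1 (σ n), q.2)

theorem inner_permuteWave (σ : Equiv.Perm (Fin N)) (φ ψ : WaveFn N L) :
    inner ℂ (permuteWave σ φ) (permuteWave σ ψ) = inner ℂ φ ψ :=
  (Lp.compMeasurePreservingₗᵢ ℂ (permuteConfig σ) (measurePreserving_permuteConfig σ)).inner_map_map
    φ ψ

theorem amplitude_permuteWave (σ : Equiv.Perm (Fin N)) (ψ : WaveFn N L) (q : Mode N) :
    amplitude (permuteWave σ ψ) q = amplitude ψ (permuteMode σ q) := by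
  have hq : planeWave (L := L) q = permuteWave σ (planeWave (permuteMode σ q)) := by
    rw [permuteWave_planeWave]
    simp only [permuteMode, Equiv.apply_symm_apply]
  rw [amplitude, hq, inner_permuteWave, amplitude]

theorem mem_fermiSpace_iff {ψ : WaveFn N L} : ψ ∈ FermiSpace N L ↔
    ∀ (σ : Equiv.Perm (Fin N)) (q : Mode N),
      amplitude ψ (permuteMode σ q) = ((Equiv.Perm.sign σ : ℤ) : ℂ) * amplitude ψ q := by
  refine ⟨fun h σ q => ?_, fun h σ => amplitude_ext fun q => ?_⟩
  · rw [← amplitude_permuteWave, h σ, amplitude_smul]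
  · rw [amplitude_permuteWave, h, amplitude_smul]

theorem amplitude_eq_zero_of_not_injective {ψ : WaveFn N L} (hψ : ψ ∈ FermiSpace N L) {q : Mode N}
    (hq : ¬ Function.Injective q.1) : amplitude ψ q = 0 := by
  obtain ⟨a, b, hab, hne⟩ := Function.not_injective_iff.1 hq
  have hswap : permuteMode (Equiv.swap a b) q = q :=
    Prod.ext (funext fun n => Equiv.apply_swap_eq_self hab n) rfl
  have h := mem_fermiSpace_iff.1 hψ (Equiv.swap a b) q
  rw [hswap, Equiv.Perm.sign_swap hne] at h
  push_cast at h
  linear_combination h / 2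

theorem isClosed_fermiSpace : IsClosed (FermiSpace N L : Set (WaveFn N L)) := by
  have hcont : ∀ σ : Equiv.Perm (Fin N), Continuous (permuteWave (L := L) σ) := fun σ =>
    (Lp.compMeasurePreservingₗᵢ ℂ (permuteConfig σ) (measurePreserving_permuteConfig σ)).continuous
  simp only [FermiSpace, Submodule.coe_set_mk, AddSubmonoid.coe_set_mk, AddSubsemigroup.coe_set_mk,
    Set.ofPred_forall]
  exact isClosed_iInter fun σ => isClosed_eq (hcont σ) (continuous_const_smul _)

instance : CompleteSpace (FermiSpace N L) := isClosed_fermiSpace.completeSpace_coe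

theorem fermiSpace_ext {ψ χ : FermiSpace N L}
    (h : ∀ q, amplitude (ψ : WaveFn N L) q = amplitude (χ : WaveFn N L) q) : ψ = χ :=
  Subtype.ext (amplitude_ext h)

theorem inner_multiplier_left {T : FermiSpace N L → FermiSpace N L} {g : Mode N → ℝ}
    (hT : ∀ ψ q, amplitude (T ψ : WaveFn N L) q = g q * amplitude (ψ : WaveFn N L) q)
    (φ ψ : FermiSpace N L) : (inner ℂ (T φ) ψ : ℂ) = inner ℂ φ (T ψ) := by
  refine (hasSum_conj_amplitude_mul (T φ : WaveFn N L) (ψ : WaveFn N L)).unique ?_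
  convert! hasSum_conj_amplitude_mul (φ : WaveFn N L) (T ψ : WaveFn N L) using 2 with q
  rw [hT, hT, map_mul, Complex.conj_ofReal]
  ring

theorem exists_fermiSpace_multiplier {g : Mode N → ℝ} {C : ℝ} (hg : ∀ q, |g q| ≤ C)
    (hsymm : ∀ σ q, g (permuteMode σ q) = g q) :
    ∃ T : FermiSpace N L →L[ℂ] FermiSpace N L, (∀ (ψ : FermiSpace N L) q,
      amplitude (T ψ : WaveFn N L) q = g q * amplitude (ψ : WaveFn N L) q) ∧
      (Tendsto g cofinite (𝓝 0) → IsCompactOperator T) := by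
  obtain ⟨T, hT⟩ := exists_diagonalOperator (planeWaveBasis N L) (g := fun q => (g q : ℂ))
    (fun q => by simpa using hg q) ((abs_nonneg _).trans (hg 0))
  have hmem : ∀ ψ : FermiSpace N L, T ψ ∈ FermiSpace N L := fun ψ =>
    mem_fermiSpace_iff.2 fun σ q => by
      simp only [← inner_planeWaveBasis, hT]
      simp only [inner_planeWaveBasis, hsymm, mem_fermiSpace_iff.1 ψ.2 σ q, mul_left_comm]
  refine ⟨(T ∘L (FermiSpace N L).subtypeL).codRestrict _ hmem, fun ψ q => ?_, fun hlim => ?_⟩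
  · change amplitude (T ψ) q = _
    simpa only [inner_planeWaveBasis] using hT ψ q
  · have hcompact := isCompactOperator_of_inner_eq_mul hT
      (by simpa [Function.comp_def] using (Complex.continuous_ofReal.tendsto 0).comp hlim)
    exact (hcompact.comp_clm (FermiSpace N L).subtypeL).codRestrict hmem isClosed_fermiSpace

end FermiSpace

section FourierSeries

variable {L : ℝ} [Fact (0 < L)]

theorem integrable_continuousMap (μ : Measure (AddCircle L)) [IsFiniteMeasure μ]
    (ρ : C(AddCircle L, ℂ)) : Integrable (fun y => ρ y) μ :=
  ρ.continuous.integrable_of_hasCompactSupport (HasCompactSupport.of_compactSpace _)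

/-- The functional `h ↦ ∫ h(g x) w(x) dμ` on continuous functions on the ring: the image under `g`
of the complex measure `w μ`. -/
def pushforwardFunctional {X : Type*} [MeasurableSpace X] (μ : Measure X) {g : X → AddCircle L}
    (hg : Measurable g) {w : X → ℂ} (hw : Integrable w μ) : C(AddCircle L, ℂ) →L[ℂ] ℂ :=
  have hint : ∀ h : C(AddCircle L, ℂ), Integrable (fun x => h (g x) * w x) μ := fun h =>
    hw.bdd_mul (c := ‖h‖) (h.continuous.measurable.comp hg).aestronglyMeasurable
      (Eventually.of_forall fun _ => h.norm_coe_le_norm _)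
  LinearMap.mkContinuous
    { toFun := fun h => ∫ x, h (g x) * w x ∂μ
      map_add' := fun h h' => by
        rw [← integral_add (hint h) (hint h')]
        simp only [ContinuousMap.add_apply, add_mul]
      map_smul' := fun c h => by
        rw [RingHom.id_apply, smul_eq_mul, ← integral_const_mul]
        simp only [ContinuousMap.smul_apply, smul_eq_mul, mul_assoc] }
    (∫ x, ‖w x‖ ∂μ) fun h => by
      rw [mul_comm, ← integral_const_mul]
      refine norm_integral_le_of_norm_le (hw.norm.const_mul _) (Eventually.of_forall fun x => ?_)
      rw [norm_mul]
      gcongr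
      exact h.norm_coe_le_norm _

theorem pushforwardFunctional_apply {X : Type*} [MeasurableSpace X] {μ : Measure X}
    {g : X → AddCircle L} (hg : Measurable g) {w : X → ℂ} (hw : Integrable w μ)
    (h : C(AddCircle L, ℂ)) : pushforwardFunctional μ hg hw h = ∫ x, h (g x) * w x ∂μ := rfl

theorem eq_of_forall_integral_fourier_mul {ρ ρ' : C(AddCircle L, ℂ)}
    (h : ∀ m : ℤ, ∫ y : AddCircle L, fourier m y * ρ y = ∫ y : AddCircle L, fourier m y * ρ' y) :
    ρ = ρ' := by
  apply ContinuousMap.toLp_injective (p := 2) (𝕜 := ℂ) AddCircle.haarAddCircle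
  apply (fourierBasis (T := L)).repr.injective
  ext m
  rw [fourierBasis_repr, fourierBasis_repr, fourierCoeff_toLp, fourierCoeff_toLp]
  simp only [fourierCoeff, AddCircle.integral_haarAddCircle, smul_eq_mul, h]

theorem integral_fourier_mul_fourier_neg (m k : ℤ) :
    ∫ y : AddCircle L, fourier (-k) y * fourier m y = if k = m then (L : ℂ) else 0 := by
  simp only [← fourier_add, integral_fourier, neg_add_eq_zero]

theorem exists_integral_fourier_mul_eq {c : ℤ → ℂ} (hc : Summable fun m => ‖c m‖) :
    ∃ ρ : C(AddCircle L, ℂ), (∀ m : ℤ, ∫ y : AddCircle L, fourier m y * ρ y = c m) ∧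
      ‖ρ‖ ≤ L⁻¹ * ∑' m, ‖c m‖ := by
  have hL : 0 < L := Fact.out
  let f : ℤ → C(AddCircle L, ℂ) := fun k => ((L⁻¹ : ℝ) * c k : ℂ) • fourier (-k)
  have hnorm : ∀ k, ‖f k‖ ≤ L⁻¹ * ‖c k‖ := fun k => by
    rw [norm_smul, fourier_norm, mul_one, norm_mul, Complex.norm_real,
      Real.norm_of_nonneg (by positivity)]
  have hf : Summable f := .of_norm_bounded (hc.mul_left _) hnorm
  refine ⟨∑' k, f k, fun m => ?_, tsum_of_norm_bounded (hc.hasSum.mul_left _) hnorm⟩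
  have hint : Integrable fun y : AddCircle L => fourier m y := integrable_continuousMap _ _
  let Φ := pushforwardFunctional volume measurable_id hint
  have hΦ : ∀ k, Φ (f k) = if k = m then c m else 0 := fun k => by
    rw [map_smul, pushforwardFunctional_apply]
    simp only [id, integral_fourier_mul_fourier_neg]
    split_ifs with hk
    · rw [hk, smul_eq_mul, mul_right_comm, ← Complex.ofReal_mul, inv_mul_cancel₀ hL.ne',
        Complex.ofReal_one, one_mul]
    · rw [smul_zero]
  have hsum := Φ.hasSum hf.hasSum
  simp only [hΦ] at hsum
  rw [← hsum.unique (hasSum_ite_eq m (c m)), pushforwardFunctional_apply]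
  simp only [id, mul_comm]

end FourierSeries

section PairDensity

variable {N : ℕ} {L : ℝ}

/-- Transfer of `m` units of momentum from the impurity to the host particle `n`. -/
def shiftMode (n : Fin N) (m : ℤ) (q : Mode N) : Mode N := (q.1 + Pi.single n m, q.2 - m)

theorem shiftMode_neg_shiftMode (n : Fin N) (m : ℤ) (q : Mode N) :
    shiftMode n (-m) (shiftMode n m q) = q := by
  simp [shiftMode, Pi.single_neg]

theorem totalMomentum_shiftMode (n : Fin N) (m : ℤ) (q : Mode N) :
    ∑ i, (shiftMode n m q).1 i + (shiftMode n m q).2 = ∑ i, q.1 i + q.2 := by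
  simp [shiftMode, Finset.sum_add_distrib]

theorem fourier_mul_planeWaveFun (n : Fin N) (m : ℤ) (q : Mode N) (x : Config N L) :
    fourier m (x.1 n - x.2) * planeWaveFun q x = planeWaveFun (shiftMode n m q) x := by
  have hprod : ∏ i, (fourier ((Pi.single n m : Fin N → ℤ) i) (x.1 i) : ℂ) = fourier m (x.1 n) := by
    rw [Finset.prod_eq_single n (fun i _ hi => by rw [Pi.single_eq_of_ne hi, fourier_zero])
      (by simp), Pi.single_eq_same]
  have hsub : (fourier m (x.1 n - x.2) : ℂ) = fourier m (x.1 n) * fourier (-m) x.2 := by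
    rw [fourier_apply, fourier_apply, fourier_apply, zsmul_sub, sub_eq_add_neg,
      AddCircle.toCircle_add, neg_smul, Circle.coe_mul]
  simp only [planeWaveFun, ContinuousMap.coe_mk, shiftMode, Pi.add_apply, fourier_add,
    Finset.prod_mul_distrib, sub_eq_add_neg q.2, hprod, hsub]
  ring

variable [Fact (0 < L)]

theorem integrable_conj_mul (φ ψ : WaveFn N L) : Integrable fun x => conj (φ x) * ψ x := by
  simpa only [RCLike.inner_apply, mul_comm] using L2.integrable_inner (𝕜 := ℂ) φ ψ

theorem inner_eq_integral_conj_mul (φ ψ : WaveFn N L) : inner ℂ φ ψ = ∫ x, conj (φ x) * ψ x := by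
  simp only [L2.inner_def, RCLike.inner_apply, mul_comm]

theorem hasSum_integral_fourier_mul (n : Fin N) (m : ℤ) (φ ψ : WaveFn N L) :
    HasSum (fun q => conj (amplitude φ (shiftMode n m q)) * amplitude ψ q)
      (∫ x : Config N L, fourier m (x.1 n - x.2) * (conj (φ x) * ψ x)) := by
  have hmem : MemLp (fun x : Config N L => conj (fourier m (x.1 n - x.2)) * φ x) 2 volume := by
    refine (Lp.memLp φ).of_le_mul (c := 1) (.mul ?_ (Lp.aestronglyMeasurable φ))
      (Eventually.of_forall fun x => ?_)
    · exact Continuous.aestronglyMeasurable (by fun_prop)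
    · rw [norm_mul, RCLike.norm_conj, fourier_apply, Circle.norm_coe]
  have hinner : ∀ χ : WaveFn N L, (inner ℂ hmem.toLp χ : ℂ) =
      ∫ x : Config N L, fourier m (x.1 n - x.2) * (conj (φ x) * χ x) := fun χ => by
    rw [inner_eq_integral_conj_mul]
    refine integral_congr_ae ?_
    filter_upwards [hmem.coeFn_toLp] with x hx
    rw [hx, map_mul, Complex.conj_conj, mul_assoc]
  have hamp (q) : conj (amplitude hmem.toLp q) = conj (amplitude φ (shiftMode n m q)) := by
    rw [amplitude, amplitude, inner_conj_symm, inner_conj_symm, hinner, inner_eq_integral_conj_mul]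
    refine integral_congr_ae ?_
    filter_upwards [ContinuousMap.coeFn_toLp (p := 2) (𝕜 := ℂ) volume (planeWaveFun (L := L) q),
      ContinuousMap.coeFn_toLp (p := 2) (𝕜 := ℂ) volume (planeWaveFun (L := L) (shiftMode n m q))]
      with x hq hshift
    rw [planeWave, planeWave, hq, hshift, ← fourier_mul_planeWaveFun]
    ring
  simpa only [← hinner, hamp] using hasSum_conj_amplitude_mul hmem.toLp ψ

theorem isPairDensity_iff_hasSum {n : Fin N} {φ ψ : WaveFn N L} {ρ : C(AddCircle L, ℂ)} :
    IsPairDensity n φ ψ ρ ↔ ∀ m : ℤ,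
      HasSum (fun q => conj (amplitude φ (shiftMode n m q)) * amplitude ψ q)
        (∫ y : AddCircle L, fourier m y * ρ y) := by
  refine ⟨fun h m => h (fourier m) ▸ hasSum_integral_fourier_mul n m φ ψ, fun h => ?_⟩
  have hrel : Measurable fun x : Config N L => x.1 n - x.2 := Continuous.measurable (by fun_prop)
  have hfun : pushforwardFunctional volume hrel (integrable_conj_mul φ ψ) =
      pushforwardFunctional volume measurable_id (integrable_continuousMap volume ρ) := by
    refine ContinuousLinearMap.ext_on (s := Set.range (fourier (T := L)))
      (Submodule.dense_iff_topologicalClosure_eq_top.2 span_fourier_closure_eq_top) ?_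
    rintro _ ⟨m, rfl⟩
    exact (hasSum_integral_fourier_mul n m φ ψ).unique (h m)
  exact fun f => DFunLike.congr_fun hfun f

namespace IsPairDensity

variable {n : Fin N} {φ ψ ψ' : WaveFn N L} {ρ ρ' : C(AddCircle L, ℂ)}

theorem unique (h : IsPairDensity n φ ψ ρ) (h' : IsPairDensity n φ ψ ρ') : ρ = ρ' :=
  eq_of_forall_integral_fourier_mul fun m =>
    (isPairDensity_iff_hasSum.1 h m).unique (isPairDensity_iff_hasSum.1 h' m)

theorem pairDensity_eq (h : IsPairDensity n φ ψ ρ) : pairDensity n φ ψ = ρ := by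
  have hex : ∃ ρ, IsPairDensity n φ ψ ρ := ⟨ρ, h⟩
  rw [pairDensity, dif_pos hex]
  exact hex.choose_spec.unique h

theorem add_right (h : IsPairDensity n φ ψ ρ) (h' : IsPairDensity n φ ψ' ρ') :
    IsPairDensity n φ (ψ + ψ') (ρ + ρ') := isPairDensity_iff_hasSum.2 fun m => by
  simp only [ContinuousMap.add_apply, amplitude_add, mul_add]
  convert (isPairDensity_iff_hasSum.1 h m).add (isPairDensity_iff_hasSum.1 h' m) using 1
  exact integral_add (integrable_continuousMap volume (fourier m * ρ))
    (integrable_continuousMap volume (fourier m * ρ'))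

theorem smul_right (h : IsPairDensity n φ ψ ρ) (c : ℂ) : IsPairDensity n φ (c • ψ) (c • ρ) :=
  isPairDensity_iff_hasSum.2 fun m => by
    simp only [ContinuousMap.smul_apply, smul_eq_mul, amplitude_smul, mul_left_comm _ c,
      integral_const_mul]
    exact (isPairDensity_iff_hasSum.1 h m).mul_left c

theorem symm (h : IsPairDensity n φ ψ ρ) : IsPairDensity n ψ φ (star ρ) := fun f => by
  have hstar := congrArg conj (h (star f))
  simp only [← integral_conj, map_mul, ContinuousMap.star_apply, RCLike.star_def,
    Complex.conj_conj] at hstar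
  simpa only [ContinuousMap.star_apply, RCLike.star_def, mul_comm (φ _)] using hstar

end IsPairDensity

theorem exists_isPairDensity (n : Fin N) {φ ψ : WaveFn N L}
    (hs : Summable fun p : ℤ × Mode N =>
      ‖amplitude φ (shiftMode n p.1 p.2)‖ * ‖amplitude ψ p.2‖) :
    ∃ ρ, IsPairDensity n φ ψ ρ ∧
      ‖ρ‖ ≤ L⁻¹ * ∑' p : ℤ × Mode N, ‖amplitude φ (shiftMode n p.1 p.2)‖ * ‖amplitude ψ p.2‖ := by
  have hL : 0 < L := Fact.out
  have hnorm : ∀ m : ℤ, Summable fun q => ‖conj (amplitude φ (shiftMode n m q)) * amplitude ψ q‖ :=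
    fun m => by simpa only [norm_mul, RCLike.norm_conj] using hs.prod_factor m
  have hle : ∀ m : ℤ, ‖∑' q, conj (amplitude φ (shiftMode n m q)) * amplitude ψ q‖ ≤
      ∑' q, ‖amplitude φ (shiftMode n m q)‖ * ‖amplitude ψ q‖ := fun m => by
    simpa only [norm_mul, RCLike.norm_conj] using norm_tsum_le_tsum_norm (hnorm m)
  have hc : Summable fun m : ℤ =>
      ‖∑' q, conj (amplitude φ (shiftMode n m q)) * amplitude ψ q‖ :=
    .of_nonneg_of_le (fun _ => norm_nonneg _) hle hs.prod
  obtain ⟨ρ, hρ, hρnorm⟩ := exists_integral_fourier_mul_eq (L := L) hc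
  refine ⟨ρ, isPairDensity_iff_hasSum.2 fun m => ?_, hρnorm.trans ?_⟩
  · rw [hρ m]
    exact (hnorm m).of_norm.hasSum
  · rw [hs.tsum_prod]
    gcongr
    exacts [hs.prod, hle _]

end PairDensity

section ShiftEstimate

variable {N : ℕ} {f g : Mode N → ℝ} {κ : ℤ → ℝ} {a b c : ℝ}

theorem hasSum_shiftMode_mul (n : Fin N) (hf : HasSum f a) (hκ : HasSum κ c) (hf₀ : 0 ≤ f)
    (hκ₀ : 0 ≤ κ) : HasSum (fun p : ℤ × Mode N => f (shiftMode n p.1 p.2) * κ p.2.2) (a * c) := by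
  let e : ℤ × Mode N ≃ Mode N × ℤ :=
    { toFun p := (shiftMode n p.1 p.2, p.2.2)
      invFun p := (p.2 - p.1.2, shiftMode n (-(p.2 - p.1.2)) p.1)
      left_inv p := by
        have h : p.2.2 - (shiftMode n p.1 p.2).2 = p.1 := by simp [shiftMode]
        simp only [h, shiftMode_neg_shiftMode]
      right_inv p := Prod.ext
        (by simpa only [neg_neg] using shiftMode_neg_shiftMode n (-(p.2 - p.1.2)) p.1)
        (by simp [shiftMode]) }
  exact e.hasSum_iff.2 (hf.mul hκ (hf.summable.mul_of_nonneg hκ.summable hf₀ hκ₀))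

theorem hasSum_mul_shiftMode (n : Fin N) (hf : HasSum f a) (hκ : HasSum κ c) (hf₀ : 0 ≤ f)
    (hκ₀ : 0 ≤ κ) :
    HasSum (fun p : ℤ × Mode N => f p.2 * κ (shiftMode n p.1 p.2).2) (a * c) := by
  let e : ℤ × Mode N ≃ Mode N × ℤ :=
    { toFun p := (p.2, p.2.2 - p.1)
      invFun p := (p.1.2 - p.2, p.1)
      left_inv p := by simp
      right_inv p := by simp }
  exact e.hasSum_iff.2 (hf.mul hκ (hf.summable.mul_of_nonneg hκ.summable hf₀ hκ₀))

variable {L : ℝ} [Fact (0 < L)]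

-- The weights `κ` are paired crosswise, which makes both resulting double sums factorize.
theorem norm_amplitude_mul_le (hκ₀ : 0 ≤ κ) (hf₀ : 0 ≤ f) (hg₀ : 0 ≤ g) {φ ψ : WaveFn N L}
    (hφ : ∀ q, ‖amplitude φ q‖ ^ 2 ≤ κ q.2 * f q) (hψ : ∀ q, ‖amplitude ψ q‖ ^ 2 ≤ κ q.2 * g q)
    (q q' : Mode N) :
    ‖amplitude φ q'‖ * ‖amplitude ψ q‖ ≤ 1 / 2 * (f q' * κ q.2 + g q * κ q'.2) := by
  have hx : 0 ≤ f q' * κ q.2 := mul_nonneg (hf₀ _) (hκ₀ _)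
  have hy : 0 ≤ g q * κ q'.2 := mul_nonneg (hg₀ _) (hκ₀ _)
  have hsq : (‖amplitude φ q'‖ * ‖amplitude ψ q‖) ^ 2 ≤ f q' * κ q.2 * (g q * κ q'.2) :=
    calc (‖amplitude φ q'‖ * ‖amplitude ψ q‖) ^ 2
        = ‖amplitude φ q'‖ ^ 2 * ‖amplitude ψ q‖ ^ 2 := mul_pow _ _ _
      _ ≤ κ q'.2 * f q' * (κ q.2 * g q) := by
          gcongr
          exacts [mul_nonneg (hκ₀ _) (hf₀ _), hφ q', hψ q]
      _ = f q' * κ q.2 * (g q * κ q'.2) := by ring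
  refine le_of_sq_le_sq ?_ (by positivity)
  nlinarith [sq_nonneg (f q' * κ q.2 - g q * κ q'.2)]

theorem exists_isPairDensity_of_sq_norm_amplitude_le (n : Fin N) (hκ : HasSum κ c) (hκ₀ : 0 ≤ κ)
    (hf : HasSum f a) (hf₀ : 0 ≤ f) (hg : HasSum g b) (hg₀ : 0 ≤ g) {φ ψ : WaveFn N L}
    (hφ : ∀ q, ‖amplitude φ q‖ ^ 2 ≤ κ q.2 * f q) (hψ : ∀ q, ‖amplitude ψ q‖ ^ 2 ≤ κ q.2 * g q) :
    ∃ ρ, IsPairDensity n φ ψ ρ ∧ ‖ρ‖ ≤ L⁻¹ * (c / 2 * (a + b)) := by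
  have hL : 0 < L := Fact.out
  have hmajorant := ((hasSum_shiftMode_mul n hf hκ hf₀ hκ₀).add
    (hasSum_mul_shiftMode n hg hκ hg₀ hκ₀)).mul_left (1 / 2)
  have hle := fun p : ℤ × Mode N =>
    norm_amplitude_mul_le hκ₀ hf₀ hg₀ hφ hψ p.2 (shiftMode n p.1 p.2)
  have hsum := Summable.of_nonneg_of_le (fun p => by positivity) hle hmajorant.summable
  obtain ⟨ρ, hρ, hnorm⟩ := exists_isPairDensity n hsum
  refine ⟨ρ, hρ, hnorm.trans ?_⟩
  gcongr
  calc _ ≤ 1 / 2 * (a * c + b * c) := hasSum_le hle hsum.hasSum hmajorant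
    _ = c / 2 * (a + b) := by ring

end ShiftEstimate

section Potential

variable {L : ℝ} (U : SignedMeasure (AddCircle L))

/-- Total variation norm of the potential. -/
def totalVariationNorm : ℝ :=
  U.toJordanDecomposition.posPart.real Set.univ + U.toJordanDecomposition.negPart.real Set.univ

theorem totalVariationNorm_nonneg : 0 ≤ totalVariationNorm U := by
  unfold totalVariationNorm
  positivity

theorem signedIntegral_smul (c : ℂ) (ρ : C(AddCircle L, ℂ)) :
    signedIntegral U (c • ρ : C(AddCircle L, ℂ)) = c * signedIntegral U ρ := by
  simp only [signedIntegral, ContinuousMap.smul_apply, smul_eq_mul, integral_const_mul, mul_sub]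

theorem signedIntegral_star (ρ : C(AddCircle L, ℂ)) :
    signedIntegral U (star ρ : C(AddCircle L, ℂ)) = conj (signedIntegral U ρ) := by
  simp only [signedIntegral, ContinuousMap.star_apply, RCLike.star_def, map_sub, ← integral_conj]

theorem norm_signedIntegral_le [Fact (0 < L)] (ρ : C(AddCircle L, ℂ)) :
    ‖signedIntegral U ρ‖ ≤ ‖ρ‖ * totalVariationNorm U := by
  refine (norm_sub_le _ _).trans ?_
  rw [totalVariationNorm, mul_add]
  exact add_le_add
    (norm_integral_le_of_norm_le_const (Eventually.of_forall fun y => ρ.norm_coe_le_norm y))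
    (norm_integral_le_of_norm_le_const (Eventually.of_forall fun y => ρ.norm_coe_le_norm y))

variable [Fact (0 < L)]

theorem signedIntegral_add (ρ ρ' : C(AddCircle L, ℂ)) :
    signedIntegral U (ρ + ρ' : C(AddCircle L, ℂ)) = signedIntegral U ρ + signedIntegral U ρ' := by
  simp only [signedIntegral, ContinuousMap.add_apply]
  rw [integral_add (integrable_continuousMap _ ρ) (integrable_continuousMap _ ρ'),
    integral_add (integrable_continuousMap _ ρ) (integrable_continuousMap _ ρ')]
  ring

variable {N : ℕ} {φ ψ ψ' : WaveFn N L}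

/-- All relative coordinates `xₙ - xᵢ` have a continuous density under `conj φ ψ dx`, so that
`⟨φ|V|ψ⟩` is not evaluated on the default value of `pairDensity`. -/
def HasPairDensities (φ ψ : WaveFn N L) : Prop := ∀ n, ∃ ρ, IsPairDensity n φ ψ ρ

theorem IsPairDensity.potentialForm_eq {ρ : Fin N → C(AddCircle L, ℂ)}
    (hρ : ∀ n, IsPairDensity n φ ψ (ρ n)) :
    potentialForm U φ ψ = ∑ n, signedIntegral U (ρ n) :=
  Finset.sum_congr rfl fun n _ => by rw [(hρ n).pairDensity_eq]

namespace HasPairDensities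

theorem potentialForm_add_right (h : HasPairDensities φ ψ) (h' : HasPairDensities φ ψ') :
    potentialForm U φ (ψ + ψ') = potentialForm U φ ψ + potentialForm U φ ψ' := by
  choose ρ hρ using h
  choose ρ' hρ' using h'
  rw [IsPairDensity.potentialForm_eq U hρ, IsPairDensity.potentialForm_eq U hρ',
    IsPairDensity.potentialForm_eq U fun n => (hρ n).add_right (hρ' n), ← Finset.sum_add_distrib]
  simp only [signedIntegral_add]

theorem potentialForm_smul_right (h : HasPairDensities φ ψ) (c : ℂ) :
    potentialForm U φ (c • ψ) = c * potentialForm U φ ψ := by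
  choose ρ hρ using h
  rw [IsPairDensity.potentialForm_eq U hρ,
    IsPairDensity.potentialForm_eq U fun n => (hρ n).smul_right c, Finset.mul_sum]
  simp only [signedIntegral_smul]

theorem conj_potentialForm (h : HasPairDensities φ ψ) :
    conj (potentialForm U φ ψ) = potentialForm U ψ φ := by
  choose ρ hρ using h
  rw [IsPairDensity.potentialForm_eq U hρ, IsPairDensity.potentialForm_eq U fun n => (hρ n).symm,
    map_sum]
  simp only [signedIntegral_star]

end HasPairDensities

theorem norm_potentialForm_le {C : ℝ} (h : ∀ n, ∃ ρ, IsPairDensity n φ ψ ρ ∧ ‖ρ‖ ≤ C) :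
    ‖potentialForm U φ ψ‖ ≤ N * (C * totalVariationNorm U) := by
  choose ρ hρ hC using h
  rw [IsPairDensity.potentialForm_eq U hρ]
  calc ‖∑ n, signedIntegral U (ρ n)‖ ≤ ∑ _ : Fin N, C * totalVariationNorm U :=
        norm_sum_le_of_le _ fun n _ => (norm_signedIntegral_le U _).trans
          (mul_le_mul_of_nonneg_right (hC n) (totalVariationNorm_nonneg U))
    _ = N * (C * totalVariationNorm U) := by simp

end Potential

section SesquilinearForms

variable {H : Type*} [NormedAddCommGroup H] [InnerProductSpace ℂ H] {f : H →ₗ⋆[ℂ] H →ₗ[ℂ] ℂ}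
  {K : ℝ}

theorem norm_le_mul_of_norm_le_add_sq (hf : ∀ u v, ‖f u v‖ ≤ K / 2 * (‖u‖ ^ 2 + ‖v‖ ^ 2))
    (u v : H) : ‖f u v‖ ≤ K * ‖u‖ * ‖v‖ := by
  rcases eq_or_ne u 0 with rfl | hu
  · simp
  rcases eq_or_ne v 0 with rfl | hv
  · simp
  have hscaled := hf ((‖u‖⁻¹ : ℂ) • u) ((‖v‖⁻¹ : ℂ) • v)
  simp only [map_smulₛₗ, LinearMap.smul_apply, RingHom.id_apply, norm_smul, RCLike.norm_conj,
    norm_inv, Complex.norm_real, norm_norm, inv_mul_cancel₀ (norm_ne_zero_iff.2 hu),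
    inv_mul_cancel₀ (norm_ne_zero_iff.2 hv)] at hscaled
  calc ‖f u v‖ = ‖u‖⁻¹ * (‖v‖⁻¹ * ‖f u v‖) * (‖u‖ * ‖v‖) := by
        field_simp [norm_ne_zero_iff.2 hu, norm_ne_zero_iff.2 hv]
    _ ≤ K * (‖u‖ * ‖v‖) := by
        gcongr
        linarith
    _ = K * ‖u‖ * ‖v‖ := (mul_assoc _ _ _).symm

theorem exists_continuousLinearMap_inner_eq [CompleteSpace H]
    (hf : ∀ u v, ‖f u v‖ ≤ K / 2 * (‖u‖ ^ 2 + ‖v‖ ^ 2)) :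
    ∃ B : H →L[ℂ] H, ∀ u v, inner ℂ u (B v) = f u v := by
  let F := f.mkContinuous₂ K (norm_le_mul_of_norm_le_add_sq hf)
  refine ⟨ContinuousLinearMap.adjoint (InnerProductSpace.continuousLinearMapOfBilin F),
    fun u v => ?_⟩
  rw [ContinuousLinearMap.adjoint_inner_right]
  exact InnerProductSpace.continuousLinearMapOfBilin_apply F u v

theorem exists_continuousLinearEquiv_inner_eq [CompleteSpace H] {A : H →L[ℂ] H}
    (hA : (A : H →ₗ[ℂ] H).IsSymmetric) {c : ℝ} (hc : 0 < c)
    (hcoercive : ∀ u, c * ‖u‖ ^ 2 ≤ (inner ℂ u (A u)).re) :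
    ∃ T : H ≃L[ℂ] H, ∀ u v, inner ℂ (T u) (T v) = inner ℂ u (A v) := by
  have hpos : 0 ≤ A := by
    refine (ContinuousLinearMap.nonneg_iff_isPositive A).2 ⟨hA, fun u => ?_⟩
    rw [ContinuousLinearMap.reApplyInnerSelf_apply, inner_re_symm]
    exact (mul_nonneg hc.le (sq_nonneg _)).trans (hcoercive u)
  have hunit : IsUnit A :=
    ContinuousLinearMap.isUnit_of_forall_le_norm_inner_map A (c := ⟨c, hc.le⟩) hc fun u =>
      calc ‖u‖ ^ 2 * c ≤ (inner ℂ u (A u)).re := by rw [mul_comm]; exact hcoercive u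
        _ ≤ ‖(inner ℂ u (A u) : ℂ)‖ := Complex.re_le_norm _
        _ = ‖(inner ℂ (A u) u : ℂ)‖ := norm_inner_symm _ _
  obtain ⟨T, hT⟩ := (CFC.isUnit_sqrt_iff A hpos).2 hunit
  have hself : ContinuousLinearMap.adjoint (CFC.sqrt A) = CFC.sqrt A :=
    (CFC.sqrt_nonneg A).isSelfAdjoint
  refine ⟨ContinuousLinearEquiv.ofUnit T, fun u v => ?_⟩
  change inner ℂ ((T : H →L[ℂ] H) u) ((T : H →L[ℂ] H) v) = _
  rw [hT, ← ContinuousLinearMap.adjoint_inner_right, hself]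
  exact congrArg (inner ℂ u) (DFunLike.congr_fun (CFC.sqrt_mul_sqrt_self A hpos) v)

theorem exists_continuousLinearEquiv_inner_add_eq [CompleteSpace H]
    (hsymm : ∀ u v, conj (f u v) = f v u) (hK : K < 1)
    (hf : ∀ u v, ‖f u v‖ ≤ K / 2 * (‖u‖ ^ 2 + ‖v‖ ^ 2)) :
    ∃ T : H ≃L[ℂ] H, ∀ u v, inner ℂ (T u) (T v) = inner ℂ u v + f u v := by
  obtain ⟨B, hB⟩ := exists_continuousLinearMap_inner_eq hf
  have hform : ∀ u v, inner ℂ u ((1 + B) v) = inner ℂ u v + f u v := fun u v => by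
    rw [← hB, ← inner_add_right]
    rfl
  have hselfAdjoint : ((1 + B : H →L[ℂ] H) : H →ₗ[ℂ] H).IsSymmetric := fun u v => by
    change inner ℂ ((1 + B) u) v = inner ℂ u ((1 + B) v)
    rw [← inner_conj_symm, hform, hform, map_add, hsymm, inner_conj_symm]
  have hcoercive : ∀ u, (1 - K) * ‖u‖ ^ 2 ≤ (inner ℂ u ((1 + B) u)).re := fun u => by
    have hre := (abs_le.1 ((Complex.abs_re_le_norm _).trans (hf u u))).1
    have hnorm : (inner ℂ u u : ℂ).re = ‖u‖ ^ 2 := inner_self_eq_norm_sq (𝕜 := ℂ) u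
    rw [hform, Complex.add_re, hnorm]
    linarith
  obtain ⟨T, hT⟩ :=
    exists_continuousLinearEquiv_inner_eq hselfAdjoint (sub_pos.2 hK) hcoercive
  exact ⟨T, fun u v => (hT u v).trans (hform u v)⟩

end SesquilinearForms

section KineticEnergy

theorem summable_inv_add_mul_sq {a b : ℝ} (ha : 0 < a) (hb : 0 ≤ b) :
    Summable fun s : ℤ => (b + a * (s : ℝ) ^ 2)⁻¹ := by
  refine Summable.of_norm_bounded_eventually
    ((Real.summable_one_div_int_pow.2 one_lt_two).mul_left a⁻¹) ?_
  filter_upwards [eventually_cofinite_ne (0 : ℤ)] with s hs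
  rw [Real.norm_of_nonneg (by positivity), one_div, ← mul_inv]
  gcongr
  linarith

theorem tendsto_tsum_inv_add_mul_sq {a : ℝ} (ha : 0 < a) :
    Tendsto (fun b : ℝ => ∑' s : ℤ, (b + a * (s : ℝ) ^ 2)⁻¹) atTop (𝓝 0) := by
  rw [← tsum_zero (α := ℝ) (β := ℤ)]
  refine tendsto_tsum_of_dominated_convergence (summable_inv_add_mul_sq ha zero_le_one)
    (fun s => tendsto_inv_atTop_zero.comp (tendsto_atTop_add_const_right _ _ tendsto_id)) ?_
  filter_upwards [eventually_ge_atTop 1] with b hb s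
  rw [Real.norm_of_nonneg (by positivity)]
  gcongr

variable {N : ℕ} {L mh mi : ℝ}

theorem kineticEnergy_permuteMode (σ : Equiv.Perm (Fin N)) (q : Mode N) :
    kineticEnergy L mh mi (permuteMode σ q) = kineticEnergy L mh mi q := by
  simp only [kineticEnergy, permuteMode]
  rw [Equiv.sum_comp σ (fun n => ringMomentum L (q.1 n) ^ 2 / (2 * mh))]

theorem kineticEnergy_add_hostShift (q : Mode N) :
    kineticEnergy L mh mi q + hostShift N L mh =
      ∑ n, ringMomentum L (q.1 n) ^ 2 / (2 * mh) + ringMomentum L q.2 ^ 2 / (2 * mi) := by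
  rw [kineticEnergy]
  ring

theorem impurityEnergy_le (hmh : 0 ≤ mh) (q : Mode N) :
    ringMomentum L q.2 ^ 2 / (2 * mi) ≤ kineticEnergy L mh mi q + hostShift N L mh := by
  rw [kineticEnergy_add_hostShift]
  exact le_add_of_nonneg_left (Finset.sum_nonneg fun n _ => by positivity)

theorem hostEnergy_le (hmh : 0 ≤ mh) (hmi : 0 ≤ mi) (q : Mode N) (n : Fin N) :
    ringMomentum L (q.1 n) ^ 2 / (2 * mh) ≤ kineticEnergy L mh mi q + hostShift N L mh := by
  rw [kineticEnergy_add_hostShift]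
  exact (Finset.single_le_sum (f := fun n => ringMomentum L (q.1 n) ^ 2 / (2 * mh))
    (fun n _ => by positivity) (Finset.mem_univ n)).trans (le_add_of_nonneg_right (by positivity))

theorem finite_ringMomentum_sq_div_le {m : ℝ} (hL : 0 < L) (hm : 0 < m) (C : ℝ) :
    {k : ℤ | ringMomentum L k ^ 2 / (2 * m) ≤ C}.Finite := by
  refine (Set.finite_Icc (-⌈2 * m * C / (2 * Real.pi / L) ^ 2⌉)
    ⌈2 * m * C / (2 * Real.pi / L) ^ 2⌉).subset fun k hk => ?_
  have hsq : (k : ℝ) ^ 2 ≤ 2 * m * C / (2 * Real.pi / L) ^ 2 := by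
    have hk' : (2 * Real.pi / L * k) ^ 2 / (2 * m) ≤ C := hk
    rw [div_le_iff₀ (by positivity), mul_pow] at hk'
    rw [le_div_iff₀ (by positivity)]
    linarith
  have hceil : k ^ 2 ≤ ⌈2 * m * C / (2 * Real.pi / L) ^ 2⌉ := by
    exact_mod_cast hsq.trans (Int.le_ceil _)
  exact ⟨by linarith [Int.le_self_sq (-k), neg_sq k], (Int.le_self_sq k).trans hceil⟩

theorem tendsto_kineticEnergy (hL : 0 < L) (hmh : 0 < mh) (hmi : 0 < mi) :
    Tendsto (kineticEnergy L mh mi : Mode N → ℝ) cofinite atTop := by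
  refine tendsto_atTop.2 fun C => ?_
  rw [eventually_cofinite]
  refine ((Set.Finite.pi' fun _ : Fin N =>
    finite_ringMomentum_sq_div_le hL hmh (C + hostShift N L mh)).prod
      (finite_ringMomentum_sq_div_le hL hmi (C + hostShift N L mh))).subset fun q hq => ?_
  have hC : kineticEnergy L mh mi q + hostShift N L mh ≤ C + hostShift N L mh :=
    add_le_add_left (not_le.1 hq).le _
  exact ⟨fun n => (hostEnergy_le hmh.le hmi.le q n).trans hC, (impurityEnergy_le hmh.le q).trans hC⟩

end KineticEnergy

section KineticRoot

variable {N : ℕ} {L : ℝ} [Fact (0 < L)] {mh mi Λ : ℝ} {S : FermiSpace N L →L[ℂ] FermiSpace N L}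

/-- `S = (H⁰ + Λ)^{-1/2}` on the fermionic space, for `Λ` so large that `H⁰ + Λ` is positive. -/
structure IsKineticRoot (mh mi Λ : ℝ) (S : FermiSpace N L →L[ℂ] FermiSpace N L) : Prop where
  weight_pos : ∀ q : Mode N, 0 < Λ + kineticEnergy L mh mi q
  amplitude_apply : ∀ (ψ : FermiSpace N L) (q : Mode N), amplitude (S ψ : WaveFn N L) q =
    ((√(Λ + kineticEnergy L mh mi q))⁻¹ : ℝ) * amplitude (ψ : WaveFn N L) q

theorem exists_isKineticRoot (N : ℕ) (hmh : 0 < mh) (hmi : 0 < mi) {b : ℝ} (hb : 0 < b) :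
    ∃ S : FermiSpace N L →L[ℂ] FermiSpace N L,
      IsKineticRoot mh mi (b + hostShift N L mh) S ∧ IsCompactOperator S := by
  have hweight : ∀ q : Mode N, b ≤ b + hostShift N L mh + kineticEnergy L mh mi q := fun q => by
    have hp : 0 ≤ ringMomentum L q.2 ^ 2 / (2 * mi) := by positivity
    linarith [impurityEnergy_le (L := L) (mi := mi) hmh.le q]
  obtain ⟨S, hS, hcompact⟩ := exists_fermiSpace_multiplier (N := N) (L := L)
    (g := fun q => (√(b + hostShift N L mh + kineticEnergy L mh mi q))⁻¹) (C := (√b)⁻¹)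
    (fun q => by
      rw [abs_of_nonneg (by positivity)]
      exact inv_anti₀ (Real.sqrt_pos.2 hb) (Real.sqrt_le_sqrt (hweight q)))
    fun σ q => by rw [kineticEnergy_permuteMode]
  refine ⟨S, ⟨fun q => hb.trans_le (hweight q), hS⟩, hcompact ?_⟩
  exact tendsto_inv_atTop_zero.comp (Real.tendsto_sqrt_atTop.comp
    (tendsto_atTop_add_const_left _ _ (tendsto_kineticEnergy Fact.out hmh hmi)))

namespace IsKineticRoot

theorem weight_mul (h : IsKineticRoot mh mi Λ S) (u v : FermiSpace N L) (q : Mode N) :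
    ((Λ + kineticEnergy L mh mi q : ℝ) : ℂ) *
      (conj (amplitude (S u : WaveFn N L) q) * amplitude (S v : WaveFn N L) q) =
      conj (amplitude (u : WaveFn N L) q) * amplitude (v : WaveFn N L) q := by
  have hroot : ((Λ + kineticEnergy L mh mi q : ℝ) : ℂ) *
      (((√(Λ + kineticEnergy L mh mi q))⁻¹ : ℝ) *
        ((√(Λ + kineticEnergy L mh mi q))⁻¹ : ℝ)) = 1 := by
    have hpos := h.weight_pos q
    rw [← Complex.ofReal_mul, ← mul_inv, Real.mul_self_sqrt hpos.le, ← Complex.ofReal_mul,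
      mul_inv_cancel₀ hpos.ne', Complex.ofReal_one]
  rw [h.amplitude_apply, h.amplitude_apply, map_mul, Complex.conj_ofReal]
  linear_combination (conj (amplitude (u : WaveFn N L) q) * amplitude (v : WaveFn N L) q) * hroot

theorem weight_mul_sq_norm (h : IsKineticRoot mh mi Λ S) (u : FermiSpace N L) (q : Mode N) :
    (Λ + kineticEnergy L mh mi q) * ‖amplitude (S u : WaveFn N L) q‖ ^ 2 =
      ‖amplitude (u : WaveFn N L) q‖ ^ 2 := by
  have hdiag := h.weight_mul u u q
  rw [Complex.conj_mul', Complex.conj_mul'] at hdiag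
  exact_mod_cast hdiag

theorem injective (h : IsKineticRoot mh mi Λ S) : Function.Injective S := fun u v huv =>
  fermiSpace_ext fun q => by
    have hq := h.amplitude_apply u q
    rw [huv, h.amplitude_apply] at hq
    exact (mul_left_cancel₀ (Complex.ofReal_ne_zero.2
      (inv_ne_zero (Real.sqrt_pos.2 (h.weight_pos q)).ne')) hq).symm

theorem denseRange (h : IsKineticRoot mh mi Λ S) : DenseRange S := by
  change Dense (LinearMap.range (S : FermiSpace N L →ₗ[ℂ] FermiSpace N L) :
    Set (FermiSpace N L))
  rw [Submodule.dense_iff_topologicalClosure_eq_top, Submodule.topologicalClosure_eq_top_iff,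
    Submodule.eq_bot_iff]
  refine fun x hx => h.injective (ext_inner_right ℂ fun y => ?_)
  rw [inner_multiplier_left h.amplitude_apply, map_zero, inner_zero_left (𝕜 := ℂ)]
  exact (Submodule.mem_orthogonal' _ x).1 hx (S y) ⟨y, rfl⟩

end IsKineticRoot

end KineticRoot

section FormRealization

variable {N : ℕ} {L : ℝ} [Fact (0 < L)] {mh mi Λ : ℝ} {U : SignedMeasure (AddCircle L)}

namespace IsKineticRoot

variable {S : FermiSpace N L →L[ℂ] FermiSpace N L}

theorem finiteKineticEnergy (h : IsKineticRoot mh mi Λ S) (u : FermiSpace N L) :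
    FiniteKineticEnergy mh mi (S u : WaveFn N L) := by
  refine ((hasSum_sq_norm_amplitude (u : WaveFn N L)).summable.sub
    ((hasSum_sq_norm_amplitude (S u : WaveFn N L)).summable.mul_left Λ)).congr fun q => ?_
  rw [← h.weight_mul_sq_norm u q]
  ring

theorem exists_eq_of_finiteKineticEnergy (h : IsKineticRoot mh mi Λ S) {ψ : FermiSpace N L}
    (hψ : FiniteKineticEnergy mh mi (ψ : WaveFn N L)) : ∃ u, S u = ψ := by
  have hsum : Summable fun q : Mode N =>
      ‖(√(Λ + kineticEnergy L mh mi q) : ℂ) * amplitude (ψ : WaveFn N L) q‖ ^ 2 := by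
    refine (((hasSum_sq_norm_amplitude (ψ : WaveFn N L)).summable.mul_left Λ).add hψ).congr
      fun q => ?_
    rw [norm_mul, mul_pow, Complex.norm_real, Real.norm_eq_abs, sq_abs,
      Real.sq_sqrt (h.weight_pos q).le, add_mul]
  obtain ⟨v, hv⟩ := exists_inner_hilbertBasis_eq (planeWaveBasis N L) hsum
  simp only [inner_planeWaveBasis] at hv
  refine ⟨⟨v, mem_fermiSpace_iff.2 fun σ q => ?_⟩, fermiSpace_ext fun q => ?_⟩
  · rw [hv, hv, kineticEnergy_permuteMode, mem_fermiSpace_iff.1 ψ.2 σ q, mul_left_comm]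
  · rw [h.amplitude_apply, hv, ← mul_assoc, ← Complex.ofReal_mul,
      inv_mul_cancel₀ (Real.sqrt_pos.2 (h.weight_pos q)).ne', Complex.ofReal_one, one_mul]

theorem kineticForm_eq (h : IsKineticRoot mh mi Λ S) (u v : FermiSpace N L) :
    kineticForm mh mi (S u : WaveFn N L) (S v : WaveFn N L) + Λ * inner ℂ (S u) (S v) =
      inner ℂ u v := by
  have hsum := (hasSum_conj_amplitude_mul (u : WaveFn N L) (v : WaveFn N L)).sub
    ((hasSum_conj_amplitude_mul (S u : WaveFn N L) (S v : WaveFn N L)).mul_left (Λ : ℂ))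
  refine eq_sub_iff_add_eq.1 (Eq.trans (tsum_congr fun q => ?_) hsum.tsum_eq)
  rw [← h.weight_mul u v q]
  push_cast
  ring

theorem exists_isPairDensity (h : IsKineticRoot mh mi Λ S) {a b c : ℝ} (ha : 0 < a) (hb : 0 < b)
    (hc : HasSum (fun s : ℤ => (b + a * (s : ℝ) ^ 2)⁻¹) c)
    (hweight : ∀ q : Mode N, b + a * (q.2 : ℝ) ^ 2 ≤ Λ + kineticEnergy L mh mi q)
    (n : Fin N) (u v : FermiSpace N L) :
    ∃ ρ, IsPairDensity n (S u : WaveFn N L) (S v : WaveFn N L) ρ ∧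
      ‖ρ‖ ≤ L⁻¹ * (c / 2 * (‖u‖ ^ 2 + ‖v‖ ^ 2)) := by
  have hamplitude : ∀ (u : FermiSpace N L) q, ‖amplitude (S u : WaveFn N L) q‖ ^ 2 ≤
      (b + a * (q.2 : ℝ) ^ 2)⁻¹ * ‖amplitude (u : WaveFn N L) q‖ ^ 2 := fun u q => by
    rw [← h.weight_mul_sq_norm u q, ← div_eq_inv_mul, le_div_iff₀ (by positivity), mul_comm]
    exact mul_le_mul_of_nonneg_right (hweight q) (sq_nonneg _)
  exact exists_isPairDensity_of_sq_norm_amplitude_le n hc (fun s => by positivity)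
    (hasSum_sq_norm_amplitude (u : WaveFn N L)) (fun q => sq_nonneg _)
    (hasSum_sq_norm_amplitude (v : WaveFn N L)) (fun q => sq_nonneg _) (hamplitude u)
    (hamplitude v)

theorem exists_momentumOperator (h : IsKineticRoot mh mi Λ S) (hmi : 0 < mi)
    (hweight : ∀ q : Mode N, 1 + ringMomentum L q.2 ^ 2 / (2 * mi) ≤ Λ + kineticEnergy L mh mi q) :
    ∃ Q : FermiSpace N L →L[ℂ] FermiSpace N L, ∀ u, HasSum (fun q : Mode N =>
      ((ringMomentum L q.2 * ‖amplitude (S u : WaveFn N L) q‖ ^ 2 : ℝ) : ℂ)) (inner ℂ u (Q u)) := by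
  have hbound : ∀ q : Mode N, |ringMomentum L q.2 / (Λ + kineticEnergy L mh mi q)| ≤ 1 + mi :=
    fun q => by
      have hp : 2 * |ringMomentum L q.2| ≤ 1 + ringMomentum L q.2 ^ 2 := by
        rw [← sq_abs]
        nlinarith [sq_nonneg (|ringMomentum L q.2| - 1)]
      have hmul := mul_le_mul_of_nonneg_left (hweight q) (show 0 ≤ 1 + mi by linarith)
      have hexpand : (1 + mi) * (1 + ringMomentum L q.2 ^ 2 / (2 * mi)) =
          1 + mi + ringMomentum L q.2 ^ 2 / (2 * mi) + ringMomentum L q.2 ^ 2 / 2 := by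
        field_simp
        ring
      have hnonneg : 0 ≤ ringMomentum L q.2 ^ 2 / (2 * mi) := by positivity
      rw [abs_div, abs_of_pos (h.weight_pos q), div_le_iff₀ (h.weight_pos q)]
      linarith
  obtain ⟨Q, hQ, -⟩ := exists_fermiSpace_multiplier (N := N) (L := L) hbound
    fun σ q => by rw [kineticEnergy_permuteMode]; rfl
  refine ⟨Q, fun u => ?_⟩
  convert! hasSum_conj_amplitude_mul (u : WaveFn N L) (Q u : WaveFn N L) using 2 with q
  rw [hQ, mul_left_comm, Complex.conj_mul', ← Complex.ofReal_pow, ← h.weight_mul_sq_norm u q,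
    ← Complex.ofReal_mul]
  have := (h.weight_pos q).ne'
  field_simp

theorem exists_continuousLinearEquiv_form (h : IsKineticRoot mh mi Λ S) {K : ℝ} (hK : K < 1)
    (hdensity : ∀ u v, HasPairDensities (S u : WaveFn N L) (S v : WaveFn N L))
    (hbound : ∀ u v, ‖potentialForm U (S u : WaveFn N L) (S v : WaveFn N L)‖ ≤
      K / 2 * (‖u‖ ^ 2 + ‖v‖ ^ 2)) :
    ∃ (T : FermiSpace N L ≃L[ℂ] FermiSpace N L) (B : FermiSpace N L →L[ℂ] FermiSpace N L),
      (∀ u v, inner ℂ (T u) (T v) = kineticForm mh mi (S u : WaveFn N L) (S v : WaveFn N L) +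
        potentialForm U (S u : WaveFn N L) (S v : WaveFn N L) + Λ * inner ℂ (S u) (S v)) ∧
      ∀ u v, (inner ℂ u (B v) : ℂ) = potentialForm U (S u : WaveFn N L) (S v : WaveFn N L) := by
  have hadd : ∀ u v v' : FermiSpace N L,
      potentialForm U (S u : WaveFn N L) (S (v + v') : WaveFn N L) =
        potentialForm U (S u : WaveFn N L) (S v : WaveFn N L) +
        potentialForm U (S u : WaveFn N L) (S v' : WaveFn N L) := fun u v v' => by
    rw [map_add, Submodule.coe_add, (hdensity u v).potentialForm_add_right U (hdensity u v')]
  have hsmul : ∀ (c : ℂ) (u v : FermiSpace N L), potentialForm U (S u : WaveFn N L)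
      (S (c • v) : WaveFn N L) = c * potentialForm U (S u : WaveFn N L) (S v : WaveFn N L) :=
    fun c u v => by
      rw [map_smul, Submodule.coe_smul, (hdensity u v).potentialForm_smul_right]
  have hsymm : ∀ u v : FermiSpace N L,
      conj (potentialForm U (S u : WaveFn N L) (S v : WaveFn N L)) =
        potentialForm U (S v : WaveFn N L) (S u : WaveFn N L) := fun u v =>
    (hdensity u v).conj_potentialForm U
  let f : FermiSpace N L →ₗ⋆[ℂ] FermiSpace N L →ₗ[ℂ] ℂ :=
    LinearMap.mk₂'ₛₗ (starRingEnd ℂ) (RingHom.id ℂ)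
      (fun u v => potentialForm U (S u : WaveFn N L) (S v : WaveFn N L))
      (fun u u' v => by rw [← hsymm, hadd, map_add, hsymm, hsymm])
      (fun c u v => by rw [← hsymm, hsmul, map_mul, hsymm, smul_eq_mul])
      hadd hsmul
  obtain ⟨T, hT⟩ := exists_continuousLinearEquiv_inner_add_eq (f := f) hsymm hK hbound
  obtain ⟨B, hB⟩ := exists_continuousLinearMap_inner_eq (f := f) hbound
  refine ⟨T, B, fun u v => ?_, hB⟩
  rw [hT, ← h.kineticForm_eq]
  exact add_right_comm _ _ _

end IsKineticRoot

/-- `J` is a compact map of the Hilbert space onto the states of finite kinetic energy that carries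
the inner product to the form of `H + Λ`, so that `(H + Λ)⁻¹ = J J†`. In the same coordinates the
bounded operators `V` and `Q` give the potential energy and the mean impurity momentum. -/
structure IsFormRealization (mh mi : ℝ) (U : SignedMeasure (AddCircle L)) (Λ : ℝ)
    (J V Q : FermiSpace N L →L[ℂ] FermiSpace N L) : Prop where
  isCompactOperator : IsCompactOperator J
  denseRange : DenseRange J
  finiteKineticEnergy_iff : ∀ ψ : FermiSpace N L,
    FiniteKineticEnergy mh mi (ψ : WaveFn N L) ↔ ∃ x, J x = ψ
  form_eq : ∀ x y, kineticForm mh mi (J x : WaveFn N L) (J y : WaveFn N L) +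
    potentialForm U (J x : WaveFn N L) (J y : WaveFn N L) + Λ * inner ℂ (J x) (J y) = inner ℂ x y
  inner_potential : ∀ x y,
    (inner ℂ x (V y) : ℂ) = potentialForm U (J x : WaveFn N L) (J y : WaveFn N L)
  hasSum_momentum : ∀ x, HasSum (fun q : Mode N =>
    ((ringMomentum L q.2 * ‖amplitude (J x : WaveFn N L) q‖ ^ 2 : ℝ) : ℂ)) (inner ℂ x (Q x))

theorem IsKineticRoot.exists_isFormRealization {S B Q : FermiSpace N L →L[ℂ] FermiSpace N L}
    (h : IsKineticRoot mh mi Λ S) (hS : IsCompactOperator S)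
    (T : FermiSpace N L ≃L[ℂ] FermiSpace N L)
    (hT : ∀ u v, inner ℂ (T u) (T v) = kineticForm mh mi (S u : WaveFn N L) (S v : WaveFn N L) +
      potentialForm U (S u : WaveFn N L) (S v : WaveFn N L) + Λ * inner ℂ (S u) (S v))
    (hB : ∀ u v, (inner ℂ u (B v) : ℂ) = potentialForm U (S u : WaveFn N L) (S v : WaveFn N L))
    (hQ : ∀ u, HasSum (fun q : Mode N =>
      ((ringMomentum L q.2 * ‖amplitude (S u : WaveFn N L) q‖ ^ 2 : ℝ) : ℂ)) (inner ℂ u (Q u))) :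
    ∃ J V Q : FermiSpace N L →L[ℂ] FermiSpace N L, IsFormRealization mh mi U Λ J V Q := by
  let R : FermiSpace N L →L[ℂ] FermiSpace N L := T.symm
  have hadjoint : ∀ (A : FermiSpace N L →L[ℂ] FermiSpace N L) x y,
      (inner ℂ x ((ContinuousLinearMap.adjoint R ∘L A ∘L R) y) : ℂ) = inner ℂ (R x) (A (R y)) :=
    fun A x y => ContinuousLinearMap.adjoint_inner_right R x (A (R y))
  refine ⟨S ∘L R, ContinuousLinearMap.adjoint R ∘L B ∘L R, ContinuousLinearMap.adjoint R ∘L Q ∘L R,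
    ⟨hS.comp_clm R, h.denseRange.comp T.symm.surjective.denseRange S.continuous, fun ψ =>
      ⟨fun hψ => ?_, ?_⟩, fun x y => ?_, fun x y => ?_, fun x => ?_⟩⟩
  · obtain ⟨u, rfl⟩ := h.exists_eq_of_finiteKineticEnergy hψ
    exact ⟨T u, congrArg S (T.symm_apply_apply u)⟩
  · rintro ⟨x, rfl⟩
    exact h.finiteKineticEnergy (R x)
  · rw [← T.apply_symm_apply x, ← T.apply_symm_apply y, hT]
    simp [R]
  · rw [hadjoint, hB]
    rfl
  · rw [hadjoint]
    exact hQ (R x)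

theorem exists_isFormRealization (N : ℕ) (hmh : 0 < mh) (hmi : 0 < mi)
    (U : SignedMeasure (AddCircle L)) :
    ∃ (Λ : ℝ) (J V Q : FermiSpace N L →L[ℂ] FermiSpace N L),
      IsFormRealization mh mi U Λ J V Q := by
  have hL : 0 < L := Fact.out
  set a := (2 * Real.pi / L) ^ 2 / (2 * mi) with ha
  have ha₀ : 0 < a := by positivity
  have hmomentum (q : Mode N) : ringMomentum L q.2 ^ 2 / (2 * mi) = a * (q.2 : ℝ) ^ 2 := by
    rw [ringMomentum, ha]
    ring
  obtain ⟨b, hsmall, hb⟩ := ((((tendsto_tsum_inv_add_mul_sq ha₀).const_mul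
    (N * (L⁻¹ * totalVariationNorm U))).eventually_lt_const
      (by rw [mul_zero]; exact one_pos)).and (eventually_ge_atTop 1)).exists
  have hb₀ : 0 < b := one_pos.trans_le hb
  obtain ⟨S, hS, hcompact⟩ := exists_isKineticRoot (L := L) N hmh hmi hb₀
  have hweight : ∀ q : Mode N, b + ringMomentum L q.2 ^ 2 / (2 * mi) ≤
      b + hostShift N L mh + kineticEnergy L mh mi q := fun q => by
    linarith [impurityEnergy_le (L := L) (mi := mi) hmh.le q]
  have hdensity := hS.exists_isPairDensity ha₀ hb₀ (summable_inv_add_mul_sq ha₀ hb₀.le).hasSum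
    fun q => hmomentum q ▸ hweight q
  obtain ⟨T, B, hT, hB⟩ := hS.exists_continuousLinearEquiv_form (U := U) hsmall
    (fun u v n => (hdensity n u v).imp fun _ => And.left)
    fun u v => (norm_potentialForm_le U fun n => hdensity n u v).trans_eq (by ring)
  obtain ⟨Q, hQ⟩ := hS.exists_momentumOperator hmi fun q => (add_le_add_left hb _).trans (hweight q)
  exact ⟨_, hS.exists_isFormRealization hcompact T hT hB hQ⟩

end FormRealization

section Hamiltonian

open ContinuousLinearMap (adjoint adjoint_inner_right)

variable {N : ℕ} {L : ℝ} [Fact (0 < L)] {mh mi Λ : ℝ} {U : SignedMeasure (AddCircle L)}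
  {J V Q : FermiSpace N L →L[ℂ] FermiSpace N L}

theorem isEvolution_iff {W : ℝ → (FermiSpace N L ≃ₗᵢ[ℂ] FermiSpace N L)} :
    IsEvolution mh mi U W ↔ IsUnitaryGroup (HamiltonianMaps mh mi U) W :=
  ⟨fun h => ⟨h.add, h.continuous, h.generator⟩, fun h => ⟨h.add, h.continuous, h.generator⟩⟩

namespace IsFormRealization

theorem hamiltonianMaps_map_iff (h : IsFormRealization mh mi U Λ J V Q) {x χ : FermiSpace N L} :
    HamiltonianMaps mh mi U (J x) χ ↔ x = adjoint J (χ + (Λ : ℂ) • J x) := by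
  have hform : ∀ y, kineticForm mh mi (J y : WaveFn N L) (J x : WaveFn N L) +
      potentialForm U (J y : WaveFn N L) (J x : WaveFn N L) = inner ℂ (J y) χ ↔
      inner ℂ y x = inner ℂ y (adjoint J (χ + (Λ : ℂ) • J x)) := fun y => by
    have hadj : inner ℂ y (adjoint J (χ + (Λ : ℂ) • J x)) =
        inner ℂ (J y) χ + Λ * inner ℂ (J y) (J x) := by
      rw [adjoint_inner_right, inner_add_right]
      exact congrArg _ (inner_smul_right (𝕜 := ℂ) (J y) (J x) (Λ : ℂ))
    rw [← h.form_eq y x, hadj, add_left_inj]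
  refine ⟨fun hx => ext_inner_left ℂ fun y => (hform y).1
    (hx.2 _ ((h.finiteKineticEnergy_iff _).2 ⟨y, rfl⟩)), fun hx =>
    ⟨(h.finiteKineticEnergy_iff _).2 ⟨x, rfl⟩, fun φ hφ => ?_⟩⟩
  obtain ⟨y, rfl⟩ := (h.finiteKineticEnergy_iff φ).1 hφ
  exact (hform y).2 (congrArg _ hx)

theorem hamiltonianMaps_iff (h : IsFormRealization mh mi U Λ J V Q) (ψ χ : FermiSpace N L) :
    HamiltonianMaps mh mi U ψ χ ↔ FormOperatorMaps J Λ ψ χ := by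
  constructor
  · intro hψ
    obtain ⟨x, rfl⟩ := (h.finiteKineticEnergy_iff ψ).1 hψ.1
    exact congrArg J (h.hamiltonianMaps_map_iff.1 hψ)
  · intro hψ
    obtain ⟨x, hx⟩ : ∃ x, adjoint J (χ + (Λ : ℂ) • ψ) = x := ⟨_, rfl⟩
    rw [FormOperatorMaps, hx] at hψ
    rw [hψ, h.hamiltonianMaps_map_iff, ← hψ, hx]

theorem hamiltonianMaps_smul_iff (h : IsFormRealization mh mi U Λ J V Q) {x : FermiSpace N L}
    {E : ℝ} : HamiltonianMaps mh mi U (J x) ((E : ℂ) • J x) ↔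
      x = ((E + Λ : ℝ) : ℂ) • adjoint J (J x) := by
  rw [h.hamiltonianMaps_map_iff, ← add_smul, map_smul, Complex.ofReal_add]

theorem existsUnique_isEvolution (h : IsFormRealization mh mi U Λ J V Q) :
    ∃! W, IsEvolution (N := N) mh mi U W := by
  obtain ⟨ι, b, E, hb⟩ := exists_diagonalization h.isCompactOperator h.denseRange Λ
  have hdiag : HamiltonianMaps mh mi U = DiagonalMaps b E :=
    funext₂ fun ψ χ => propext ((h.hamiltonianMaps_iff ψ χ).trans (hb ψ χ))
  simp only [isEvolution_iff, hdiag]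
  exact existsUnique_isUnitaryGroup_diagonalMaps b E

theorem injective (h : IsFormRealization mh mi U Λ J V Q) : Function.Injective J :=
  (injective_iff_map_eq_zero J).2 fun x hx => by
    have hform := h.form_eq x x
    rw [hx, ← map_zero J, h.form_eq, inner_zero_left] at hform
    exact inner_self_eq_zero.1 hform.symm

theorem exists_isEigenfamily (h : IsFormRealization mh mi U Λ J V Q) {ι : Type*} {E : ι → ℝ}
    (hE : Function.Injective E) {Ψ : ι → FermiSpace N L} (hnorm : ∀ i, ‖Ψ i‖ = 1)
    (hΨ : ∀ i, HamiltonianMaps mh mi U (Ψ i) ((E i : ℂ) • Ψ i)) :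
    ∃ v, IsEigenfamily J Λ E v ∧ ∀ i, J (v i) = Ψ i := by
  choose v hv using fun i => (h.finiteKineticEnergy_iff (Ψ i)).1 (hΨ i).1
  exact ⟨v, ⟨hE, fun i => h.hamiltonianMaps_smul_iff.1 (by rw [hv]; exact hΨ i),
    fun i => by rw [hv, hnorm]⟩, hv⟩

end IsFormRealization

end Hamiltonian

section MomentumSector

open ContinuousLinearMap (adjoint)

variable {N : ℕ} {L : ℝ} [Fact (0 < L)] {mh mi Λ : ℝ} {U : SignedMeasure (AddCircle L)}
  {j : ℤ} {J V Q P : FermiSpace N L →L[ℂ] FermiSpace N L}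

/-- `P` is the orthogonal projection of the fermionic space onto total momentum `2πj/L`. -/
def IsSectorProjection (j : ℤ) (P : FermiSpace N L →L[ℂ] FermiSpace N L) : Prop :=
  ∀ (ψ : FermiSpace N L) (q : Mode N), amplitude (P ψ : WaveFn N L) q =
    ((if ∑ n, q.1 n + q.2 = j then 1 else 0 : ℝ) : ℂ) * amplitude (ψ : WaveFn N L) q

theorem exists_isSectorProjection (N : ℕ) (L : ℝ) [Fact (0 < L)] (j : ℤ) :
    ∃ P : FermiSpace N L →L[ℂ] FermiSpace N L, IsSectorProjection j P := by
  obtain ⟨P, hP, -⟩ := exists_fermiSpace_multiplier (N := N) (L := L)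
    (g := fun q => if ∑ n, q.1 n + q.2 = j then 1 else 0) (C := 1)
    (fun q => by split_ifs <;> simp)
    fun σ q => by simp only [permuteMode, Equiv.sum_comp σ q.1]
  exact ⟨P, hP⟩

namespace IsSectorProjection

theorem apply_eq_self_iff (hP : IsSectorProjection j P) {ψ : FermiSpace N L} :
    P ψ = ψ ↔ HasTotalMomentum j (ψ : WaveFn N L) := by
  refine ⟨fun h q => ?_, fun h => fermiSpace_ext fun q => ?_⟩
  · contrapose!
    intro hq
    rw [← h, hP, if_neg hq, Complex.ofReal_zero, zero_mul]
  · by_cases hq : ∑ n, q.1 n + q.2 = j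
    · rw [hP, if_pos hq, Complex.ofReal_one, one_mul]
    · rw [hP, not_not.1 (mt (h q) hq), mul_zero]

theorem finiteKineticEnergy (hP : IsSectorProjection j P) {ψ : FermiSpace N L}
    (hψ : FiniteKineticEnergy mh mi (ψ : WaveFn N L)) :
    FiniteKineticEnergy mh mi (P ψ : WaveFn N L) := by
  refine (hψ.indicator {q | ∑ n, q.1 n + q.2 = j}).congr fun q => ?_
  simp only [hP ψ q, Set.indicator_apply, Set.mem_ofPred_eq]
  split_ifs <;> simp

theorem kineticForm_left (hP : IsSectorProjection j P) (φ ψ : FermiSpace N L) :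
    kineticForm mh mi (P φ : WaveFn N L) (ψ : WaveFn N L) =
      kineticForm mh mi (φ : WaveFn N L) (P ψ : WaveFn N L) :=
  tsum_congr fun q => by
    rw [hP, hP, map_mul, Complex.conj_ofReal]
    ring

theorem potentialForm_left (hP : IsSectorProjection j P) (φ ψ : FermiSpace N L) :
    potentialForm U (P φ : WaveFn N L) (ψ : WaveFn N L) =
      potentialForm U (φ : WaveFn N L) (P ψ : WaveFn N L) := by
  have hterm : ∀ n m q, conj (amplitude (P φ : WaveFn N L) (shiftMode n m q)) *
      amplitude (ψ : WaveFn N L) q =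
      conj (amplitude (φ : WaveFn N L) (shiftMode n m q)) * amplitude (P ψ : WaveFn N L) q :=
    fun n m q => by
      rw [hP, hP, totalMomentum_shiftMode, map_mul, Complex.conj_ofReal]
      ring
  have hdensity : ∀ n, IsPairDensity n (P φ : WaveFn N L) (ψ : WaveFn N L) =
      IsPairDensity n (φ : WaveFn N L) (P ψ : WaveFn N L) := fun n => funext fun ρ =>
    propext (by simp only [isPairDensity_iff_hasSum, hterm])
  exact Finset.sum_congr rfl fun n _ => by rw [pairDensity, pairDensity, hdensity n]

theorem hamiltonianMaps (hP : IsSectorProjection j P) {ψ χ : FermiSpace N L}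
    (h : HamiltonianMaps mh mi U ψ χ) : HamiltonianMaps mh mi U (P ψ) (P χ) :=
  ⟨hP.finiteKineticEnergy h.1, fun φ hφ => by
    rw [← hP.kineticForm_left, ← hP.potentialForm_left, h.2 _ (hP.finiteKineticEnergy hφ),
      inner_multiplier_left hP]⟩

theorem map_adjoint_map (hP : IsSectorProjection j P) (h : IsFormRealization mh mi U Λ J V Q)
    (ψ : FermiSpace N L) : P (J (adjoint J ψ)) = J (adjoint J (P ψ)) := by
  have hmaps := hP.hamiltonianMaps ((h.hamiltonianMaps_iff (J (adjoint J ψ))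
    (ψ - (Λ : ℂ) • J (adjoint J ψ))).2 (by rw [FormOperatorMaps, sub_add_cancel]))
  rw [h.hamiltonianMaps_iff, FormOperatorMaps, map_sub, map_smul, sub_add_cancel] at hmaps
  exact hmaps

end IsSectorProjection

theorem IsFormRealization.hasSum_inner_smul (h : IsFormRealization mh mi U Λ J V Q)
    (hnd : NondegenerateSector N mh mi U j) {v : sectorEigenvalues N mh mi U j → FermiSpace N L}
    (hv : IsEigenfamily J Λ Subtype.val v)
    (hvj : ∀ E, HasTotalMomentum j (J (v E) : WaveFn N L)) {x : FermiSpace N L}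
    (hx : HasTotalMomentum j (J x : WaveFn N L)) :
    HasSum (fun E => inner ℂ (J (v E)) (J x) • v E) x := by
  obtain ⟨P, hP⟩ := exists_isSectorProjection N L j
  let M := LinearMap.eqLocus (P ∘L J).toLinearMap J.toLinearMap
  have hmem : ∀ y, y ∈ M ↔ HasTotalMomentum j (J y : WaveFn N L) := fun _ => hP.apply_eq_self_iff
  refine hv.hasSum_inner_smul (M := M) h.isCompactOperator
    (isClosed_eq (P ∘L J).continuous J.continuous)
    (fun E => (hmem _).2 (hvj E)) (fun y hy => ?_) (fun μ y hy hy₀ hμ => ?_) ((hmem x).2 hx)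
  · exact (hP.map_adjoint_map h (J y)).trans (congrArg (J ∘ adjoint J) hy)
  · have hμ₀ : (μ : ℂ) ≠ 0 := fun h₀ => hy₀ (h.injective ?_)
    · have hsector : IsSectorEigenvector mh mi U j (μ⁻¹ - Λ) (J y) := ⟨(hmem y).1 hy,
        h.hamiltonianMaps_smul_iff.2 (by
          rw [hμ, sub_add_cancel, smul_smul, Complex.ofReal_inv, inv_mul_cancel₀ hμ₀, one_smul])⟩
      let E : sectorEigenvalues N mh mi U j :=
        ⟨μ⁻¹ - Λ, J y, (map_ne_zero_iff J h.injective).2 hy₀, hsector⟩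
      obtain ⟨c, hc⟩ := hnd _ (J (v E)) (J y) ((map_ne_zero_iff J h.injective).2 (hv.ne_zero E))
        ⟨hvj E, h.hamiltonianMaps_smul_iff.2 (hv.eigen E)⟩ hsector
      exact ⟨E, c, h.injective (by rw [hc, map_smul])⟩
    · rw [h₀, zero_smul] at hμ
      rw [map_zero, ← inner_self_eq_zero (𝕜 := ℂ), ← ContinuousLinearMap.adjoint_inner_right, hμ,
        inner_zero_right]

end MomentumSector

section HostEnergy

/-- The function `x ↦ r (N - r)`, where `r` is the residue of `x` modulo `N`. Moving a filled sea of
`N` levels to total momentum `x` raises `∑ kₙ²` by at least this amount plus `|x|`. -/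
def residueEnergy (N x : ℤ) : ℤ := x % N * (N - x % N)

variable {N : ℤ}

theorem residueEnergy_nonneg (hN : 0 < N) (x : ℤ) : 0 ≤ residueEnergy N x :=
  mul_nonneg (Int.emod_nonneg _ hN.ne') (sub_nonneg.2 (Int.emod_lt_of_pos x hN).le)

theorem residueEnergy_of_mem_Ico {x : ℤ} (hx : x ∈ Set.Ico 0 N) :
    residueEnergy N x = x * (N - x) := by
  rw [residueEnergy, Int.emod_eq_of_lt hx.1 hx.2]

theorem residueEnergy_add_mul (x k : ℤ) : residueEnergy N (x + N * k) = residueEnergy N x := by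
  simp only [residueEnergy, Int.add_mul_emod_self_left]

theorem exists_mem_Ico_eq_add_mul (hN : 0 < N) (x : ℤ) : ∃ r ∈ Set.Ico 0 N, ∃ k, x = r + N * k :=
  ⟨x % N, ⟨Int.emod_nonneg x hN.ne', Int.emod_lt_of_pos x hN⟩, x / N,
    (Int.emod_add_mul_ediv x N).symm⟩

theorem residueEnergy_neg (hN : 0 < N) (x : ℤ) : residueEnergy N (-x) = residueEnergy N x := by
  obtain ⟨r, hr, k, rfl⟩ := exists_mem_Ico_eq_add_mul hN x
  rw [residueEnergy_add_mul]
  rcases hr.1.eq_or_lt with rfl | hr₀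
  · rw [show -(0 + N * k) = 0 + N * -k by ring, residueEnergy_add_mul]
  · rw [show -(r + N * k) = N - r + N * (-1 - k) by ring, residueEnergy_add_mul,
      residueEnergy_of_mem_Ico hr, residueEnergy_of_mem_Ico ⟨by linarith [hr.2], by linarith⟩]
    ring

theorem residueEnergy_add_le (hN : 0 < N) (x y : ℤ) :
    residueEnergy N (x + y) ≤ residueEnergy N x + residueEnergy N y := by
  obtain ⟨r, hr, k, rfl⟩ := exists_mem_Ico_eq_add_mul hN x
  obtain ⟨s, hs, l, rfl⟩ := exists_mem_Ico_eq_add_mul hN y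
  rw [show r + N * k + (s + N * l) = r + s + N * (k + l) by ring]
  simp only [residueEnergy_add_mul, residueEnergy_of_mem_Ico hr, residueEnergy_of_mem_Ico hs]
  rcases lt_or_ge (r + s) N with hlt | hge
  · rw [residueEnergy_of_mem_Ico ⟨add_nonneg hr.1 hs.1, hlt⟩]
    nlinarith [mul_nonneg hr.1 hs.1]
  · rw [show r + s = r + s - N + N * 1 by ring, residueEnergy_add_mul,
      residueEnergy_of_mem_Ico ⟨by linarith, by linarith [hr.2, hs.2]⟩]
    nlinarith [mul_nonneg (sub_nonneg.2 hr.2.le) (sub_nonneg.2 hs.2.le)]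

theorem residueEnergy_sum_le (hN : 0 < N) {ι : Type*} (s : Finset ι) (f : ι → ℤ) :
    residueEnergy N (∑ i ∈ s, f i) ≤ ∑ i ∈ s, residueEnergy N (f i) :=
  Finset.le_sum_of_subadditive _ (by simp [residueEnergy]) (residueEnergy_add_le hN) s _

theorem residueEnergy_le_abs_mul_add_self (hN : 0 < N) (y : ℤ) :
    residueEnergy N y ≤ |y * (N + y)| := by
  obtain ⟨r, hr, k, rfl⟩ := exists_mem_Ico_eq_add_mul hN y
  rw [residueEnergy_add_mul, residueEnergy_of_mem_Ico hr]
  have hr₀ := hr.1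
  have hrN := hr.2
  obtain hk | rfl | hk : 0 ≤ k ∨ k = -1 ∨ k ≤ -2 := by omega
  · refine le_trans ?_ (le_abs_self _)
    have : 0 ≤ N * k := by positivity
    nlinarith
  · refine le_trans (le_of_eq ?_) (neg_le_abs _)
    ring
  · refine le_trans ?_ (le_abs_self _)
    have : N * (k + 2) ≤ 0 := mul_nonpos_of_nonneg_of_nonpos hN.le (by linarith)
    nlinarith

theorem sum_Icc_neg_self (M : ℤ) : ∑ x ∈ Finset.Icc (-M) M, x = 0 := by
  have hneg : ∑ x ∈ Finset.Icc (-M) M, x = ∑ x ∈ Finset.Icc (-M) M, -x :=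
    Finset.sum_equiv (Equiv.neg ℤ) (fun x => by simp only [Finset.mem_Icc, Equiv.neg_apply]; omega)
      fun x _ => (neg_neg x).symm
  rw [Finset.sum_neg_distrib] at hneg
  linarith

/- With `y = x - M`, a level `x` costs `y (y + 2M + 1) = x² + x - M (M + 1)`, which is `≤ 0` in the
Fermi sea and `≥ 0` outside. Its absolute value dominates the residue energy of `y`, so
subadditivity adds up the contributions of the particles and the holes. -/
theorem residueEnergy_sum_sub_sum_le {M : ℕ} {s : Finset ℤ} (hs : s.card = 2 * M + 1) :
    residueEnergy (2 * M + 1) (∑ x ∈ s, x - ∑ x ∈ Finset.Icc (-M : ℤ) M, x) ≤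
      ∑ x ∈ s, (x ^ 2 + x) - ∑ x ∈ Finset.Icc (-M : ℤ) M, (x ^ 2 + x) := by
  have hN : (0 : ℤ) < 2 * M + 1 := by positivity
  set F := Finset.Icc (-M : ℤ) M with hF
  have hcard : (s \ F).card = (F \ s).card :=
    Finset.card_sdiff_comm (by rw [hs, hF, Int.card_Icc]; omega)
  have hparticle : ∀ x ∈ s \ F, residueEnergy (2 * M + 1) (x - M) ≤ x ^ 2 + x - M * (M + 1) :=
    fun x hx => by
      have hx' := (Finset.mem_sdiff.1 hx).2
      rw [hF, Finset.mem_Icc, not_and_or, not_le, not_le] at hx'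
      refine (residueEnergy_le_abs_mul_add_self hN _).trans_eq ?_
      rw [abs_of_nonneg (by rcases hx' with h | h <;> nlinarith)]
      ring
  have hhole : ∀ x ∈ F \ s, residueEnergy (2 * M + 1) (x - M) ≤ M * (M + 1) - (x ^ 2 + x) :=
    fun x hx => by
      have hx' := Finset.mem_Icc.1 (Finset.mem_sdiff.1 hx).1
      refine (residueEnergy_le_abs_mul_add_self hN _).trans_eq ?_
      rw [abs_of_nonpos (mul_nonpos_of_nonpos_of_nonneg (by linarith) (by linarith))]
      ring
  calc residueEnergy (2 * M + 1) (∑ x ∈ s, x - ∑ x ∈ F, x)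
      = residueEnergy (2 * M + 1) (∑ x ∈ s \ F, (x - M) + -∑ x ∈ F \ s, (x - M)) := by
        rw [← Finset.sum_sdiff_sub_sum_sdiff]
        simp only [Finset.sum_sub_distrib, Finset.sum_const, hcard]
        congr 1
        ring
    _ ≤ ∑ x ∈ s \ F, residueEnergy (2 * M + 1) (x - M) +
        ∑ x ∈ F \ s, residueEnergy (2 * M + 1) (x - M) := by
        refine (residueEnergy_add_le hN _ _).trans (add_le_add (residueEnergy_sum_le hN _ _) ?_)
        rw [residueEnergy_neg hN]
        exact residueEnergy_sum_le hN _ _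
    _ ≤ ∑ x ∈ s \ F, (x ^ 2 + x - M * (M + 1)) + ∑ x ∈ F \ s, (M * (M + 1) - (x ^ 2 + x)) :=
        add_le_add (Finset.sum_le_sum hparticle) (Finset.sum_le_sum hhole)
    _ = ∑ x ∈ s, (x ^ 2 + x) - ∑ x ∈ F, (x ^ 2 + x) := by
        rw [← Finset.sum_sdiff_sub_sum_sdiff]
        simp only [Finset.sum_sub_distrib, Finset.sum_const, hcard]
        ring

theorem residueEnergy_sum_add_sum_le {M : ℕ} {ι : Type*} [Fintype ι]
    (hι : Fintype.card ι = 2 * M + 1) {k : ι → ℤ} (hk : Function.Injective k) :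
    residueEnergy (2 * M + 1) (∑ i, k i) ≤
      ∑ i, k i ^ 2 + ∑ i, k i - ∑ x ∈ Finset.Icc (-M : ℤ) M, x ^ 2 := by
  have hmap := residueEnergy_sum_sub_sum_le (M := M) (s := Finset.univ.map ⟨k, hk⟩)
    (by rw [Finset.card_map, Finset.card_univ, hι])
  simpa only [Finset.sum_map, Function.Embedding.coeFn_mk, Finset.sum_add_distrib,
    sum_Icc_neg_self, sub_zero, add_zero] using hmap

theorem residueEnergy_add_abs_le {M : ℕ} {ι : Type*} [Fintype ι]
    (hι : Fintype.card ι = 2 * M + 1) {k : ι → ℤ} (hk : Function.Injective k) :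
    residueEnergy (2 * M + 1) (∑ i, k i) + |∑ i, k i| ≤
      ∑ i, k i ^ 2 - ∑ x ∈ Finset.Icc (-M : ℤ) M, x ^ 2 := by
  have hpos := residueEnergy_sum_add_sum_le hι hk
  have hneg := residueEnergy_sum_add_sum_le hι (neg_injective.comp hk)
  simp only [Function.comp_apply, Finset.sum_neg_distrib, neg_sq] at hneg
  rw [residueEnergy_neg (by positivity)] at hneg
  rcases abs_cases (∑ i, k i) with h | h <;> linarith

theorem mul_two_mul_sub_le {M : ℕ} (K : ℤ) :
    K * (2 * M - K) ≤ residueEnergy (2 * M + 1) K + |K| := by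
  have hN : (0 : ℤ) < 2 * M + 1 := by positivity
  have hres := residueEnergy_nonneg hN K
  by_cases hK : K ∈ Set.Ico 0 (2 * M + 1 : ℤ)
  · rw [residueEnergy_of_mem_Ico hK]
    linarith [abs_nonneg K, hK.1]
  · rw [Set.mem_Ico, not_and_or, not_le, not_lt] at hK
    have hle : K * (2 * M - K) ≤ 0 := by
      rcases hK with h | h <;> nlinarith
    linarith [abs_nonneg K]

end HostEnergy

section KineticBound

theorem sum_range_sub_sq (c : ℝ) (n : ℕ) : ∑ i ∈ Finset.range n, ((i : ℝ) - c) ^ 2 =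
    n * (n - 1) * (2 * n - 1) / 6 - c * n * (n - 1) + c ^ 2 * n := by
  induction n with
  | zero => simp
  | succ n ih =>
    rw [Finset.sum_range_succ, ih]
    push_cast
    ring

theorem fermiSeaModes_eq_sub (M : ℕ) (n : Fin (2 * M + 1)) :
    fermiSeaModes (2 * M + 1) n = n - M := by
  rw [fermiSeaModes]
  omega

theorem sum_fermiSeaModes_sq (M : ℕ) :
    ∑ n, (fermiSeaModes (2 * M + 1) n : ℝ) ^ 2 = M * (M + 1) * (2 * M + 1) / 3 := by
  simp only [fermiSeaModes_eq_sub, Int.cast_sub, Int.cast_natCast]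
  rw [Fin.sum_univ_eq_sum_range (fun i => ((i : ℝ) - M) ^ 2), sum_range_sub_sq]
  push_cast
  ring

theorem sum_comp_fermiSeaModes {R : Type*} [AddCommMonoid R] (M : ℕ) (f : ℤ → R) :
    ∑ n, f (fermiSeaModes (2 * M + 1) n) = ∑ x ∈ Finset.Icc (-M : ℤ) M, f x := by
  refine Finset.sum_bij (fun n _ => fermiSeaModes (2 * M + 1) n) (fun n _ => ?_)
    (fun n _ n' _ h => ?_) (fun x hx => ?_) fun n _ => rfl
  · rw [fermiSeaModes_eq_sub, Finset.mem_Icc]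
    omega
  · rw [fermiSeaModes_eq_sub, fermiSeaModes_eq_sub] at h
    omega
  · rw [Finset.mem_Icc] at hx
    refine ⟨⟨(x + M).toNat, by omega⟩, Finset.mem_univ _, ?_⟩
    rw [fermiSeaModes_eq_sub]
    simp only
    omega

variable {N : ℕ} {L mh mi : ℝ}

theorem hostShift_eq_sum_fermiSeaModes (hN : Odd N) (L mh : ℝ) :
    hostShift N L mh = ∑ n, ringMomentum L (fermiSeaModes N n) ^ 2 / (2 * mh) := by
  obtain ⟨M, rfl⟩ := hN
  simp only [ringMomentum, mul_pow, ← Finset.sum_div, ← Finset.mul_sum, sum_fermiSeaModes_sq]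
  rcases eq_or_ne M 0 with rfl | hM
  · simp [hostShift, fermiMomentum]
  · have hM' : (M : ℝ) ≠ 0 := Nat.cast_ne_zero.2 hM
    rw [hostShift, fermiMomentum]
    push_cast
    rw [add_sub_cancel_right]
    field_simp
    ring

theorem fermiMomentum_nonneg (hN : 1 ≤ N) (hL : 0 ≤ L) : 0 ≤ fermiMomentum N L := by
  have : (0 : ℝ) ≤ N - 1 := sub_nonneg.2 (Nat.one_le_cast.2 hN)
  rw [fermiMomentum]
  positivity

theorem criticalMomentum_nonneg (hN : 1 ≤ N) (hL : 0 ≤ L) (hmh : 0 ≤ mh) (hmi : 0 ≤ mi) :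
    0 ≤ criticalMomentum N L mh mi := by
  have := fermiMomentum_nonneg hN hL
  exact le_min this (by positivity)

theorem fermiMomentum_two_mul_add_one (M : ℕ) (L : ℝ) :
    fermiMomentum (2 * M + 1) L = ringMomentum L M := by
  rw [fermiMomentum, ringMomentum]
  push_cast
  ring

theorem sum_ringMomentum_sq_sub_hostShift (M : ℕ) (k : Fin (2 * M + 1) → ℤ) :
    ∑ n, ringMomentum L (k n) ^ 2 / (2 * mh) - hostShift (2 * M + 1) L mh =
      (2 * Real.pi / L) ^ 2 * ((∑ n, k n ^ 2 - ∑ x ∈ Finset.Icc (-M : ℤ) M, x ^ 2 : ℤ) : ℝ) /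
        (2 * mh) := by
  rw [hostShift_eq_sum_fermiSeaModes ⟨M, rfl⟩, sum_comp_fermiSeaModes M fun x =>
    ringMomentum L x ^ 2 / (2 * mh)]
  push_cast
  simp only [ringMomentum, mul_pow, ← Finset.sum_div, ← Finset.mul_sum]
  ring

theorem mul_two_mul_fermiMomentum_sub_le (hN : Odd N) (hmh : 0 ≤ mh) {k : Fin N → ℤ}
    (hk : Function.Injective k) :
    max 0 (ringMomentum L (∑ n, k n) * (2 * fermiMomentum N L - ringMomentum L (∑ n, k n))) /
      (2 * mh) ≤ ∑ n, ringMomentum L (k n) ^ 2 / (2 * mh) - hostShift N L mh := by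
  obtain ⟨M, rfl⟩ := hN
  have hres := residueEnergy_add_abs_le (Fintype.card_fin _) hk
  set K := ∑ n, k n
  have hnonneg : (0 : ℝ) ≤ ((∑ n, k n ^ 2 - ∑ x ∈ Finset.Icc (-M : ℤ) M, x ^ 2 : ℤ) : ℝ) :=
    Int.cast_nonneg
      ((add_nonneg (residueEnergy_nonneg (by positivity) K) (abs_nonneg K)).trans hres)
  have hle : ((K * (2 * M - K) : ℤ) : ℝ) ≤
      ((∑ n, k n ^ 2 - ∑ x ∈ Finset.Icc (-M : ℤ) M, x ^ 2 : ℤ) : ℝ) :=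
    Int.cast_le.2 ((mul_two_mul_sub_le K).trans hres)
  rw [sum_ringMomentum_sq_sub_hostShift, fermiMomentum_two_mul_add_one]
  refine div_le_div_of_nonneg_right (max_le (by positivity) ?_) (by positivity)
  refine le_trans (le_of_eq ?_) (mul_le_mul_of_nonneg_left hle (sq_nonneg (2 * Real.pi / L)))
  simp only [ringMomentum]
  push_cast
  ring

theorem mul_two_mul_sub_le_mul_max {P Q kF c : ℝ} (hc : 0 ≤ c) (hQ : 0 ≤ Q) (hQk : Q ≤ kF)
    (hQc : Q ≤ c * kF) : P * (2 * Q - P) ≤ c * max 0 (P * (2 * kF - P)) := by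
  rcases le_or_gt P 0 with hP | hP
  · exact (mul_nonpos_of_nonpos_of_nonneg hP (by linarith)).trans
      (mul_nonneg hc (le_max_left _ _))
  rcases le_total 1 c with h1 | h1
  · calc P * (2 * Q - P) ≤ P * (2 * kF - P) := by gcongr
      _ ≤ 1 * max 0 (P * (2 * kF - P)) := by rw [one_mul]; exact le_max_right _ _
      _ ≤ c * max 0 (P * (2 * kF - P)) := mul_le_mul_of_nonneg_right h1 (le_max_left _ _)
  · refine le_trans ?_ (mul_le_mul_of_nonneg_left (le_max_right _ _) hc)
    nlinarith [mul_nonneg (sub_nonneg.2 h1) (sq_nonneg P), mul_le_mul_of_nonneg_left hQc hP.le]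

theorem linear_le_kineticEnergy (hN : Odd N) (hL : 0 ≤ L) (hmh : 0 < mh) (hmi : 0 < mi) {j : ℤ}
    {q : Mode N} (hq : Function.Injective q.1) (hj : ∑ n, q.1 n + q.2 = j) :
    ringMomentum L j ^ 2 / (2 * mi) + (criticalMomentum N L mh mi - ringMomentum L j) / mi *
      (ringMomentum L j - ringMomentum L q.2) ≤ kineticEnergy L mh mi q := by
  have hhost := mul_two_mul_fermiMomentum_sub_le (L := L) hN hmh.le hq
  have hcritical := mul_two_mul_sub_le_mul_max (P := ringMomentum L (∑ n, q.1 n))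
    (div_nonneg hmi.le hmh.le) (criticalMomentum_nonneg hN.pos hL hmh.le hmi.le)
    (min_le_left _ _) (min_le_right _ _)
  have himpurity : ringMomentum L q.2 = ringMomentum L j - ringMomentum L (∑ n, q.1 n) := by
    rw [← hj]
    simp only [ringMomentum]
    push_cast
    ring
  set P := ringMomentum L (∑ n, q.1 n)
  set p := ringMomentum L j
  calc p ^ 2 / (2 * mi) + (criticalMomentum N L mh mi - p) / mi * (p - ringMomentum L q.2)
      = P * (2 * criticalMomentum N L mh mi - P) / (2 * mi) +
          ringMomentum L q.2 ^ 2 / (2 * mi) := by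
        rw [himpurity]
        field_simp
        ring
    _ ≤ mi / mh * max 0 (P * (2 * fermiMomentum N L - P)) / (2 * mi) +
        ringMomentum L q.2 ^ 2 / (2 * mi) := by gcongr
    _ = max 0 (P * (2 * fermiMomentum N L - P)) / (2 * mh) +
        ringMomentum L q.2 ^ 2 / (2 * mi) := by field_simp
    _ ≤ kineticEnergy L mh mi q := add_le_add hhost le_rfl

end KineticBound

section MeanMomentum

variable {N : ℕ} {L : ℝ} [Fact (0 < L)] {mh mi : ℝ} {ψ : WaveFn N L}

theorem FiniteKineticEnergy.hasSum (hψ : FiniteKineticEnergy mh mi ψ) :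
    HasSum (fun q => kineticEnergy L mh mi q * ‖amplitude ψ q‖ ^ 2) (kineticForm mh mi ψ ψ).re := by
  have hform : kineticForm mh mi ψ ψ =
      ((∑' q, kineticEnergy L mh mi q * ‖amplitude ψ q‖ ^ 2 : ℝ) : ℂ) := by
    rw [kineticForm, Complex.ofReal_tsum]
    refine tsum_congr fun q => ?_
    rw [Complex.conj_mul']
    push_cast
    rfl
  rw [hform, Complex.ofReal_re]
  exact Summable.hasSum hψ

theorem FiniteKineticEnergy.inMomentumDomain (hmh : 0 ≤ mh) (hmi : 0 < mi)
    (hψ : FiniteKineticEnergy mh mi ψ) : InMomentumDomain ψ := by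
  refine Summable.of_nonneg_of_le (fun q => by positivity) (fun q => ?_)
    ((hψ.add ((hasSum_sq_norm_amplitude ψ).summable.mul_left (hostShift N L mh))).mul_left (2 * mi))
  rw [← add_mul, ← mul_assoc]
  have himpurity := impurityEnergy_le (L := L) (mi := mi) hmh q
  rw [div_le_iff₀ (by positivity), mul_comm] at himpurity
  exact mul_le_mul_of_nonneg_right himpurity (sq_nonneg _)

theorem InMomentumDomain.hasSum_meanMomentum (hψ : InMomentumDomain ψ) :
    HasSum (fun q => ringMomentum L q.2 * ‖amplitude ψ q‖ ^ 2) (meanMomentum ψ) := by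
  refine Summable.hasSum (Summable.of_norm_bounded (hψ.add (hasSum_sq_norm_amplitude ψ).summable)
    fun q => ?_)
  rw [norm_mul, Real.norm_eq_abs, Real.norm_eq_abs, abs_of_nonneg (sq_nonneg ‖amplitude ψ q‖),
    ← add_one_mul]
  refine mul_le_mul_of_nonneg_right ?_ (sq_nonneg _)
  nlinarith [sq_nonneg (|ringMomentum L q.2| - 1), sq_abs (ringMomentum L q.2)]

theorem linear_meanMomentum_le_kineticForm (hN : Odd N) (hmh : 0 < mh) (hmi : 0 < mi) {j : ℤ}
    {ψ : FermiSpace N L} (hψ : FiniteKineticEnergy mh mi (ψ : WaveFn N L))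
    (hj : HasTotalMomentum j (ψ : WaveFn N L)) (hnorm : ‖ψ‖ = 1) :
    ringMomentum L j ^ 2 / (2 * mi) + (criticalMomentum N L mh mi - ringMomentum L j) / mi *
      (ringMomentum L j - meanMomentum (ψ : WaveFn N L)) ≤
      (kineticForm mh mi (ψ : WaveFn N L) (ψ : WaveFn N L)).re := by
  have hone := hasSum_sq_norm_amplitude (ψ : WaveFn N L)
  rw [← Submodule.coe_norm, hnorm, one_pow] at hone
  have hmean := (hψ.inMomentumDomain hmh.le hmi).hasSum_meanMomentum
  have hlinear := (hone.mul_left (ringMomentum L j ^ 2 / (2 * mi))).add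
    (((hone.mul_left (ringMomentum L j)).sub hmean).mul_left
      ((criticalMomentum N L mh mi - ringMomentum L j) / mi))
  rw [mul_one, mul_one] at hlinear
  refine hasSum_le (fun q => ?_) hlinear hψ.hasSum
  by_cases hq : amplitude (ψ : WaveFn N L) q = 0
  · simp [hq]
  have hinj : Function.Injective q.1 :=
    not_not.1 (mt (amplitude_eq_zero_of_not_injective ψ.2) hq)
  rw [← sub_mul, ← mul_assoc, ← add_mul]
  exact mul_le_mul_of_nonneg_right
    (linear_le_kineticEnergy hN (Fact.out : 0 < L).le hmh hmi hinj (hj q hq)) (sq_nonneg _)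

end MeanMomentum

section FermiSea

variable {N : ℕ} {L : ℝ} [Fact (0 < L)]

theorem fermiSeaModes_injective : Function.Injective (fermiSeaModes N) := fun m n h =>
  Fin.ext (by simp only [fermiSeaModes] at h; omega)

theorem exists_perm_of_amplitude_fermiSeaWave_ne_zero {j : ℤ} {q : Mode N}
    (hq : amplitude (fermiSeaWave N L j) q ≠ 0) :
    ∃ σ : Equiv.Perm (Fin N), q = (fun n => fermiSeaModes N (σ n), j) := by
  by_contra! hne
  refine hq ?_
  rw [fermiSeaWave, amplitude_smul, amplitude, inner_sum]
  refine mul_eq_zero_of_right _ (Finset.sum_eq_zero fun σ _ => ?_)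
  rw [← amplitude, amplitude_smul, amplitude_planeWave, if_neg (hne σ), mul_zero]

theorem sq_norm_sum_sign_smul_planeWave (j : ℤ) :
    ‖∑ σ : Equiv.Perm (Fin N), ((Equiv.Perm.sign σ : ℤ) : ℂ) •
      planeWave (L := L) (fun n => fermiSeaModes N (σ n), j)‖ ^ 2 = N.factorial := by
  have hinj : Function.Injective fun σ : Equiv.Perm (Fin N) =>
      ((fun n => fermiSeaModes N (σ n), j) : Mode N) := fun σ τ h =>
    Equiv.ext fun n => fermiSeaModes_injective (congrFun (congrArg Prod.fst h) n)
  have hsign (σ : Equiv.Perm (Fin N)) :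
      conj ((Equiv.Perm.sign σ : ℤ) : ℂ) * ((Equiv.Perm.sign σ : ℤ) : ℂ) = 1 := by
    rw [map_intCast, ← Int.cast_mul, ← Units.val_mul, Int.units_mul_self, Units.val_one,
      Int.cast_one]
  have hinner := ((orthonormal_planeWave (L := L)).comp _ hinj).inner_sum
    (fun σ => ((Equiv.Perm.sign σ : ℤ) : ℂ)) (fun σ => ((Equiv.Perm.sign σ : ℤ) : ℂ)) Finset.univ
  simp only [Function.comp_apply, hsign, Finset.sum_const, Finset.card_univ, Fintype.card_perm,
    Fintype.card_fin, nsmul_eq_mul, mul_one, inner_self_eq_norm_sq_to_K] at hinner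
  exact Complex.ofReal_injective (by simpa using hinner)

theorem norm_fermiSeaWave (j : ℤ) : ‖fermiSeaWave N L j‖ = 1 := by
  rw [fermiSeaWave, norm_smul, norm_inv, Complex.norm_of_nonneg (Real.sqrt_nonneg _),
    ← Real.sqrt_sq (norm_nonneg (∑ σ, _)), sq_norm_sum_sign_smul_planeWave]
  exact inv_mul_cancel₀ (Real.sqrt_ne_zero'.2 (by positivity))

theorem hasTotalMomentum_fermiSeaWave (hN : Odd N) (j : ℤ) :
    HasTotalMomentum j (fermiSeaWave N L j) := by
  intro q hq
  obtain ⟨σ, rfl⟩ := exists_perm_of_amplitude_fermiSeaWave_ne_zero hq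
  obtain ⟨M, rfl⟩ := hN
  rw [Equiv.sum_comp σ (fermiSeaModes (2 * M + 1)), sum_comp_fermiSeaModes M fun m => m,
    sum_Icc_neg_self, zero_add]

theorem kineticEnergy_mul_amplitude_fermiSeaWave (hN : Odd N) (mh mi : ℝ) (j : ℤ) (q : Mode N) :
    kineticEnergy L mh mi q * ‖amplitude (fermiSeaWave N L j) q‖ ^ 2 =
      ringMomentum L j ^ 2 / (2 * mi) * ‖amplitude (fermiSeaWave N L j) q‖ ^ 2 := by
  by_cases hq : amplitude (fermiSeaWave N L j) q = 0
  · simp [hq]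
  obtain ⟨σ, rfl⟩ := exists_perm_of_amplitude_fermiSeaWave_ne_zero hq
  rw [kineticEnergy, hostShift_eq_sum_fermiSeaModes hN]
  simp only
  rw [Equiv.sum_comp σ fun n => ringMomentum L (fermiSeaModes N n) ^ 2 / (2 * mh), sub_self,
    zero_add]

theorem finiteKineticEnergy_fermiSeaWave (hN : Odd N) (mh mi : ℝ) (j : ℤ) :
    FiniteKineticEnergy mh mi (fermiSeaWave N L j) := by
  simp only [FiniteKineticEnergy, kineticEnergy_mul_amplitude_fermiSeaWave hN]
  exact (hasSum_sq_norm_amplitude _).summable.mul_left _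

theorem re_kineticForm_fermiSeaWave (hN : Odd N) (mh mi : ℝ) (j : ℤ) :
    (kineticForm mh mi (fermiSeaWave N L j) (fermiSeaWave N L j)).re =
      ringMomentum L j ^ 2 / (2 * mi) := by
  have hsum := (hasSum_sq_norm_amplitude (fermiSeaWave N L j)).mul_left
    (ringMomentum L j ^ 2 / (2 * mi))
  simp only [← kineticEnergy_mul_amplitude_fermiSeaWave hN mh, norm_fermiSeaWave, one_pow,
    mul_one] at hsum
  exact (finiteKineticEnergy_fermiSeaWave hN mh mi j).hasSum.unique hsum

theorem isPairDensity_fermiSeaWave (n : Fin N) (j : ℤ) :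
    IsPairDensity n (fermiSeaWave N L j) (fermiSeaWave N L j)
      (ContinuousMap.const _ ((L⁻¹ : ℝ) : ℂ)) := by
  have hL : (L : ℂ) ≠ 0 := Complex.ofReal_ne_zero.2 (Fact.out : 0 < L).ne'
  refine isPairDensity_iff_hasSum.2 fun m => ?_
  simp only [ContinuousMap.const_apply, integral_mul_const, integral_fourier]
  rcases eq_or_ne m 0 with rfl | hm
  · have hsum := hasSum_conj_amplitude_mul (fermiSeaWave N L j) (fermiSeaWave N L j)
    rw [inner_self_eq_norm_sq_to_K, norm_fermiSeaWave] at hsum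
    simpa [shiftMode, hL] using hsum
  · rw [if_neg hm, zero_mul]
    convert hasSum_zero using 2 with q
    by_contra hne
    obtain ⟨hshift, hq⟩ := mul_ne_zero_iff.1 hne
    obtain ⟨σ, hσ⟩ := exists_perm_of_amplitude_fermiSeaWave_ne_zero hq
    obtain ⟨τ, hτ⟩ := exists_perm_of_amplitude_fermiSeaWave_ne_zero
      (mt (fun h => by rw [h, map_zero]) hshift)
    have himpurity : q.2 = j := congrArg Prod.snd hσ
    have himpurity_shift : q.2 - m = j := congrArg Prod.snd hτ
    omega

theorem potentialEnergy_fermiSeaWave (U : SignedMeasure (AddCircle L)) (j : ℤ) :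
    potentialEnergy U (fermiSeaWave N L j) = N * U Set.univ / L := by
  have hconst : signedIntegral U (ContinuousMap.const (AddCircle L) ((L⁻¹ : ℝ) : ℂ)) =
      ((U Set.univ / L : ℝ) : ℂ) := by
    rw [U.apply_eq_posPart_real_sub_negPart_real MeasurableSet.univ]
    simp only [signedIntegral, ContinuousMap.const_apply, integral_const, Complex.real_smul]
    push_cast
    ring
  rw [potentialEnergy, IsPairDensity.potentialForm_eq U fun n => isPairDensity_fermiSeaWave n j,
    hconst, Finset.sum_const, Finset.card_univ, Fintype.card_fin, nsmul_eq_mul,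
    ← Complex.ofReal_natCast, ← Complex.ofReal_mul, Complex.ofReal_re, mul_div_assoc]

end FermiSea

section Repulsive

theorem negPart_toJordanDecomposition_eq_zero {α : Type*} [MeasurableSpace α]
    {U : SignedMeasure α} (hU : 0 ≤ U) : U.toJordanDecomposition.negPart = 0 := by
  have hpos : VectorMeasure.restrict 0 Set.univ ≤ VectorMeasure.restrict U Set.univ := by
    simpa only [VectorMeasure.restrict_univ] using hU
  let decomposition : JordanDecomposition α :=
    { posPart := U.toMeasureOfZeroLE Set.univ MeasurableSet.univ hpos
      negPart := 0
      mutuallySingular := Measure.MutuallySingular.zero_right }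
  have heq : U = decomposition.toSignedMeasure := by
    rw [JordanDecomposition.toSignedMeasure]
    simp only [decomposition, SignedMeasure.toMeasureOfZeroLE_toSignedMeasure,
      Measure.toSignedMeasure_zero, sub_zero]
  rw [SignedMeasure.toJordanDecomposition_eq heq]

theorem nonneg_of_forall_integral_mul_nonneg {X : Type*} [TopologicalSpace X] [CompactSpace X]
    [MeasurableSpace X] [OpensMeasurableSpace X] {μ : Measure X} [IsFiniteMeasureOnCompacts μ]
    [μ.IsOpenPosMeasure] {f : C(X, ℝ)} (hf : ∀ g : C(X, ℝ), 0 ≤ g → 0 ≤ ∫ x, g x * f x ∂μ) :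
    0 ≤ f := by
  intro x
  by_contra! hx
  let g : C(X, ℝ) := ⟨fun x => max (-f x) 0, by fun_prop⟩
  have hmul : ∀ x, g x * f x = -(g x ^ 2) := fun x => by
    change max (-f x) 0 * f x = -(max (-f x) 0 ^ 2)
    rcases max_cases (-f x) 0 with ⟨h, -⟩ | ⟨h, -⟩ <;> rw [h] <;> ring
  have hgx : g x ^ 2 ≠ 0 := pow_ne_zero 2 (lt_max_of_lt_left (neg_pos.2 hx)).ne'
  have hpos : 0 < ∫ x, g x ^ 2 ∂μ :=
    Continuous.integral_pos_of_hasCompactSupport_nonneg_nonzero (by fun_prop)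
      (HasCompactSupport.of_compactSpace _) (fun x => sq_nonneg (g x)) hgx
  have hnonneg := hf g fun x => le_max_right _ _
  simp only [hmul, integral_neg] at hnonneg
  linarith

variable {N : ℕ} {L : ℝ} [Fact (0 < L)]

theorem IsPairDensity.re_nonneg {n : Fin N} {ψ : WaveFn N L} {ρ : C(AddCircle L, ℂ)}
    (hρ : IsPairDensity n ψ ψ ρ) (y : AddCircle L) : 0 ≤ (ρ y).re := by
  suffices h : 0 ≤ (⟨fun y => (ρ y).re, by fun_prop⟩ : C(AddCircle L, ℝ)) from h y
  refine nonneg_of_forall_integral_mul_nonneg (μ := volume) fun g hg => ?_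
  let h : C(AddCircle L, ℂ) := ⟨fun y => (g y : ℂ), by fun_prop⟩
  have hre : ∫ y, g y * (ρ y).re = (∫ y, h y * ρ y).re := by
    refine Eq.trans ?_ (integral_re (integrable_continuousMap volume (h * ρ)))
    exact integral_congr_ae (.of_forall fun y => (Complex.re_ofReal_mul _ _).symm)
  have hreal : ∫ x : Config N L, h (x.1 n - x.2) * (conj (ψ x) * ψ x) =
      ((∫ x : Config N L, g (x.1 n - x.2) * ‖ψ x‖ ^ 2 : ℝ) : ℂ) := by
    rw [← integral_complex_ofReal]
    refine integral_congr_ae (.of_forall fun x => ?_)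
    simp only [Complex.conj_mul', Complex.ofReal_mul, Complex.ofReal_pow]
    rfl
  change 0 ≤ ∫ y, g y * (ρ y).re
  rw [hre, ← hρ h, hreal, Complex.ofReal_re]
  exact integral_nonneg fun x => mul_nonneg (hg _) (sq_nonneg _)

theorem re_pairDensity_nonneg (n : Fin N) (ψ : WaveFn N L) (y : AddCircle L) :
    0 ≤ (pairDensity n ψ ψ y).re := by
  by_cases hex : ∃ ρ, IsPairDensity n ψ ψ ρ
  · obtain ⟨ρ, hρ⟩ := hex
    rw [hρ.pairDensity_eq]
    exact hρ.re_nonneg y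
  · rw [pairDensity, dif_neg hex, ContinuousMap.zero_apply, Complex.zero_re]

theorem potentialEnergy_nonneg {U : SignedMeasure (AddCircle L)} (hU : 0 ≤ U) (ψ : WaveFn N L) :
    0 ≤ potentialEnergy U ψ := by
  rw [potentialEnergy, potentialForm, Complex.re_sum]
  refine Finset.sum_nonneg fun n _ => ?_
  rw [signedIntegral, negPart_toJordanDecomposition_eq_zero hU, integral_zero_measure, sub_zero]
  exact (integral_nonneg fun y => re_pairDensity_nonneg n ψ y).trans_eq
    (integral_re (integrable_continuousMap U.toJordanDecomposition.posPart (pairDensity n ψ ψ)))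

end Repulsive

section InfiniteTimeMomentum

theorem timeAverage_ofReal (f : ℝ → ℝ) (t : ℝ) :
    timeAverage (fun s => (f s : ℂ)) t = ((t⁻¹ * ∫ s in (0 : ℝ)..t, f s : ℝ) : ℂ) := by
  rw [timeAverage, intervalIntegral.integral_ofReal, Complex.real_smul, Complex.ofReal_mul]

theorem sub_inv_mul_le_tsum_of_linear_le {ι : Type*} {w K V m : ι → ℝ} {A K₀ V₀ p : ℝ}
    (hA : 0 < A) (hw₀ : 0 ≤ w) (hw : HasSum w 1)
    (henergy : HasSum (fun i => w i * (K i + V i)) (K₀ + V₀))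
    (hV : Summable fun i => w i * V i) (hm : Summable fun i => w i * m i)
    (hle : ∀ i, K₀ + A * (p - m i) ≤ K i) :
    p - A⁻¹ * (V₀ - ∑' i, w i * V i) ≤ ∑' i, w i * m i := by
  have hlinear := (hw.mul_left (K₀ + A * p)).sub (hm.hasSum.mul_left A)
  have hkinetic := henergy.sub hV.hasSum
  have hmean := hasSum_le (fun i => by linarith [mul_le_mul_of_nonneg_left (hle i) (hw₀ i)])
    hlinear hkinetic
  have hscaled : A * (p - ∑' i, w i * m i) ≤ V₀ - ∑' i, w i * V i := by linarith
  linarith [(le_inv_mul_iff₀ hA).2 hscaled]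

variable {N : ℕ} {L : ℝ} [Fact (0 < L)] {mh mi Λ : ℝ} {U : SignedMeasure (AddCircle L)}
  {J V Q : FermiSpace N L →L[ℂ] FermiSpace N L} {ι : Type*} {E : ι → ℝ} {v : ι → FermiSpace N L}
  {x : FermiSpace N L}

namespace IsFormRealization

theorem meanMomentum_eq (h : IsFormRealization mh mi U Λ J V Q) (x : FermiSpace N L) :
    (meanMomentum (J x : WaveFn N L) : ℂ) = inner ℂ x (Q x) := by
  rw [meanMomentum, Complex.ofReal_tsum]
  exact (h.hasSum_momentum x).tsum_eq

theorem potentialEnergy_eq (h : IsFormRealization mh mi U Λ J V Q) (x : FermiSpace N L) :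
    potentialEnergy U (J x : WaveFn N L) = (inner ℂ x (V x) : ℂ).re := by
  rw [h.inner_potential, potentialEnergy]

theorem sq_norm_eq (h : IsFormRealization mh mi U Λ J V Q) (x : FermiSpace N L) :
    ‖x‖ ^ 2 = (kineticForm mh mi (J x : WaveFn N L) (J x : WaveFn N L)).re +
      potentialEnergy U (J x : WaveFn N L) + Λ * ‖J x‖ ^ 2 := by
  have hself : ∀ y : FermiSpace N L, (inner ℂ y y : ℂ) = ((‖y‖ ^ 2 : ℝ) : ℂ) := fun y =>
    (inner_self_eq_norm_sq_to_K (𝕜 := ℂ) y).trans (Complex.ofReal_pow _ 2).symm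
  have hform := congrArg Complex.re (h.form_eq x x)
  rw [hself, hself] at hform
  norm_cast at hform
  exact hform.symm

theorem summable_potentialEnergy (h : IsFormRealization mh mi U Λ J V Q)
    (hv : IsEigenfamily J Λ E v) (hx : HasSum (fun i => inner ℂ (J (v i)) (J x) • v i) x) :
    Summable fun i => ‖inner ℂ (J (v i)) (J x)‖ ^ 2 *
      potentialEnergy U (J (v i) : WaveFn N L) := by
  refine (Complex.reCLM.summable (hv.summable_sq_norm_inner_mul_inner hx V)).congr fun i => ?_
  rw [h.potentialEnergy_eq, Complex.reCLM_apply, ← Complex.ofReal_pow, Complex.re_ofReal_mul]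

theorem summable_meanMomentum (h : IsFormRealization mh mi U Λ J V Q)
    (hv : IsEigenfamily J Λ E v) (hx : HasSum (fun i => inner ℂ (J (v i)) (J x) • v i) x) :
    Summable fun i => ‖inner ℂ (J (v i)) (J x)‖ ^ 2 * meanMomentum (J (v i) : WaveFn N L) := by
  have hsum := hv.summable_sq_norm_inner_mul_inner hx Q
  simp only [← h.meanMomentum_eq] at hsum
  exact_mod_cast hsum

theorem isInfiniteTimeMomentum (h : IsFormRealization mh mi U Λ J V Q) (hmh : 0 ≤ mh)
    (hmi : 0 < mi) (hv : IsEigenfamily J Λ E v)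
    (hx : HasSum (fun i => inner ℂ (J (v i)) (J x) • v i) x)
    {W : ℝ → (FermiSpace N L ≃ₗᵢ[ℂ] FermiSpace N L)}
    (hW : ∀ t i, W t (J (v i)) = (phase (E i) t : ℂ) • J (v i)) :
    IsInfiniteTimeMomentum W (J x)
      (∑' i, ‖inner ℂ (J (v i)) (J x)‖ ^ 2 * meanMomentum (J (v i) : WaveFn N L)) := by
  obtain ⟨u, hu, hJu, hlim⟩ := hv.exists_tendsto_timeAverage hx Q hW
  have hcont : Continuous fun t => meanMomentum (J (u t) : WaveFn N L) := by
    have hre : ∀ y, meanMomentum (J y : WaveFn N L) = (inner ℂ y (Q y) : ℂ).re := fun y => by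
      rw [← h.meanMomentum_eq, Complex.ofReal_re]
    simp only [hre]
    exact Complex.continuous_re.comp (hu.inner (𝕜 := ℂ) (Q.continuous.comp hu))
  simp only [← h.meanMomentum_eq] at hlim
  refine ⟨fun t => ?_, fun t => ?_, ?_⟩
  · rw [← hJu]
    exact ((h.finiteKineticEnergy_iff _).2 ⟨_, rfl⟩).inMomentumDomain hmh hmi
  · simp only [← hJu]
    exact hcont.intervalIntegrable 0 t
  · simp only [← hJu]
    rw [← tendsto_ofReal_iff]
    simp only [← timeAverage_ofReal]
    exact_mod_cast hlim

theorem sub_mul_le_tsum_meanMomentum (h : IsFormRealization mh mi U Λ J V Q) (hN : Odd N)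
    (hmh : 0 < mh) (hmi : 0 < mi) {j : ℤ} (hlt : ringMomentum L j < criticalMomentum N L mh mi)
    (hv : IsEigenfamily J Λ E v) (hvj : ∀ i, HasTotalMomentum j (J (v i) : WaveFn N L))
    (hx : HasSum (fun i => inner ℂ (J (v i)) (J x) • v i) x) (hJx : J x = initialState N L j) :
    ringMomentum L j - mi / (criticalMomentum N L mh mi - ringMomentum L j) *
      (potentialEnergy U (J x : WaveFn N L) - ∑' i, ‖inner ℂ (J (v i)) (J x)‖ ^ 2 *
        potentialEnergy U (J (v i) : WaveFn N L)) ≤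
      ∑' i, ‖inner ℂ (J (v i)) (J x)‖ ^ 2 * meanMomentum (J (v i) : WaveFn N L) := by
  have hnorm : ‖J x‖ = 1 := by rw [hJx]; exact norm_fermiSeaWave j
  have hkinetic : (kineticForm mh mi (J x : WaveFn N L) (J x : WaveFn N L)).re =
      ringMomentum L j ^ 2 / (2 * mi) := by
    rw [hJx]
    exact re_kineticForm_fermiSeaWave hN mh mi j
  have hweights := hasSum_sq_norm_inner_map hx
  have henergy := hv.hasSum_sq_norm_inner_mul hx
  simp only [← hv.norm_sq, h.sq_norm_eq, hv.norm_eq_one, hnorm, hkinetic] at hweights henergy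
  have hshift := henergy.sub (hweights.mul_right (Λ * 1 ^ 2))
  simp only [← mul_sub, add_sub_cancel_right, one_pow, one_mul] at hweights hshift
  rw [← inv_div]
  exact sub_inv_mul_le_tsum_of_linear_le (div_pos (sub_pos.2 hlt) hmi) (fun i => sq_nonneg _)
    hweights hshift (h.summable_potentialEnergy hv hx) (h.summable_meanMomentum hv hx) fun i =>
      linear_meanMomentum_le_kineticForm hN hmh hmi ((h.finiteKineticEnergy_iff _).2 ⟨_, rfl⟩)
        (hvj i) (hv.norm_eq_one i)

end IsFormRealization

theorem exists_isInfiniteTimeMomentum (hN : Odd N) (hmh : 0 < mh) (hmi : 0 < mi) {j : ℤ}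
    (hlt : ringMomentum L j < criticalMomentum N L mh mi) (hnd : NondegenerateSector N mh mi U j)
    {Ψ : sectorEigenvalues N mh mi U j → FermiSpace N L}
    (hΨ : ∀ E, ‖Ψ E‖ = 1 ∧ IsSectorEigenvector mh mi U j E (Ψ E))
    {W : ℝ → (FermiSpace N L ≃ₗᵢ[ℂ] FermiSpace N L)} (hW : IsEvolution mh mi U W) :
    ∃ pInf, IsInfiniteTimeMomentum W (initialState N L j) pInf ∧
      (Summable fun E => ‖(inner ℂ (initialState N L j) (Ψ E) : ℂ)‖ ^ 2 *
        potentialEnergy U (Ψ E : WaveFn N L)) ∧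
      ringMomentum L j - mi / (criticalMomentum N L mh mi - ringMomentum L j) *
        (potentialEnergy U (initialState N L j : WaveFn N L) -
          ∑' E, ‖(inner ℂ (initialState N L j) (Ψ E) : ℂ)‖ ^ 2 *
            potentialEnergy U (Ψ E : WaveFn N L)) ≤ pInf := by
  obtain ⟨Λ, J, V, Q, h⟩ := exists_isFormRealization N hmh hmi U
  obtain ⟨v, hv, hJv⟩ := h.exists_isEigenfamily Subtype.val_injective (fun E => (hΨ E).1)
    fun E => (hΨ E).2.2
  obtain ⟨x, hJx⟩ := (h.finiteKineticEnergy_iff (initialState N L j)).1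
    (finiteKineticEnergy_fermiSeaWave hN mh mi j)
  have hvj : ∀ E, HasTotalMomentum j (J (v E) : WaveFn N L) := fun E => by
    rw [hJv]
    exact (hΨ E).2.1
  have hx : HasSum (fun E => inner ℂ (J (v E)) (J x) • v E) x := h.hasSum_inner_smul hnd hv hvj (by
    rw [hJx]
    exact hasTotalMomentum_fermiSeaWave hN j)
  have hphase : ∀ t E, W t (J (v E)) = (phase E.1 t : ℂ) • J (v E) := fun t E => by
    rw [hJv]
    exact (isEvolution_iff.1 hW).apply_eigenvector (hΨ E).2.2 t
  have hswap : ∀ E, ‖(inner ℂ (J x) (J (v E)) : ℂ)‖ = ‖inner ℂ (J (v E)) (J x)‖ := fun E =>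
    norm_inner_symm (𝕜 := ℂ) (J x) (J (v E))
  simp only [← hJx, ← hJv, hswap]
  exact ⟨_, h.isInfiniteTimeMomentum hmh.le hmi hv hx hphase, h.summable_potentialEnergy hv hx,
    h.sub_mul_le_tsum_meanMomentum hN hmh hmi hlt hv hvj hx hJx⟩

end InfiniteTimeMomentum

section FermiMomentum

variable {N : ℕ} {L : ℝ}

theorem one_lt_of_criticalMomentum_pos (hL : 0 ≤ L) {mh mi : ℝ}
    (h : 0 < criticalMomentum N L mh mi) : 1 < N := by
  by_contra! hN
  have hN' : (N : ℝ) - 1 ≤ 0 := sub_nonpos.2 (by exact_mod_cast hN)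
  refine (h.trans_le (min_le_left _ _)).not_ge ?_
  exact mul_nonpos_of_nonneg_of_nonpos (by positivity)
    (div_nonpos_of_nonpos_of_nonneg hN' two_pos.le)

theorem mul_fermiMomentum_mul_div (hN : 1 < N) (m u d : ℝ) :
    m * fermiMomentum N L * u / (Real.pi * d) * ((N : ℝ) / ((N : ℝ) - 1)) =
      m / d * (N * u / L) := by
  have hN' : (N : ℝ) - 1 ≠ 0 := sub_ne_zero.2 (by exact_mod_cast hN.ne')
  rw [fermiMomentum]
  field_simp

end FermiMomentum

end ImpurityGas

end

theorem mainTheorem1_general (N : ℕ) (hN : Odd N) (hN1 : 1 < N) (L : ℝ) [Fact (0 < L)] (mh mi : ℝ)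
    (hmh : 0 < mh) (hmi : 0 < mi) (U : SignedMeasure (AddCircle L))
    (j₀ : ℤ) (p₀ : ℝ) (hp₀ : p₀ = ringMomentum L j₀) (hlt : p₀ < criticalMomentum N L mh mi)
    (hnd : NondegenerateSector N mh mi U j₀)
    (Ψ : sectorEigenvalues N mh mi U j₀ → FermiSpace N L)
    (hΨ : ∀ E, ‖Ψ E‖ = 1 ∧ IsSectorEigenvector mh mi U j₀ E (Ψ E)) :
    (∃! W, IsEvolution (N := N) mh mi U W) ∧
    ∀ W, IsEvolution (N := N) mh mi U W →
      ∃ pInf : ℝ, IsInfiniteTimeMomentum W (initialState N L j₀) pInf ∧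
        (Summable fun E => ‖(inner ℂ (initialState N L j₀) (Ψ E) : ℂ)‖ ^ 2 *
          potentialEnergy U (Ψ E : WaveFn N L)) ∧
        pInf ≥ p₀ - mi / (criticalMomentum N L mh mi - p₀) *
          (potentialEnergy U (initialState N L j₀ : WaveFn N L) -
            ∑' E, ‖(inner ℂ (initialState N L j₀) (Ψ E) : ℂ)‖ ^ 2 *
              potentialEnergy U (Ψ E : WaveFn N L)) ∧
        (0 ≤ U →
          pInf ≥ p₀ - mi * fermiMomentum N L * U Set.univ /
              (Real.pi * (criticalMomentum N L mh mi - p₀)) * ((N : ℝ) / ((N : ℝ) - 1))) := by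
  subst hp₀
  obtain ⟨Λ, J, V, Q, h⟩ := exists_isFormRealization N hmh hmi U
  refine ⟨h.existsUnique_isEvolution, fun W hW => ?_⟩
  obtain ⟨pInf, hpInf, hsummable, hbound⟩ :=
    exists_isInfiniteTimeMomentum hN hmh hmi hlt hnd hΨ hW
  refine ⟨pInf, hpInf, hsummable, hbound, fun hU => le_trans ?_ hbound⟩
  have hcoef : 0 ≤ mi / (criticalMomentum N L mh mi - ringMomentum L j₀) :=
    (div_pos hmi (sub_pos.2 hlt)).le
  have hdiagonal : 0 ≤ ∑' E, ‖(inner ℂ (initialState N L j₀) (Ψ E) : ℂ)‖ ^ 2 *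
      potentialEnergy U (Ψ E : WaveFn N L) :=
    tsum_nonneg fun E => mul_nonneg (sq_nonneg _) (potentialEnergy_nonneg hU _)
  rw [mul_fermiMomentum_mul_div hN1, ← potentialEnergy_fermiSeaWave U j₀]
  exact sub_le_sub_left (mul_le_mul_of_nonneg_left (sub_le_self _ hdiagonal) hcoef) _

theorem mainTheorem1 (N : ℕ) (hN : Odd N) (L : ℝ) [Fact (0 < L)] (mh mi : ℝ)
    (hmh : 0 < mh) (hmi : 0 < mi) (U : SignedMeasure (AddCircle L))
    (j₀ : ℤ) (p₀ : ℝ) (hp₀ : p₀ = ringMomentum L j₀)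
    (hpos : 0 < p₀) (hlt : p₀ < criticalMomentum N L mh mi)
    (hnd : NondegenerateSector N mh mi U j₀)
    (Ψ : sectorEigenvalues N mh mi U j₀ → FermiSpace N L)
    (hΨ : ∀ E, ‖Ψ E‖ = 1 ∧ IsSectorEigenvector mh mi U j₀ E (Ψ E)) :
    (∃! W, IsEvolution (N := N) mh mi U W) ∧
    ∀ W, IsEvolution (N := N) mh mi U W →
      ∃ pInf : ℝ, IsInfiniteTimeMomentum W (initialState N L j₀) pInf ∧
        (Summable fun E => ‖(inner ℂ (initialState N L j₀) (Ψ E) : ℂ)‖ ^ 2 *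
          potentialEnergy U (Ψ E : WaveFn N L)) ∧
        pInf ≥ p₀ - mi / (criticalMomentum N L mh mi - p₀) *
          (potentialEnergy U (initialState N L j₀ : WaveFn N L) -
            ∑' E, ‖(inner ℂ (initialState N L j₀) (Ψ E) : ℂ)‖ ^ 2 *
              potentialEnergy U (Ψ E : WaveFn N L)) ∧
        (0 ≤ U →
          pInf ≥ p₀ - mi * fermiMomentum N L * U Set.univ /
              (Real.pi * (criticalMomentum N L mh mi - p₀)) * ((N : ℝ) / ((N : ℝ) - 1))) := by
  have hN1 : 1 < N := one_lt_of_criticalMomentum_pos (Fact.out : 0 < L).le (hpos.trans hlt)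
  exact mainTheorem1_general N hN hN1 L mh mi hmh hmi U j₀ p₀ hp₀ hlt hnd Ψ hΨ
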